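/- \textbf{Model.} Fix $m>0$, $a>0$, an integer $\mathfrak q\ge 1$ and $c_H>0$, $D_H\in\mathbb R$. Let $\mathbf h_0=\nabla^*\mathbf H\nabla$ on $\mathbb Z^3$, where $\nabla$ is the forward lattice gradient and $\mathbf H$ is a real, symmetric, translation invariant operator on functions of the (nearest neighbour) bonds of $\mathbb Z^3$, $\mathbf H\ge c_H$ in the sense that its $3\times 3$ Fourier symbol is bounded below by $c_H$ at every momentum, with $\sum_{i,j}\sum_{x\in\mathbb Z^3}e^{m|x|}\,|\mathbf H(b_i(x),b_j(0))|\le D_H$ ($b_i(x)$ is the bond from $x$ to $x+e_i$). Let $L_{\rm tp},L_{\rm sp}\ge1$ be integers, $\boldsymbol{\mathcal X}_0=(\mathbb Z/L_{\rm tp}\mathbb Z)\times\mathbb Z^3$, $\mathcal X_0=(\mathbb Z/L_{\rm tp}\mathbb Z)\times(\mathbb Z^3/L_{\rm sp}\mathbb Z^3)$, and let $\partial_0$ be the forward time derivative, $\mathbf D_0=1-e^{-\mathbf h_0}-e^{-\mathbf h_0}\partial_0$ on $\boldsymbol{\mathcal X}_0$, and $D_0$ its spatial periodization, acting on functions on $\mathcal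 X_0$. Put $$\mathbf D_0^{-1}(x,0)=\frac1{L_{\rm tp}}\sum_{k_0\in\frac{2\pi}{L_{\rm tp}}\mathbb Z/2\pi\mathbb Z}\ \int_{\mathbb R^3/2\pi\mathbb Z^3}\frac{d^3\mathbf k}{(2\pi)^3}\ \frac{e^{ik\cdot x}}{1-e^{-\hat{\mathbf h}_0(\mathbf k)}e^{ik_0}} .$$ Let $\mathbf V_0(x_1,x_2,x_3,x_4)$ be a (real or complex) translation invariant kernel on $\boldsymbol{\mathcal X}_0$ with $\mathfrak v_0=2\|\mathbf V_0\|_{2m}<\infty$, where $$\|\mathbf V_0\|_{2m}=\max_{1\le i\le4}\ \sup_{x_i}\sum_{x_j,\,j\ne i}|\mathbf V_0(x_1,\dots,x_4)|\,e^{2m\tau(x_1,\dots,x_4)}$$ and $\tau$ is the length of the shortest tree in $\boldsymbol{\mathcal X}_0$ having $x_1,\dots,x_4$ among its vertices. Let $V_0$ be its spatial periodization, a kernel on $\mathcal X_0$, and let $$\mu_*=2\sum_{x_1,x_2,x_3\in\boldsymbol{\mathcal X}_0}\mathbf V_0(0,x_1,x_2,x_3)\,\mathbf D_0^{-1}(x_3,0).$$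 \textbf{Scale $n$.} Let $L\ge3$ be odd, and let $n\ge1$ be such that $L^{2n}\mid L_{\rm tp}$ and $L^n\mid L_{\rm sp}$. For $0\le j\le n$ put $$\mathcal X_j^{(n-j)}=\big(L^{-2j}\mathbb Z\big/L_{\rm tp}L^{-2n}\mathbb Z\big)\times\big(L^{-j}\mathbb Z^3\big/L_{\rm sp}L^{-n}\mathbb Z^3\big),\qquad \int_{\mathcal X_j^{(n-j)}}du=L^{-5j}\sum_{u\in \mathcal X_j^{(n-j)}},$$ in particular $\mathcal X_n=\mathcal X_n^{(0)}$ (the fine lattice) and $\mathcal X_0^{(n)}$ (the blocked unit lattice). Let $\mathbb L(u_0,\mathbf u)=(L^2u_0,L\mathbf u)$ and $(\mathbb L_*\alpha)(\mathbb Lu)=\alpha(u)$. Let $D_n=L^{2n}\,\mathbb L_*^{-n}D_0\mathbb L_*^{n}$. Let $q$ be the $\mathfrak q$-fold convolution with itself of the normalized characteristic function of the centred box in $\mathbb Z\times\mathbb Z^3$ with sides of $L^2$ (time) and $L$ (space) points, $(Q\psi)(y)=\sum_{x\in\mathbb Z\times\mathbb Z^3}q(x)\,\psi(y+[x])$ the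 corresponding block spin average from functions on a unit lattice to functions on its sublattice with spacings $(L^2,L,L,L)$, and $Q_0=1$, $Q_j=\mathbb L_*^{-1}QQ_{j-1}\mathbb L_*$, which maps functions on $\mathcal X_j^{(n-j)}$ to functions on $\mathcal X_0^{(n)}$. With adjoints taken with respect to the bilinear forms $\int\alpha_1\alpha_2$, put $$\mathfrak Q_n=a\Big(1+\sum_{j=1}^{n-1}\frac1{L^{2j}}Q_jQ_j^*\Big)^{-1},\qquad S_n=\big(D_n+Q_n^*\mathfrak Q_nQ_n\big)^{-1},$$ let $S_n(u,u')$ be the kernel of $S_n$ with respect to $du'$, and put $V_n^{(u)}(u_1,\dots,u_4)=L^{14n}V_0(\mathbb L^nu_1,\dots,\mathbb L^nu_4)$. For $\mu_0\in\mathbb R$ let $$\mu_n^*=L^{2n}\mu_0-\frac{2}{|\mathcal X_0^{(n)}|}\int_{\mathcal X_n^4}du_1\cdots du_4\ V_n^{(u)}(u_1,u_2,u_3,u_4)\,S_n(u_4,u_1).$$ \textbf{Lemma.} The integrals and the sum that define $\mathbf D_0^{-1}(x,0)$ and $\mu_*$ converge absolutely, and the inverses that define $\mathfrak Q_n$ and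 $S_n$ exist. There is a constant $c_{\mu_*}$, depending only on $m$, $a$, $\mathfrak q$, $c_H$ and $D_H$ (in particular not on $n$, $L$, $L_{\rm tp}$, $L_{\rm sp}$, $\mathbf V_0$, $\mu_0$, nor otherwise on $\mathbf H$), such that $$\big|L^{2n}(\mu_0-\mu_*)-\mu_n^*\big|\le c_{\mu_*}\,\mathfrak v_0$$ for all $n\ge 1$ for which the blocked lattice exists, that is, with $L^{2n}\mid L_{\rm tp}$ and $L^n\mid L_{\rm sp}$; in particular for $1\le n\le n_p$ whenever $L^{2n_p}\mid L_{\rm tp}$ and $L^{n_p}\mid L_{\rm sp}$. -/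

import Mathlib

open scoped BigOperators ENNReal

noncomputable section

namespace ParabolicFlow

/-! ### Lattices

A point `(ε^2 x₀, ε x₁, ε x₂, ε x₃)` of a scaled lattice is represented by its integer coordinates
`(x₀, x₁, x₂, x₃)`. In these coordinates the scaling map `(u₀, u) ↦ (L^2 u₀, L u)` is the identity, and
the lattice spacings enter through the cell volumes. -/

/-- The torus with `T` temporal and `S` points in each spatial direction. It represents the unit
lattice, the fine lattice at scale `n` and the blocked lattices, with the respective sizes. -/
abbrev Lat (T S : ℕ) : Type := ZMod T × (Fin 3 → ZMod S)

/-- The lattice `(ℤ / T ℤ) × ℤ³`. -/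
abbrev BoldLat (T : ℕ) : Type := ZMod T × (Fin 3 → ℤ)

/-- The lattice `ℤ × ℤ³`. -/
abbrev ZLat : Type := ℤ × (Fin 3 → ℤ)

/-- The class in the torus of a point of `ℤ × ℤ³`. -/
def ZLat.proj (T S : ℕ) (x : ZLat) : Lat T S := (x.1, fun i => (x.2 i : ZMod S))

/-- The class in the torus of a point of `(ℤ / T ℤ) × ℤ³`. -/
def BoldLat.proj {T : ℕ} (S : ℕ) (x : BoldLat T) : Lat T S := (x.1, fun i => (x.2 i : ZMod S))

/-- A representative in `ℤ × ℤ³` of a point of the torus. -/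
def Lat.lift {T S : ℕ} (x : Lat T S) : ZLat := ((x.1.val : ℤ), fun i => ((x.2 i).val : ℤ))

/-- A representative in `(ℤ / T ℤ) × ℤ³` of a point of the torus. -/
def Lat.boldLift {T S : ℕ} (x : Lat T S) : BoldLat T := (x.1, fun i => ((x.2 i).val : ℤ))

/-! ### The kinetic energy -/

/-- The Euclidean length of a point of `ℤ³`. -/
def spatialLength (x : Fin 3 → ℤ) : ℝ := Real.sqrt (∑ i, (x i : ℝ) ^ 2)

/-- `k · x` -/
def phase (k : Fin 3 → ℝ) (x : Fin 3 → ℤ) : ℝ := ∑ i, k i * (x i : ℝ)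

/-- The unit vector of `ℤ³` in direction `i`. -/
def unitVec (i : Fin 3) : Fin 3 → ℤ := Pi.single i 1

/-- The Fourier symbol (a `3 × 3` matrix) of a translation invariant operator on functions of the
bonds of `ℤ³`. The kernel of the operator is `H(b_i(x), b_j(y)) = H i j (x - y)`, where `b_i(x)` is the
bond from `x` to `x + e_i`. -/
def bondSymbol (H : Fin 3 → Fin 3 → (Fin 3 → ℤ) → ℝ) (k : Fin 3 → ℝ) :
    Matrix (Fin 3) (Fin 3) ℂ :=
  Matrix.of fun i j => ∑' x : Fin 3 → ℤ, (H i j x : ℂ) * Complex.exp (-(Complex.I * (phase k x : ℂ)))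

/-- `H` is a real, translation invariant, symmetric operator on the bonds of `ℤ³` with exponentially
decaying kernel (its norm with mass `m` is at most `DH`) and bounded below by `cH`. -/
structure IsBondOperator (m cH DH : ℝ) (H : Fin 3 → Fin 3 → (Fin 3 → ℤ) → ℝ) : Prop where
  symm : ∀ i j x, H i j x = H j i (-x)
  summable : Summable fun p : (Fin 3 × Fin 3) × (Fin 3 → ℤ) =>
    |H p.1.1 p.1.2 p.2| * Real.exp (m * spatialLength p.2)
  decay : ∑' p : (Fin 3 × Fin 3) × (Fin 3 → ℤ),
    |H p.1.1 p.1.2 p.2| * Real.exp (m * spatialLength p.2) ≤ DH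
  coercive : ∀ (k : Fin 3 → ℝ) (v : Fin 3 → ℂ),
    cH * ∑ i, ‖v i‖ ^ 2 ≤ (star v ⬝ᵥ (bondSymbol H k).mulVec v).re

/-- The kernel of `h₀ = ∇^* H ∇` on `ℤ³`: `h₀(x, y) = kinetic H (x - y)`, where
`(∇ f)(b_i(x)) = f(x + e_i) - f(x)`. -/
def kinetic (H : Fin 3 → Fin 3 → (Fin 3 → ℤ) → ℝ) (z : Fin 3 → ℤ) : ℝ :=
  ∑ i, ∑ j, (H i j (z - unitVec i + unitVec j) - H i j (z - unitVec i)
    - H i j (z + unitVec j) + H i j z)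

/-- The Fourier symbol of `h₀` on `ℤ³`. -/
def kineticSymbol (H : Fin 3 → Fin 3 → (Fin 3 → ℤ) → ℝ) (k : Fin 3 → ℝ) : ℂ :=
  ∑' z : Fin 3 → ℤ, (kinetic H z : ℂ) * Complex.exp (-(Complex.I * (phase k z : ℂ)))

/-! ### The operator `D₀` on the infinite volume lattice, and its inverse -/

/-- The Fourier symbol of `1 - exp(-h₀) - exp(-h₀) ∂₀` on `(ℤ / T ℤ) × ℤ³`, where `∂₀` is the forward
derivative in the time direction, at the momentum `(k₀, k)`. -/
def boldDSymbol (H : Fin 3 → Fin 3 → (Fin 3 → ℤ) → ℝ) (k0 : ℝ) (k : Fin 3 → ℝ) : ℂ :=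
  1 - Complex.exp (-kineticSymbol H k)
    - Complex.exp (-kineticSymbol H k) * (Complex.exp (Complex.I * (k0 : ℂ)) - 1)

/-- A fundamental domain for `ℝ³ / 2πℤ³`. -/
def momentumCell : Set (Fin 3 → ℝ) := Set.univ.pi fun _ => Set.Ioc (-Real.pi) Real.pi

/-- The integrand in the Fourier representation of `D₀⁻¹(x, 0)`, at the temporal momentum
`2π l / T`. -/
def boldDInvIntegrand (H : Fin 3 → Fin 3 → (Fin 3 → ℤ) → ℝ) (T : ℕ) (x : BoldLat T) (l : Fin T)
    (k : Fin 3 → ℝ) : ℂ :=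
  (boldDSymbol H (2 * Real.pi * (l : ℕ) / T) k)⁻¹
    * Complex.exp (Complex.I *
        ((2 * Real.pi * (l : ℕ) / T * (x.1.val : ℝ) + phase k x.2 : ℝ) : ℂ))

/-- The kernel `D₀⁻¹(x, 0)` on `(ℤ / T ℤ) × ℤ³`. -/
def boldDInv (H : Fin 3 → Fin 3 → (Fin 3 → ℤ) → ℝ) (T : ℕ) (x : BoldLat T) : ℂ :=
  (1 / (T : ℂ)) * ∑ l : Fin T,
    (1 / ((2 * Real.pi) ^ 3 : ℝ) : ℂ) * ∫ k in momentumCell, boldDInvIntegrand H T x l k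

/-! ### The interaction -/

/-- The Euclidean distance on `(ℤ / T ℤ) × ℤ³`. -/
def boldDist {T : ℕ} (x y : BoldLat T) : ℝ :=
  Real.sqrt (((x.1 - y.1).valMinAbs : ℝ) ^ 2 + ∑ i, ((x.2 i : ℝ) - (y.2 i : ℝ)) ^ 2)

open scoped Classical in
/-- The length of a shortest tree in `(ℤ / T ℤ) × ℤ³` which has the points `x i` among its vertices. -/
def treeLength {T : ℕ} {r : ℕ} (x : Fin r → BoldLat T) : ℝ :=
  sInf {l : ℝ | ∃ (N : ℕ) (p : Fin N → BoldLat T) (G : SimpleGraph (Fin N)),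
    G.IsTree ∧ (∀ i, ∃ b, p b = x i) ∧
      l = (1 / 2) * ∑ b, ∑ c, if G.Adj b c then boldDist (p b) (p c) else 0}

/-- The `ℓ¹`-`ℓ^∞` norm with mass `M`: the maximum over `i` of the supremum over `x i` of the sum over
the other arguments of `|V(x)| exp(M τ(x))`, where `τ` is the tree length. -/
def kernelNorm {T : ℕ} (M : ℝ) (V : (Fin 4 → BoldLat T) → ℂ) : ℝ≥0∞ :=
  ⨆ (i : Fin 4) (y : BoldLat T), ∑' x : {x : Fin 4 → BoldLat T // x i = y},
    ENNReal.ofReal (‖V x.1‖ * Real.exp (M * treeLength x.1))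

/-- Translation invariance of a kernel. -/
def TranslationInvariant {T : ℕ} (V : (Fin 4 → BoldLat T) → ℂ) : Prop :=
  ∀ (z : BoldLat T) (x : Fin 4 → BoldLat T), V (fun i => x i + z) = V x

/-- The coupling constant `2 ‖V‖_{2m}`. -/
def coupling {T : ℕ} (m : ℝ) (V : (Fin 4 → BoldLat T) → ℂ) : ℝ := 2 * (kernelNorm (2 * m) V).toReal

open scoped Classical in
/-- The spatial periodization `V₀` of a translation invariant kernel `V`. -/
def periodize {T : ℕ} (S : ℕ) (V : (Fin 4 → BoldLat T) → ℂ) (x : Fin 4 → Lat T S) : ℂ :=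
  ∑' y : Fin 4 → BoldLat T,
    if y 0 = (x 0).boldLift ∧ ∀ i, (y i).proj S = x i then V y else 0

/-- `μ_* = 2 ∫ dx₁ dx₂ dx₃ V(0, x₁, x₂, x₃) D₀⁻¹(x₃, 0)`, the integrals running over
`(ℤ / T ℤ) × ℤ³`. -/
def muStar (H : Fin 3 → Fin 3 → (Fin 3 → ℤ) → ℝ) {T : ℕ} (V : (Fin 4 → BoldLat T) → ℂ) : ℂ :=
  2 * ∑' x : Fin 3 → BoldLat T, V (Fin.cons 0 x) * boldDInv H T (x 2)

/-! ### The operators `D₀` and `D_n` on the torus -/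

open scoped Classical in
/-- The periodization of `h₀`, acting on functions on the torus. -/
def torusKinetic (H : Fin 3 → Fin 3 → (Fin 3 → ℤ) → ℝ) (T S : ℕ) : Matrix (Lat T S) (Lat T S) ℂ :=
  Matrix.of fun x y => if x.1 = y.1 then
    ((∑' z : Fin 3 → ℤ, if (fun i => (z i : ZMod S)) = x.2 - y.2 then kinetic H z else 0 : ℝ) : ℂ)
    else 0

/-- The forward time derivative `(∂₀ ψ)(x₀, x) = ψ(x₀ + 1, x) - ψ(x₀, x)`. -/
def timeDeriv (T S : ℕ) : Matrix (Lat T S) (Lat T S) ℂ :=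
  Matrix.of fun x y => (if y = (x.1 + 1, x.2) then 1 else 0) - (if y = x then 1 else 0)

/-- `D₀ = 1 - exp(-h₀) - exp(-h₀) ∂₀` on the torus. -/
def torusD (H : Fin 3 → Fin 3 → (Fin 3 → ℤ) → ℝ) (T S : ℕ) [NeZero T] [NeZero S] :
    Matrix (Lat T S) (Lat T S) ℂ :=
  1 - NormedSpace.exp (-torusKinetic H T S)
    - NormedSpace.exp (-torusKinetic H T S) * timeDeriv T S

/-- `D_n = L^{2n} 𝕃_*^{-n} D₀ 𝕃_*^n`. -/
def scaledD (H : Fin 3 → Fin 3 → (Fin 3 → ℤ) → ℝ) (L n T S : ℕ) [NeZero T] [NeZero S] :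
    Matrix (Lat T S) (Lat T S) ℂ :=
  (L : ℂ) ^ (2 * n) • torusD H T S

/-! ### Block spin averaging -/

/-- The box with sides of `L²` points in the time and `L` points in each space direction, centred at
the origin (for odd `L`). -/
def blockBox (L : ℕ) : Finset ZLat :=
  Finset.Icc (-(((L : ℤ) ^ 2 - 1) / 2)) (((L : ℤ) ^ 2 - 1) / 2) ×ˢ
    Fintype.piFinset fun _ : Fin 3 => Finset.Icc (-(((L : ℤ) - 1) / 2)) (((L : ℤ) - 1) / 2)

/-- The averaging profile: the `r`-fold convolution with itself of the normalized characteristic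
function of the box. -/
def avgProfile (L : ℕ) : ℕ → ZLat → ℝ
  | 0 => fun x => if x = 0 then 1 else 0
  | r + 1 => fun x => (1 / (L : ℝ) ^ 5) * ∑ z ∈ blockBox L, avgProfile L r (x - z)

/-- One block spin average, `(Q ψ)(y) = ∑_x q(x) ψ(y + x)` with `y = (L² w₀, L w)`, followed by the
scaling that identifies `y` with `w`. -/
def blockAverage (L r : ℕ) (f : ZLat → ℂ) : ZLat → ℂ := fun w =>
  ∑' x : ZLat, (avgProfile L r x : ℂ) *
    f (((L : ℤ) ^ 2 * w.1, fun i => (L : ℤ) * w.2 i) + x)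

open scoped Classical in
/-- `Q_j`, the `j`-fold block spin average, as a matrix. It takes functions on the torus of size
`(T, S) = (L^{2j} T', L^j S')` to functions on the torus of size `(T', S')`; functions on a torus are
regarded as periodic functions on `ℤ × ℤ³`. -/
def blockMatrix (L r j T S T' S' : ℕ) : Matrix (Lat T' S') (Lat T S) ℂ :=
  Matrix.of fun w x =>
    ((blockAverage L r)^[j] fun z => if z.proj T S = x then 1 else 0) w.lift

/-- `Q_j^*`, the transpose of `Q_j` with respect to the bilinear forms `L^{-5j} ∑ α₁ α₂` on the fine
torus (on which each point has volume `L^{-5j}`) and `∑ α₁ α₂` on the unit torus. -/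
def blockAdjoint (L r j T S T' S' : ℕ) : Matrix (Lat T S) (Lat T' S') ℂ :=
  (L : ℂ) ^ (5 * j) • (blockMatrix L r j T S T' S').transpose

/-- `1 + ∑_{j=1}^{n-1} L^{-2j} Q_j Q_j^*` on the torus of size `(T', S')`. -/
def frakQInv (L r n T' S' : ℕ) [NeZero L] [NeZero T'] [NeZero S'] :
    Matrix (Lat T' S') (Lat T' S') ℂ :=
  1 + ∑ j ∈ Finset.Icc 1 (n - 1), (1 / (L : ℂ) ^ (2 * j)) •
    (blockMatrix L r j (L ^ (2 * j) * T') (L ^ j * S') T' S'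
      * blockAdjoint L r j (L ^ (2 * j) * T') (L ^ j * S') T' S')

/-- `𝔔_n = a (1 + ∑_{j=1}^{n-1} L^{-2j} Q_j Q_j^*)⁻¹`. -/
def frakQ (a : ℝ) (L r n T' S' : ℕ) [NeZero L] [NeZero T'] [NeZero S'] :
    Matrix (Lat T' S') (Lat T' S') ℂ :=
  (a : ℂ) • (frakQInv L r n T' S')⁻¹

/-! ### The Green's function `S_n` and `μ_n^*` -/

/-- `D_n + Q_n^* 𝔔_n Q_n`, acting on functions on the fine torus of size `(T, S)`. -/
def greenInv (H : Fin 3 → Fin 3 → (Fin 3 → ℤ) → ℝ) (a : ℝ) (L r n T S T' S' : ℕ)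
    [NeZero L] [NeZero T] [NeZero S] [NeZero T'] [NeZero S'] : Matrix (Lat T S) (Lat T S) ℂ :=
  scaledD H L n T S
    + blockAdjoint L r n T S T' S' * frakQ a L r n T' S' * blockMatrix L r n T S T' S'

/-- The kernel of `S_n = (D_n + Q_n^* 𝔔_n Q_n)⁻¹` with respect to the measure on the fine torus that
gives volume `L^{-5n}` to each point: `(S_n α)(u) = L^{-5n} ∑_{u'} S_n(u, u') α(u')`. -/
def greenKernel (H : Fin 3 → Fin 3 → (Fin 3 → ℤ) → ℝ) (a : ℝ) (L r n T S T' S' : ℕ)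
    [NeZero L] [NeZero T] [NeZero S] [NeZero T'] [NeZero S'] (u u' : Lat T S) : ℂ :=
  (L : ℂ) ^ (5 * n) * (greenInv H a L r n T S T' S')⁻¹ u u'

/-- The kernel of the `n`-fold scaled interaction, `V_n^{(u)}(u) = L^{14n} V₀(𝕃^n u)`. -/
def scaledInteraction {T : ℕ} (L n S : ℕ) (V : (Fin 4 → BoldLat T) → ℂ) (u : Fin 4 → Lat T S) : ℂ :=
  (L : ℂ) ^ (14 * n) * periodize S V u

/-- `μ_n^* = L^{2n} μ₀ - (2 / |X₀^{(n)}|) ∫ du₁ ⋯ du₄ V_n^{(u)}(u₁, u₂, u₃, u₄) S_n(u₄, u₁)`, where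
`X₀^{(n)}` is the unit torus of size `(T', S')`, and the integrals run over the fine torus of size
`(T, S)`, with volume `L^{-5n}` for each point. -/
def muStarN (H : Fin 3 → Fin 3 → (Fin 3 → ℤ) → ℝ) (a : ℝ) (L r n : ℕ) {T : ℕ} (S T' S' : ℕ)
    [NeZero L] [NeZero T] [NeZero S] [NeZero T'] [NeZero S']
    (V : (Fin 4 → BoldLat T) → ℂ) (μ₀ : ℝ) : ℂ :=
  (L : ℂ) ^ (2 * n) * (μ₀ : ℂ)
    - 2 / (Fintype.card (Lat T' S') : ℂ) *
      ((1 / (L : ℂ) ^ (5 * n)) ^ 4 * ∑ u : Fin 4 → Lat T S,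
        scaledInteraction L n S V u * greenKernel H a L r n T S T' S' (u 3) (u 0))

end ParabolicFlow

end

open ParabolicFlow

/-!
All operators are translation invariant up to the blocking, so the comparison is made in momentum
space. Let `ε(k)` be the symbol of the kinetic energy, `d = 1 - exp(-ε(k)) exp(i k₀)` the symbol of
`D₀` and `G` the inverse of `D_n + Q_n^* 𝔔_n Q_n` as a matrix, on a fine torus with `T S³` points.
Collecting the volume factors and using translation invariance of the interaction, one finds that
`L^{2n} (μ₀ - μ_*) - μ_n^*` equals `2 ∑_x V(0, x) Ψ(x₃)` with

  `Ψ(y) = L^{4n} (T S³)⁻¹ ∑_u G(u + y, u) - L^{2n} D₀⁻¹(y, 0)`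

(`GreenSetup.muStarN_eq`). Since a quadratic function of the spatial separation is dominated by
`exp(2m τ)`, where `τ` is the tree length (`one_add_oneLength_sq_le`), it suffices to bound `Ψ(y)`
by a constant times `(1 + |y|)²`. This is `GreenSetup.norm_translate_average_sub_le`.

The average over translates only sees the diagonal coefficients `g(p)` of `G` in the basis of
characters (`average_translates_eq`). In momentum space, the averaging term `Q_n^* 𝔔_n Q_n` is a
positive operator of rank one on each set of fine momenta with the same reduction to the blocked
lattice, so that `g(p)` is given by the resolvent formula for rank one perturbations
(`FibreEquation.diag`). With `A = L^{2n} d` there are three contributions to `Ψ(y)`.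

* The spatially constant modes, `k = 0`. Here `g(p)` is bounded by a constant times
  `min(1, 1 / |A|)`: at small frequencies the averaging term serves as a mass, because the Fourier
  transform of the averaging profile is close to one (`GreenSetup.sum_greenDiag_zero_le`).
* The difference `g - 1 / A` at the modes with `k ≠ 0`. It is at most `a / |A|²`, and at most
  `1 / A` if `k₀ = 0`. With the gap `|d| ≥ c (|k|² + |k₀|)` and `∑_{k ≠ 0} |k|⁻² ≤ C S³`, the sum of
  these terms is bounded (`GreenSetup.sum_greenDiag_sub_inv_le`).
* The difference between the momentum sum of `e^{i p y} / d` over the modes with `k ≠ 0` and the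
  momentum integral that represents `D₀⁻¹(y, 0)`. The momentum torus is cut into `S³` cells
  (`integral_momentumCell_eq_sum`). In the cells away from the origin the midpoint rule applies, its
  error being controlled by second differences of the integrand. In the cell at the origin the sum
  over `k₀` is a geometric series, which leaves the integrable singularity `1 / (T |k|²)`. The total
  is `O((1 + |y|)² (1 / S² + 1 / T))` (`DispersionBounds.norm_sum_char_div_sub_waveInv_le`), and
  `L^{2n} ≤ T`, `L^{2n} ≤ S²`.
-/

open scoped BigOperators ENNReal

set_option linter.unusedSectionVars false

namespace ParabolicFlow

noncomputable section

/-! ### Fourier analysis on the torus -/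

/-- The character `x ↦ exp(2πi (p₀ x₀ / T + p · x / S))` of the torus, symmetric in `p` and `x`. -/
def Lat.char {T S : ℕ} [NeZero T] [NeZero S] (p x : Lat T S) : ℂ :=
  ZMod.stdAddChar (p.1 * x.1) * ∏ i, ZMod.stdAddChar (p.2 i * x.2 i)

section Characters

variable {T S : ℕ} [NeZero T] [NeZero S]

lemma norm_stdAddChar {N : ℕ} [NeZero N] (a : ZMod N) : ‖(ZMod.stdAddChar a : ℂ)‖ = 1 := by
  simp

lemma Lat.char_comm (p x : Lat T S) : p.char x = x.char p := by
  simp only [Lat.char, mul_comm]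

lemma Lat.char_add (p x y : Lat T S) : p.char (x + y) = p.char x * p.char y := by
  simp only [Lat.char, Prod.fst_add, Prod.snd_add, Pi.add_apply, mul_add, AddChar.map_add_eq_mul,
    Finset.prod_mul_distrib]
  ring

@[simp] lemma Lat.char_zero_right (p : Lat T S) : p.char 0 = 1 := by
  simp [Lat.char]

@[simp] lemma Lat.char_zero_left (x : Lat T S) : (0 : Lat T S).char x = 1 := by
  simp [Lat.char]

lemma Lat.norm_char (p x : Lat T S) : ‖p.char x‖ = 1 := by
  simp [Lat.char, norm_prod]

lemma Lat.char_neg (p x : Lat T S) : p.char (-x) = star (p.char x) := by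
  have h : p.char x * p.char (-x) = 1 := by rw [← Lat.char_add]; simp
  have hs : p.char x * star (p.char x) = 1 := by
    rw [Complex.star_def, Complex.mul_conj, Complex.normSq_eq_norm_sq, Lat.norm_char]; simp
  have h0 : p.char x ≠ 0 := by
    intro h0; simpa [h0] using Lat.norm_char p x
  exact mul_left_cancel₀ h0 (h.trans hs.symm)

lemma Lat.card_eq : (Fintype.card (Lat T S) : ℂ) = (T : ℂ) * (S : ℂ) ^ 3 := by
  simp [Lat, Fintype.card_prod, ZMod.card]

lemma Lat.card_ne_zero : (Fintype.card (Lat T S) : ℂ) ≠ 0 := by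
  rw [Lat.card_eq]
  exact mul_ne_zero (NeZero.ne _) (pow_ne_zero _ (NeZero.ne _))

lemma sum_stdAddChar_mul {N : ℕ} [NeZero N] (a : ZMod N) :
    ∑ x : ZMod N, (ZMod.stdAddChar (x * a) : ℂ) = if a = 0 then (N : ℂ) else 0 := by
  have h := AddChar.sum_mulShift a (ZMod.isPrimitive_stdAddChar N)
  rw [h]; simp [ZMod.card]

lemma Lat.sum_char (x : Lat T S) :
    ∑ p : Lat T S, p.char x = if x = 0 then (Fintype.card (Lat T S) : ℂ) else 0 := by
  rw [Lat.card_eq, Fintype.sum_prod_type]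
  simp only [Lat.char, ← Finset.mul_sum]
  rw [← Finset.sum_mul, sum_stdAddChar_mul]
  have h : ∑ q : Fin 3 → ZMod S, ∏ i, (ZMod.stdAddChar (q i * x.2 i) : ℂ)
      = ∏ i, ∑ a : ZMod S, (ZMod.stdAddChar (a * x.2 i) : ℂ) := by
    rw [Finset.prod_univ_sum]; simp
  rw [h]
  simp only [sum_stdAddChar_mul]
  by_cases hx : x = 0
  · subst hx; simp
  · rw [if_neg hx]
    by_cases h1 : x.1 = 0
    · have h2 : ∃ i, x.2 i ≠ 0 := by
        by_contra! hc
        exact hx (Prod.ext h1 (funext hc))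
      obtain ⟨i, hi⟩ := h2
      rw [Finset.prod_eq_zero (Finset.mem_univ i) (by simp [hi]), mul_zero]
    · simp [h1]

lemma Lat.sum_char_mul_star (p q : Lat T S) :
    ∑ x, p.char x * star (q.char x) = if p = q then (Fintype.card (Lat T S) : ℂ) else 0 := by
  have h : ∀ x, p.char x * star (q.char x) = x.char (p - q) := by
    intro x
    rw [sub_eq_add_neg, Lat.char_add, Lat.char_neg, Lat.char_comm x p, Lat.char_comm x q]
  simp only [h, Lat.sum_char, sub_eq_zero]

/-- The normalized Fourier coefficient, so that `f = ∑ p, fourierCoeff f p • p.char`. -/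
def fourierCoeff (f : Lat T S → ℂ) (p : Lat T S) : ℂ :=
  (1 / (Fintype.card (Lat T S) : ℂ)) * ∑ x, star (p.char x) * f x

lemma fourierCoeff_char (p q : Lat T S) :
    fourierCoeff (fun x => p.char x) q = if p = q then 1 else 0 := by
  simp only [fourierCoeff, mul_comm (star _), Lat.sum_char_mul_star]
  split_ifs
  · rw [one_div, inv_mul_cancel₀ Lat.card_ne_zero]
  · simp

lemma fourierCoeff_add (f g : Lat T S → ℂ) (q : Lat T S) :
    fourierCoeff (f + g) q = fourierCoeff f q + fourierCoeff g q := by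
  simp [fourierCoeff, mul_add, Finset.sum_add_distrib]

lemma fourierCoeff_smul (c : ℂ) (f : Lat T S → ℂ) (q : Lat T S) :
    fourierCoeff (c • f) q = c * fourierCoeff f q := by
  simp only [fourierCoeff, Finset.mul_sum, Pi.smul_apply, smul_eq_mul]
  exact Finset.sum_congr rfl fun x _ => by ring

lemma fourierCoeff_sum {ι : Type*} (s : Finset ι) (f : ι → Lat T S → ℂ) (q : Lat T S) :
    fourierCoeff (∑ i ∈ s, f i) q = ∑ i ∈ s, fourierCoeff (f i) q := by
  classical
  induction s using Finset.induction_on with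
  | empty => simp [fourierCoeff]
  | insert a s ha ih => rw [Finset.sum_insert ha, Finset.sum_insert ha, fourierCoeff_add, ih]

lemma fourier_inversion (f : Lat T S → ℂ) : ∑ p, fourierCoeff f p • (fun x => p.char x) = f := by
  ext x
  simp only [Finset.sum_apply, Pi.smul_apply, smul_eq_mul, fourierCoeff]
  have h : ∀ p : Lat T S, (1 / (Fintype.card (Lat T S) : ℂ) * ∑ y, star (p.char y) * f y) * p.char x
      = (1 / (Fintype.card (Lat T S) : ℂ)) * ∑ y, p.char (x - y) * f y := by
    intro p
    rw [mul_assoc, Finset.sum_mul]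
    congr 1
    refine Finset.sum_congr rfl fun y _ => ?_
    rw [sub_eq_add_neg, Lat.char_add, Lat.char_neg]; ring
  simp only [h, ← Finset.mul_sum]
  rw [Finset.sum_comm]
  simp only [← Finset.sum_mul, Lat.sum_char, sub_eq_zero]
  rw [one_div, Finset.sum_eq_single x (fun y _ hy => by simp [hy.symm]) (by simp), if_pos rfl,
    inv_mul_cancel_left₀ Lat.card_ne_zero]

lemma fourierCoeff_injective {f g : Lat T S → ℂ} (h : ∀ p, fourierCoeff f p = fourierCoeff g p) :
    f = g := by
  rw [← fourier_inversion f, ← fourier_inversion g]; simp only [h]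

/-- A matrix that acts diagonally on the characters multiplies the Fourier coefficients. -/
lemma fourierCoeff_mulVec_of_eigen {M : Matrix (Lat T S) (Lat T S) ℂ} {μ : Lat T S → ℂ}
    (h : ∀ p : Lat T S, M.mulVec (fun x => p.char x) = μ p • fun x => p.char x)
    (f : Lat T S → ℂ) (q : Lat T S) :
    fourierCoeff (M.mulVec f) q = μ q * fourierCoeff f q := by
  conv_lhs => rw [← fourier_inversion f]
  rw [Matrix.mulVec_sum, fourierCoeff_sum]
  simp only [Matrix.mulVec_smul, h, fourierCoeff_smul, fourierCoeff_char]
  simp [mul_comm]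

/-- A matrix with nonvanishing eigenvalues on the characters is invertible. -/
lemma isUnit_of_eigen {M : Matrix (Lat T S) (Lat T S) ℂ} {μ : Lat T S → ℂ}
    (h : ∀ p : Lat T S, M.mulVec (fun x => p.char x) = μ p • fun x => p.char x)
    (hμ : ∀ p, μ p ≠ 0) : IsUnit M := by
  rw [← Matrix.mulVec_injective_iff_isUnit]
  intro f g hfg
  refine fourierCoeff_injective fun p => ?_
  have := congrArg (fun F => fourierCoeff F p) hfg
  simp only [fourierCoeff_mulVec_of_eigen h] at this
  exact mul_left_cancel₀ (hμ p) this

/-- The average over translations of a kernel, in terms of its diagonal Fourier coefficients. -/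
lemma average_translates_eq (G : Matrix (Lat T S) (Lat T S) ℂ) (y : Lat T S) :
    (1 / (Fintype.card (Lat T S) : ℂ)) * ∑ u, G (u + y) u
      = (1 / (Fintype.card (Lat T S) : ℂ)) *
        ∑ p : Lat T S, p.char y * fourierCoeff (G.mulVec fun x => p.char x) p := by
  congr 1
  simp only [fourierCoeff, Matrix.mulVec, dotProduct, Finset.mul_sum]
  have h1 : ∀ p u v : Lat T S, p.char y * (1 / (Fintype.card (Lat T S) : ℂ) *
      (star (p.char u) * (G u v * p.char v)))
      = (1 / (Fintype.card (Lat T S) : ℂ) * G u v) * p.char (v + y - u) := by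
    intro p u v
    rw [sub_eq_add_neg, Lat.char_add, Lat.char_add, Lat.char_neg]; ring
  simp only [h1]
  rw [Finset.sum_comm]
  have h2 : ∀ u : Lat T S,
      ∑ p : Lat T S, ∑ v, 1 / (Fintype.card (Lat T S) : ℂ) * G u v * p.char (v + y - u)
      = ∑ v, if v = u - y then G u v else 0 := by
    intro u
    rw [Finset.sum_comm]
    refine Finset.sum_congr rfl fun v _ => ?_
    rw [← Finset.mul_sum, Lat.sum_char]
    have : v + y - u = 0 ↔ v = u - y := by rw [sub_eq_zero, eq_sub_iff_add_eq]
    simp only [this]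
    split_ifs
    · rw [one_div, mul_right_comm, inv_mul_cancel₀ Lat.card_ne_zero, one_mul]
    · simp
  simp only [h2, Finset.sum_ite_eq', Finset.mem_univ, if_true]
  exact Fintype.sum_equiv (Equiv.addRight y) _ _ fun u => by simp

end Characters

/-! ### The dispersion relation -/

/-- The properties of the (real) symbol `ε` of the kinetic energy that enter the estimates, with
respect to the supremum norm on `ℝ³`. The lower bound is needed on momenta that leave the cube
`[-π, π]³` by half a lattice cell, hence the radius `3π/2`. -/
structure DispersionBounds (κ M : ℝ) (ε : (Fin 3 → ℝ) → ℝ) : Prop where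
  continuous : Continuous ε
  periodic : ∀ (k : Fin 3 → ℝ) (j : Fin 3 → ℤ), ε (fun i => k i + 2 * Real.pi * j i) = ε k
  zero : ε 0 = 0
  nonneg : ∀ k, 0 ≤ ε k
  lower : ∀ k, ‖k‖ ≤ 3 * Real.pi / 2 → κ * ‖k‖ ^ 2 ≤ ε k
  upper : ∀ k, ε k ≤ M
  second_diff : ∀ k u, |ε (k + u) + ε (k - u) - 2 * ε k| ≤ M * ‖u‖ ^ 2
  first_diff : ∀ k u, |ε (k + u) - ε (k - u)| ≤ 2 * M * ‖k‖ * ‖u‖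

/-- The `ℓ¹` length of a point of `ℤ³`. -/
def oneLength (z : Fin 3 → ℤ) : ℝ := ∑ i, |(z i : ℝ)|

lemma oneLength_nonneg (z : Fin 3 → ℤ) : 0 ≤ oneLength z := by
  unfold oneLength; positivity

lemma oneLength_add_le (x y : Fin 3 → ℤ) : oneLength (x + y) ≤ oneLength x + oneLength y := by
  unfold oneLength
  rw [← Finset.sum_add_distrib]
  refine Finset.sum_le_sum fun i _ => ?_
  simpa using abs_add_le (x i : ℝ) (y i : ℝ)

lemma oneLength_neg (x : Fin 3 → ℤ) : oneLength (-x) = oneLength x := by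
  simp [oneLength]

lemma oneLength_unitVec (i : Fin 3) : oneLength (unitVec i) = 1 := by
  unfold oneLength unitVec
  rw [Finset.sum_eq_single i]
  · simp
  · intro j _ hj; simp [hj]
  · simp

lemma oneLength_le_spatialLength (x : Fin 3 → ℤ) : oneLength x ≤ 2 * spatialLength x := by
  unfold oneLength spatialLength
  apply le_of_sq_le_sq _ (by positivity)
  rw [mul_pow, Real.sq_sqrt (by positivity)]
  simp only [Fin.sum_univ_three]
  rw [← sq_abs (x 0 : ℝ), ← sq_abs (x 1 : ℝ), ← sq_abs (x 2 : ℝ)]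
  nlinarith [sq_nonneg (|(x 0 : ℝ)| - |(x 1 : ℝ)|), sq_nonneg (|(x 0 : ℝ)| - |(x 2 : ℝ)|),
    sq_nonneg (|(x 1 : ℝ)| - |(x 2 : ℝ)|), sq_nonneg (|(x 0 : ℝ)|), sq_nonneg (|(x 1 : ℝ)|),
    sq_nonneg (|(x 2 : ℝ)|)]

lemma abs_phase_le (k : Fin 3 → ℝ) (z : Fin 3 → ℤ) : |phase k z| ≤ ‖k‖ * oneLength z := by
  unfold phase oneLength
  refine (Finset.abs_sum_le_sum_abs _ _).trans ?_
  rw [Finset.mul_sum]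
  refine Finset.sum_le_sum fun i _ => ?_
  rw [abs_mul]
  exact mul_le_mul_of_nonneg_right (norm_le_pi_norm k i) (abs_nonneg _)

lemma phase_add_left (k l : Fin 3 → ℝ) (z : Fin 3 → ℤ) :
    phase (k + l) z = phase k z + phase l z := by
  simp [phase, add_mul, Finset.sum_add_distrib]

lemma phase_sub_left (k l : Fin 3 → ℝ) (z : Fin 3 → ℤ) :
    phase (k - l) z = phase k z - phase l z := by
  simp [phase, sub_mul, Finset.sum_sub_distrib]

lemma phase_add_right (k : Fin 3 → ℝ) (x y : Fin 3 → ℤ) :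
    phase k (x + y) = phase k x + phase k y := by
  simp [phase, mul_add, Finset.sum_add_distrib]

lemma phase_neg_right (k : Fin 3 → ℝ) (x : Fin 3 → ℤ) : phase k (-x) = -phase k x := by
  simp [phase]

lemma phase_unitVec (k : Fin 3 → ℝ) (i : Fin 3) : phase k (unitVec i) = k i := by
  unfold phase unitVec
  rw [Finset.sum_eq_single i]
  · simp
  · intro j _ hj; simp [hj]
  · simp

lemma phase_periodic (k : Fin 3 → ℝ) (j z : Fin 3 → ℤ) :
    phase (fun i => k i + 2 * Real.pi * j i) z
      = phase k z + ((∑ i, j i * z i : ℤ) : ℝ) * (2 * Real.pi) := by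
  simp only [phase, add_mul, Finset.sum_add_distrib, Int.cast_sum, Int.cast_mul, Finset.sum_mul]
  congr 1
  exact Finset.sum_congr rfl fun i _ => by ring

/-- The range goes beyond the Brillouin zone `|x| ≤ π`, since the momenta of the zone are shifted by
up to half their length in the second differences. -/
lemma sq_le_one_sub_cos {x : ℝ} (hx : |x| ≤ 3 * Real.pi / 2) : x ^ 2 / 50 ≤ 1 - Real.cos x := by
  have hpi := Real.pi_pos
  have hpi' := Real.pi_lt_d2
  have key : |x| / (3 * Real.pi) ≤ Real.sin (|x| / 2) := by
    by_cases h : |x| / 2 ≤ Real.pi / 2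
    · have := Real.mul_le_sin (x := |x| / 2) (by positivity) h
      refine le_trans ?_ this
      rw [div_le_iff₀ (by positivity)]
      have : 2 / Real.pi * (|x| / 2) * (3 * Real.pi) = 3 * |x| := by field_simp
      rw [this]; linarith [abs_nonneg x]
    · push Not at h
      have := Real.mul_le_sin (x := Real.pi - |x| / 2) (by linarith) (by linarith)
      rw [Real.sin_pi_sub] at this
      refine le_trans ?_ this
      rw [div_le_iff₀ (by positivity)]
      have : 2 / Real.pi * (Real.pi - |x| / 2) * (3 * Real.pi) = 6 * Real.pi - 3 * |x| := by
        field_simp; ring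
      rw [this]; linarith
  have h2 : 1 - Real.cos x = 2 * Real.sin (|x| / 2) ^ 2 := by
    rw [← Real.cos_abs x, Real.sin_sq_eq_half_sub]
    ring_nf
  rw [h2]
  have h3 : (|x| / (3 * Real.pi)) ^ 2 ≤ Real.sin (|x| / 2) ^ 2 :=
    pow_le_pow_left₀ (by positivity) key 2
  have h4 : x ^ 2 / 100 ≤ (|x| / (3 * Real.pi)) ^ 2 := by
    rw [div_pow, sq_abs]
    apply div_le_div_of_nonneg_left (by positivity) (by positivity)
    nlinarith
  linarith

/-- The weight that controls the first two moments of the kernel of `h₀`. -/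
def momentWeight (z : Fin 3 → ℤ) : ℝ := 1 + oneLength z ^ 2

/-- The factor by which exponential weights of mass `m` dominate second moments. -/
def momentConst (m : ℝ) : ℝ := 19 + 16 / m ^ 2

lemma sq_le_exp {m s : ℝ} (hm : 0 < m) (hs : 0 ≤ s) : s ^ 2 ≤ 2 / m ^ 2 * Real.exp (m * s) := by
  have h := Real.quadratic_le_exp_of_nonneg (x := m * s) (by positivity)
  have h2 : (m * s) ^ 2 ≤ 2 * Real.exp (m * s) := by nlinarith [mul_nonneg hm.le hs]
  rw [div_mul_eq_mul_div, le_div_iff₀ (by positivity)]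
  nlinarith

lemma momentWeight_le {m : ℝ} (hm : 0 < m) (z a : Fin 3 → ℤ) (ha : oneLength a ≤ 2) :
    momentWeight z ≤ momentConst m * Real.exp (m * spatialLength (z + a)) := by
  have hs : 0 ≤ spatialLength (z + a) := Real.sqrt_nonneg _
  have h1 : oneLength z ≤ 2 * spatialLength (z + a) + 2 := by
    have h : z = (z + a) + -a := by abel
    calc oneLength z = oneLength ((z + a) + -a) := by rw [← h]
      _ ≤ oneLength (z + a) + oneLength (-a) := oneLength_add_le _ _
      _ ≤ _ := by rw [oneLength_neg]; linarith [oneLength_le_spatialLength (z + a)]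
  have h2 := sq_le_exp hm hs
  have h3 : 1 ≤ Real.exp (m * spatialLength (z + a)) := Real.one_le_exp (by positivity)
  unfold momentWeight momentConst
  have h4 : oneLength z ^ 2 ≤ (2 * spatialLength (z + a) + 2) ^ 2 :=
    pow_le_pow_left₀ (oneLength_nonneg z) h1 2
  have h5 : 16 / m ^ 2 * Real.exp (m * spatialLength (z + a))
      = 8 * (2 / m ^ 2 * Real.exp (m * spatialLength (z + a))) := by ring
  nlinarith [sq_nonneg (spatialLength (z + a) - 1)]

section Kinetic

variable {m cH DH : ℝ} {H : Fin 3 → Fin 3 → (Fin 3 → ℤ) → ℝ}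

/-- The exponentially weighted norm of one matrix element of `H`. -/
def bondNorm (m : ℝ) (H : Fin 3 → Fin 3 → (Fin 3 → ℤ) → ℝ) (i j : Fin 3) : ℝ :=
  ∑' x, |H i j x| * Real.exp (m * spatialLength x)

lemma IsBondOperator.summable_exp (h : IsBondOperator m cH DH H) (i j : Fin 3) :
    Summable fun x => |H i j x| * Real.exp (m * spatialLength x) :=
  h.summable.prod_factor (i, j)

lemma IsBondOperator.sum_bondNorm_le (h : IsBondOperator m cH DH H) :
    ∑ i, ∑ j, bondNorm m H i j ≤ DH := by
  refine le_trans (le_of_eq ?_) h.decay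
  rw [h.summable.tsum_prod, tsum_fintype, Fintype.sum_prod_type]
  rfl

lemma IsBondOperator.summable_shift (h : IsBondOperator m cH DH H) (hm : 0 < m) (i j : Fin 3)
    (a : Fin 3 → ℤ) (ha : oneLength a ≤ 2) :
    Summable (fun z => |H i j (z + a)| * momentWeight z) ∧
      ∑' z, |H i j (z + a)| * momentWeight z ≤ momentConst m * bondNorm m H i j := by
  have hs : Summable fun z => momentConst m *
      (|H i j (z + a)| * Real.exp (m * spatialLength (z + a))) :=
    ((Equiv.addRight a).summable_iff.mpr (h.summable_exp i j)).mul_left _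
  have hle : ∀ z, |H i j (z + a)| * momentWeight z ≤
      momentConst m * (|H i j (z + a)| * Real.exp (m * spatialLength (z + a))) := by
    intro z
    have := mul_le_mul_of_nonneg_left (momentWeight_le hm z a ha) (abs_nonneg (H i j (z + a)))
    linarith
  have hnn : ∀ z, 0 ≤ |H i j (z + a)| * momentWeight z := fun z => by
    unfold momentWeight; positivity
  refine ⟨Summable.of_nonneg_of_le hnn hle hs, ?_⟩
  refine ((Summable.of_nonneg_of_le hnn hle hs).tsum_le_tsum hle hs).trans (le_of_eq ?_)
  rw [tsum_mul_left]
  congr 1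
  exact (Equiv.addRight a).tsum_eq (fun x => |H i j x| * Real.exp (m * spatialLength x))

lemma oneLength_shift_le (i j : Fin 3) : oneLength (-unitVec i + unitVec j) ≤ 2 := by
  refine (oneLength_add_le _ _).trans ?_
  rw [oneLength_neg, oneLength_unitVec, oneLength_unitVec]; norm_num

/-- The weighted `ℓ¹` norm of the kernel of `h₀`. -/
lemma IsBondOperator.kinetic_moment (h : IsBondOperator m cH DH H) (hm : 0 < m) :
    Summable (fun z => |kinetic H z| * momentWeight z) ∧
      ∑' z, |kinetic H z| * momentWeight z ≤ 4 * momentConst m * DH := by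
  have h1 := fun i j => h.summable_shift hm i j (-unitVec i + unitVec j) (oneLength_shift_le i j)
  have h2 := fun i j => h.summable_shift hm i j (-unitVec i)
    (by rw [oneLength_neg, oneLength_unitVec]; norm_num)
  have h3 := fun i j => h.summable_shift hm i j (unitVec j) (by rw [oneLength_unitVec]; norm_num)
  have h4 := fun i j => h.summable_shift hm i j 0 (by simp [oneLength])
  set F : Fin 3 → Fin 3 → (Fin 3 → ℤ) → ℝ := fun i j z =>
    |H i j (z + (-unitVec i + unitVec j))| * momentWeight z
      + |H i j (z + -unitVec i)| * momentWeight z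
      + |H i j (z + unitVec j)| * momentWeight z + |H i j (z + 0)| * momentWeight z with hF
  have hFs : ∀ i j, Summable (F i j) := fun i j =>
    (((h1 i j).1.add (h2 i j).1).add (h3 i j).1).add (h4 i j).1
  have hFt : ∀ i j, ∑' z, F i j z ≤ 4 * momentConst m * bondNorm m H i j := by
    intro i j
    rw [hF, ((((h1 i j).1.add (h2 i j).1).add (h3 i j).1)).tsum_add (h4 i j).1,
      (((h1 i j).1.add (h2 i j).1)).tsum_add (h3 i j).1, ((h1 i j).1).tsum_add (h2 i j).1]
    linarith [(h1 i j).2, (h2 i j).2, (h3 i j).2, (h4 i j).2]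
  have hGs : Summable fun z => ∑ i, ∑ j, F i j z :=
    summable_sum fun i _ => summable_sum fun j _ => hFs i j
  have hw : ∀ z, 0 ≤ momentWeight z := fun z => by unfold momentWeight; positivity
  have hle : ∀ z, |kinetic H z| * momentWeight z ≤ ∑ i, ∑ j, F i j z := by
    intro z
    have : |kinetic H z| ≤ ∑ i, ∑ j, (|H i j (z + (-unitVec i + unitVec j))|
        + |H i j (z + -unitVec i)| + |H i j (z + unitVec j)| + |H i j (z + 0)|) := by
      unfold kinetic
      refine (Finset.abs_sum_le_sum_abs _ _).trans (Finset.sum_le_sum fun i _ => ?_)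
      refine (Finset.abs_sum_le_sum_abs _ _).trans (Finset.sum_le_sum fun j _ => ?_)
      rw [show z + (-unitVec i + unitVec j) = z - unitVec i + unitVec j by abel,
        show z + -unitVec i = z - unitVec i by abel, add_zero]
      refine (abs_add_le _ _).trans (add_le_add ?_ le_rfl)
      refine (abs_sub _ _).trans (add_le_add ?_ le_rfl)
      exact abs_sub _ _
    refine (mul_le_mul_of_nonneg_right this (hw z)).trans (le_of_eq ?_)
    simp only [Finset.sum_mul, add_mul, hF]
  have hs := Summable.of_nonneg_of_le (fun z => mul_nonneg (abs_nonneg _) (hw z)) hle hGs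
  refine ⟨hs, (hs.tsum_le_tsum hle hGs).trans ?_⟩
  rw [Summable.tsum_finsetSum fun i _ => summable_sum fun j _ => hFs i j]
  simp only [Summable.tsum_finsetSum fun j _ => hFs _ j]
  calc ∑ i, ∑ j, ∑' z, F i j z ≤ ∑ i, ∑ j, 4 * momentConst m * bondNorm m H i j :=
        Finset.sum_le_sum fun i _ => Finset.sum_le_sum fun j _ => hFt i j
    _ = 4 * momentConst m * ∑ i, ∑ j, bondNorm m H i j := by simp only [Finset.mul_sum]
    _ ≤ 4 * momentConst m * DH := mul_le_mul_of_nonneg_left h.sum_bondNorm_le (by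
        unfold momentConst; positivity)

lemma IsBondOperator.kinetic_neg (h : IsBondOperator m cH DH H) (z : Fin 3 → ℤ) :
    kinetic H (-z) = kinetic H z := by
  unfold kinetic
  rw [Finset.sum_comm]
  refine Finset.sum_congr rfl fun i _ => Finset.sum_congr rfl fun j _ => ?_
  rw [h.symm j i, h.symm j i, h.symm j i, h.symm j i]
  rw [show -(-z - unitVec j + unitVec i) = z - unitVec i + unitVec j by abel,
    show -(-z - unitVec j) = z + unitVec j by abel, show -(-z + unitVec i) = z - unitVec i by abel,
    neg_neg]
  ring

/-- The symbol of `h₀` in real form. -/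
def dispersion (H : Fin 3 → Fin 3 → (Fin 3 → ℤ) → ℝ) (k : Fin 3 → ℝ) : ℝ :=
  ∑' z, kinetic H z * Real.cos (phase k z)

lemma IsBondOperator.summable_kinetic (h : IsBondOperator m cH DH H) (hm : 0 < m) :
    Summable fun z => |kinetic H z| :=
  Summable.of_nonneg_of_le (fun _ => abs_nonneg _) (fun z => le_mul_of_one_le_right (abs_nonneg _)
    (by unfold momentWeight; nlinarith [sq_nonneg (oneLength z)])) (h.kinetic_moment hm).1

lemma IsBondOperator.summable_kinetic_mul (h : IsBondOperator m cH DH H) (hm : 0 < m)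
    {f : (Fin 3 → ℤ) → ℝ} (hf : ∀ z, |f z| ≤ 1) : Summable fun z => kinetic H z * f z :=
  Summable.of_norm_bounded (h.summable_kinetic hm) fun z => by
    rw [Real.norm_eq_abs, abs_mul]
    exact mul_le_of_le_one_right (abs_nonneg _) (hf z)

/-- The symmetry of the bond operator makes the kinetic energy an even function, so that its symbol
is real. -/
lemma IsBondOperator.kineticSymbol_eq (h : IsBondOperator m cH DH H) (hm : 0 < m)
    (k : Fin 3 → ℝ) : kineticSymbol H k = (dispersion H k : ℂ) := by
  have hc := h.summable_kinetic_mul hm (f := fun z => Real.cos (phase k z))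
    fun z => Real.abs_cos_le_one _
  have hs := h.summable_kinetic_mul hm (f := fun z => Real.sin (phase k z))
    fun z => Real.abs_sin_le_one _
  have hodd : ∑' z, kinetic H z * Real.sin (phase k z) = 0 := by
    have := (Equiv.neg (Fin 3 → ℤ)).tsum_eq fun z => kinetic H z * Real.sin (phase k z)
    simp only [Equiv.neg_apply, h.kinetic_neg, phase_neg_right, Real.sin_neg, mul_neg,
      tsum_neg] at this
    linarith
  have hterm : ∀ z, (kinetic H z : ℂ) * Complex.exp (-(Complex.I * (phase k z : ℂ)))
      = ((kinetic H z * Real.cos (phase k z) : ℝ) : ℂ)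
        - ((kinetic H z * Real.sin (phase k z) : ℝ) : ℂ) * Complex.I := by
    intro z
    rw [show -(Complex.I * (phase k z : ℂ)) = ((-phase k z : ℝ) : ℂ) * Complex.I by
      push_cast; ring, Complex.exp_mul_I, ← Complex.ofReal_cos, ← Complex.ofReal_sin,
      Real.cos_neg, Real.sin_neg]
    push_cast; ring
  unfold kineticSymbol dispersion
  simp only [hterm]
  have hc' : Summable fun z => ((kinetic H z * Real.cos (phase k z) : ℝ) : ℂ) :=
    Complex.ofRealCLM.summable hc
  have hs' : Summable fun z => ((kinetic H z * Real.sin (phase k z) : ℝ) : ℂ) :=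
    Complex.ofRealCLM.summable hs
  rw [hc'.tsum_sub (hs'.mul_right _), tsum_mul_right, ← Complex.ofReal_tsum, ← Complex.ofReal_tsum,
    hodd]
  simp

lemma IsBondOperator.summable_symbol (h : IsBondOperator m cH DH H) (hm : 0 < m) (i j : Fin 3)
    (k : Fin 3 → ℝ) :
    Summable fun x => (H i j x : ℂ) * Complex.exp (-(Complex.I * (phase k x : ℂ))) := by
  refine Summable.of_norm_bounded (h.summable_exp i j) fun x => ?_
  rw [norm_mul, show -(Complex.I * (phase k x : ℂ)) = ((-phase k x : ℝ) : ℂ) * Complex.I by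
      push_cast; ring, Complex.norm_exp_ofReal_mul_I, mul_one, Complex.norm_real]
  exact le_mul_of_one_le_right (abs_nonneg _)
    (Real.one_le_exp (mul_nonneg hm.le (Real.sqrt_nonneg _)))

/-- `h₀ = ∇^* H ∇` in momentum space. -/
lemma IsBondOperator.kineticSymbol_eq_form (h : IsBondOperator m cH DH H) (hm : 0 < m)
    (k : Fin 3 → ℝ) :
    kineticSymbol H k = star (fun i => Complex.exp (Complex.I * (k i : ℂ)) - 1) ⬝ᵥ
      (bondSymbol H k).mulVec fun i => Complex.exp (Complex.I * (k i : ℂ)) - 1 := by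
  set E : (Fin 3 → ℤ) → ℂ := fun x => Complex.exp (-(Complex.I * (phase k x : ℂ))) with hE
  have hEadd : ∀ x y, E (x + y) = E x * E y := by
    intro x y
    simp only [hE, phase_add_right]
    rw [← Complex.exp_add]; congr 1; push_cast; ring
  have hshift : ∀ i j a, HasSum (fun z => (H i j (z + a) : ℂ) * E z)
      (E (-a) * bondSymbol H k i j) := by
    intro i j a
    have h1 : HasSum (fun x => (H i j x : ℂ) * E x) (bondSymbol H k i j) :=
      (h.summable_symbol hm i j k).hasSum
    have h2 := ((Equiv.addRight a).hasSum_iff.mpr h1).mul_left (E (-a))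
    refine h2.congr_fun fun z => ?_
    simp only [Function.comp, Equiv.coe_addRight]
    have : E z = E (-a) * E (z + a) := by rw [← hEadd]; congr 1; abel
    rw [this]; ring
  have hu : ∀ i, E (-unitVec i) = Complex.exp (Complex.I * (k i : ℂ)) := by
    intro i; simp [hE, phase_neg_right, phase_unitVec]
  have hu' : ∀ i, E (unitVec i) = star (Complex.exp (Complex.I * (k i : ℂ))) := by
    intro i
    simp [hE, phase_unitVec, ← Complex.exp_conj]
  have hsum : HasSum (fun z => (kinetic H z : ℂ) * E z)
      (∑ i, ∑ j, (E (-(-unitVec i + unitVec j)) * bondSymbol H k i j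
        - E (-(-unitVec i)) * bondSymbol H k i j - E (-unitVec j) * bondSymbol H k i j
        + E (-0) * bondSymbol H k i j)) := by
    refine HasSum.congr_fun (hasSum_sum fun i _ => hasSum_sum fun j _ =>
      (((hshift i j (-unitVec i + unitVec j)).sub (hshift i j (-unitVec i))).sub
        (hshift i j (unitVec j))).add (hshift i j 0)) fun z => ?_
    simp only [kinetic]
    push_cast
    simp only [Finset.sum_mul]
    refine Finset.sum_congr rfl fun i _ => Finset.sum_congr rfl fun j _ => ?_
    rw [show z + (-unitVec i + unitVec j) = z - unitVec i + unitVec j by abel,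
        show z + -unitVec i = z - unitVec i by abel, add_zero]
    ring
  have : kineticSymbol H k = _ := hsum.tsum_eq
  rw [this]
  simp only [dotProduct, Matrix.mulVec, Pi.star_apply, Finset.mul_sum]
  refine Finset.sum_congr rfl fun i _ => Finset.sum_congr rfl fun j _ => ?_
  have h0 : E 0 = 1 := by simp [hE, phase]
  rw [show -(-unitVec i + unitVec j) = unitVec i + -unitVec j by abel, hEadd, neg_neg, hu, hu',
    neg_zero, h0, star_sub, star_one]
  ring

/-- Coercivity of the bond operator, applied to the symbol `exp(i k_j) - 1` of the lattice gradient.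
-/
lemma IsBondOperator.dispersion_ge (h : IsBondOperator m cH DH H) (hm : 0 < m)
    (k : Fin 3 → ℝ) : cH * ∑ i, 2 * (1 - Real.cos (k i)) ≤ dispersion H k := by
  have h1 := h.coercive k fun i => Complex.exp (Complex.I * (k i : ℂ)) - 1
  rw [← h.kineticSymbol_eq_form hm, h.kineticSymbol_eq hm, Complex.ofReal_re] at h1
  refine le_trans (le_of_eq ?_) h1
  congr 1
  refine Finset.sum_congr rfl fun i _ => ?_
  rw [mul_comm Complex.I, ← Complex.normSq_eq_norm_sq, Complex.exp_mul_I, Complex.normSq_apply]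
  simp only [← Complex.ofReal_cos, ← Complex.ofReal_sin, Complex.sub_re, Complex.add_re,
    Complex.sub_im, Complex.add_im, Complex.re_ofReal_mul, Complex.im_ofReal_mul,
    Complex.ofReal_re, Complex.ofReal_im, Complex.I_re, Complex.I_im, Complex.one_re,
    Complex.one_im]
  nlinarith [Real.sin_sq_add_cos_sq (k i)]

/-- The kinetic energy has a dispersion relation of parabolic type, with constants that depend
only on `m`, `cH` and `DH`. -/
theorem IsBondOperator.dispersionBounds (h : IsBondOperator m cH DH H) (hm : 0 < m)
    (hcH : 0 < cH) :
    DispersionBounds (cH / 25) (4 * momentConst m * DH) (dispersion H) := by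
  obtain ⟨hs, hM⟩ := h.kinetic_moment hm
  have hc : ∀ k, Summable fun z => kinetic H z * Real.cos (phase k z) := fun k =>
    h.summable_kinetic_mul hm fun z => Real.abs_cos_le_one _
  have hs2 : Summable fun z => |kinetic H z| * oneLength z ^ 2 :=
    Summable.of_nonneg_of_le (fun z => by positivity) (fun z =>
      mul_le_mul_of_nonneg_left (by unfold momentWeight; linarith) (abs_nonneg _)) hs
  have hM2 : ∑' z, |kinetic H z| * oneLength z ^ 2 ≤ 4 * momentConst m * DH :=
    (hs2.tsum_le_tsum (fun z => mul_le_mul_of_nonneg_left (by unfold momentWeight; linarith)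
      (abs_nonneg _)) hs).trans hM
  have hM0 : ∑' z, |kinetic H z| ≤ 4 * momentConst m * DH :=
    ((h.summable_kinetic hm).tsum_le_tsum (fun z => le_mul_of_one_le_right (abs_nonneg _)
      (by unfold momentWeight; nlinarith [sq_nonneg (oneLength z)])) hs).trans hM
  have hge := h.dispersion_ge hm
  have hone : ∀ k : Fin 3 → ℝ, ∀ i, 0 ≤ 2 * (1 - Real.cos (k i)) := fun k i => by
    linarith [Real.cos_le_one (k i)]
  -- differences of the symbol are bounded by the second moment of the kinetic energy
  have hdom : ∀ {f : (Fin 3 → ℤ) → ℝ} {B : ℝ}, (∀ z, |f z| ≤ B * oneLength z ^ 2) → 0 ≤ B →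
      |∑' z, kinetic H z * f z| ≤ B * (4 * momentConst m * DH) := by
    intro f B hf hB
    have hb : ∀ z, ‖kinetic H z * f z‖ ≤ B * (|kinetic H z| * oneLength z ^ 2) := fun z => by
      rw [Real.norm_eq_abs, abs_mul]
      nlinarith [mul_le_mul_of_nonneg_left (hf z) (abs_nonneg (kinetic H z))]
    have := tsum_of_norm_bounded (hs2.mul_left B).hasSum hb
    rw [tsum_mul_left, Real.norm_eq_abs] at this
    exact this.trans (mul_le_mul_of_nonneg_left hM2 hB)
  refine ⟨?_, ?_, ?_, ?_, ?_, ?_, ?_, ?_⟩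
  · refine continuous_tsum (fun z => ?_) (h.summable_kinetic hm) (fun z k => ?_)
    · unfold phase; fun_prop
    · rw [Real.norm_eq_abs, abs_mul]
      exact mul_le_of_le_one_right (abs_nonneg _) (Real.abs_cos_le_one _)
  · intro k j
    unfold dispersion
    refine tsum_congr fun z => ?_
    rw [phase_periodic, Real.cos_add_int_mul_two_pi]
  · have h1 := h.kineticSymbol_eq_form hm 0
    rw [h.kineticSymbol_eq hm] at h1
    have : (fun i => Complex.exp (Complex.I * (((0 : Fin 3 → ℝ) i : ℝ) : ℂ)) - 1)
      = (0 : Fin 3 → ℂ) := by ext i; simp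
    rw [this] at h1
    simpa using h1
  · intro k
    exact le_trans (mul_nonneg hcH.le (Finset.sum_nonneg fun i _ => hone k i)) (hge k)
  · intro k hk
    obtain ⟨i, hi⟩ : ∃ i, ‖k‖ = ‖k i‖ := by
      obtain ⟨i, -, hi⟩ := Finset.exists_mem_eq_sup' (s := (Finset.univ : Finset (Fin 3)))
        ⟨0, Finset.mem_univ _⟩ (fun i => ‖k i‖₊)
      refine ⟨i, ?_⟩
      rw [Pi.norm_def, ← Finset.sup'_eq_sup ⟨0, Finset.mem_univ _⟩, hi]; rfl
    rw [hi, Real.norm_eq_abs] at hk ⊢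
    have h1 := sq_le_one_sub_cos hk
    have h2 : 2 * (1 - Real.cos (k i)) ≤ ∑ i, 2 * (1 - Real.cos (k i)) :=
      Finset.single_le_sum (f := fun i => 2 * (1 - Real.cos (k i))) (fun j _ => hone k j)
        (Finset.mem_univ i)
    have h3 := mul_le_mul_of_nonneg_left h2 hcH.le
    have h4 := mul_le_mul_of_nonneg_left h1 hcH.le
    rw [sq_abs]
    linarith [hge k]
  · intro k
    refine le_trans (le_abs_self _) (le_trans ?_ hM0)
    exact tsum_of_norm_bounded (f := fun z => kinetic H z * Real.cos (phase k z))
      (h.summable_kinetic hm).hasSum fun z => by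
      rw [Real.norm_eq_abs, abs_mul]
      exact mul_le_of_le_one_right (abs_nonneg _) (Real.abs_cos_le_one _)
  · intro k u
    unfold dispersion
    rw [← (hc (k + u)).tsum_add (hc (k - u)), ← tsum_mul_left,
      ← ((hc (k + u)).add (hc (k - u))).tsum_sub ((hc k).mul_left 2)]
    -- the factor `cos - 1` is quadratic in `u`, so that the second moment suffices
    have : ∀ z, kinetic H z * Real.cos (phase (k + u) z) + kinetic H z * Real.cos (phase (k - u) z)
        - 2 * (kinetic H z * Real.cos (phase k z))
        = kinetic H z * (2 * Real.cos (phase k z) * (Real.cos (phase u z) - 1)) := by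
      intro z
      rw [phase_add_left, phase_sub_left, Real.cos_add, Real.cos_sub]; ring
    simp only [this]
    rw [mul_comm _ (‖u‖ ^ 2)]
    refine hdom (fun z => ?_) (by positivity)
    have h1 := abs_phase_le u z
    have h2 := Real.one_sub_sq_div_two_le_cos (x := phase u z)
    have h3 := Real.cos_le_one (phase u z)
    rw [abs_mul, abs_mul, abs_of_nonpos (a := Real.cos (phase u z) - 1) (by linarith)]
    have h4 : phase u z ^ 2 ≤ (‖u‖ * oneLength z) ^ 2 := by
      rw [← sq_abs (phase u z)]; exact pow_le_pow_left₀ (abs_nonneg _) h1 2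
    have h5 := Real.abs_cos_le_one (phase k z)
    rw [abs_two]
    rw [mul_pow] at h4
    nlinarith [abs_nonneg (Real.cos (phase k z))]
  · intro k u
    unfold dispersion
    rw [← (hc (k + u)).tsum_sub (hc (k - u))]
    -- the product of sines is at most linear in both `k` and `u`
    have : ∀ z, kinetic H z * Real.cos (phase (k + u) z) - kinetic H z * Real.cos (phase (k - u) z)
        = kinetic H z * (-2 * Real.sin (phase k z) * Real.sin (phase u z)) := by
      intro z
      rw [phase_add_left, phase_sub_left, Real.cos_add, Real.cos_sub]; ring
    simp only [this]
    rw [show 2 * (4 * momentConst m * DH) * ‖k‖ * ‖u‖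
      = (2 * ‖k‖ * ‖u‖) * (4 * momentConst m * DH) by ring]
    refine hdom (fun z => ?_) (by positivity)
    have h1 := (Real.abs_sin_le_abs (x := phase u z)).trans (abs_phase_le u z)
    have h2 := (Real.abs_sin_le_abs (x := phase k z)).trans (abs_phase_le k z)
    rw [abs_mul, abs_mul, abs_neg, abs_two]
    have := mul_le_mul h2 h1 (abs_nonneg _) (mul_nonneg (norm_nonneg _) (oneLength_nonneg z))
    linarith

end Kinetic

/-! ### The operator `D₀` in momentum space -/

/-- The spatial momentum of a point of the dual torus, in `[-π, π]³`. -/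
def momentum {S : ℕ} (q : Fin 3 → ZMod S) : Fin 3 → ℝ :=
  fun i => 2 * Real.pi * (q i).valMinAbs / S

lemma torusKinetic_apply {T S : ℕ} (H : Fin 3 → Fin 3 → (Fin 3 → ℤ) → ℝ) (x y : Lat T S) :
    torusKinetic H T S x y = if x.1 = y.1 then ((∑' z : Fin 3 → ℤ,
      Set.indicator {z : Fin 3 → ℤ | (fun i => (z i : ZMod S)) = x.2 - y.2} (kinetic H) z : ℝ) : ℂ)
      else 0 := by
  simp only [torusKinetic, Matrix.of_apply, Set.indicator_apply, Set.mem_ofPred_eq]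

section TorusD

variable {T S : ℕ} [NeZero T] [NeZero S]

lemma stdAddChar_mul_intCast {N : ℕ} [NeZero N] (a : ZMod N) (z : ℤ) :
    (ZMod.stdAddChar (a * (z : ZMod N)) : ℂ)
      = Complex.exp (Complex.I * ((2 * Real.pi * a.valMinAbs / N * z : ℝ) : ℂ)) := by
  conv_lhs => rw [← ZMod.coe_valMinAbs a, ← Int.cast_mul, ZMod.stdAddChar_coe]
  congr 1; push_cast; ring

lemma prod_stdAddChar_intCast (q : Fin 3 → ZMod S) (z : Fin 3 → ℤ) :
    ∏ i, (ZMod.stdAddChar (q i * (z i : ZMod S)) : ℂ)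
      = Complex.exp (Complex.I * (phase (momentum q) z : ℂ)) := by
  simp only [stdAddChar_mul_intCast]
  rw [← Complex.exp_sum, ← Finset.mul_sum, ← Complex.ofReal_sum]
  rfl

/-- The matrix exponential acts on the characters through the exponential of the eigenvalue. -/
lemma exp_mulVec_char {A : Matrix (Lat T S) (Lat T S) ℂ} {μ : Lat T S → ℂ}
    (h : ∀ p : Lat T S, A.mulVec (fun x => p.char x) = μ p • fun x => p.char x) (p : Lat T S) :
    (NormedSpace.exp A).mulVec (fun x => p.char x) = Complex.exp (μ p) • fun x => p.char x := by
  -- the matrix of characters `U` diagonalizes `A`, and `exp` commutes with conjugation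
  set U : Matrix (Lat T S) (Lat T S) ℂ := Matrix.of fun x p => p.char x with hU
  have hunit : IsUnit U := by
    rw [← Matrix.isUnit_transpose, ← Matrix.mulVec_injective_iff_isUnit]
    intro f g hfg
    have : ∀ f : Lat T S → ℂ, ∀ p : Lat T S, U.transpose.mulVec f (-p)
        = (Fintype.card (Lat T S) : ℂ) * fourierCoeff f p := by
      intro f p
      rw [fourierCoeff, ← mul_assoc, mul_one_div, div_self Lat.card_ne_zero, one_mul]
      simp only [Matrix.mulVec, dotProduct, hU, Matrix.transpose_apply, Matrix.of_apply]
      refine Finset.sum_congr rfl fun x _ => ?_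
      rw [Lat.char_comm (-p), Lat.char_neg, Lat.char_comm]
    refine fourierCoeff_injective fun p => ?_
    have h1 := this f p
    rw [hfg, this g p] at h1
    exact (mul_left_cancel₀ Lat.card_ne_zero h1).symm
  have hdet : IsUnit U.det := (Matrix.isUnit_iff_isUnit_det U).mp hunit
  have hAU : A * U = U * Matrix.diagonal μ := by
    ext x q
    have := congrFun (h q) x
    simp only [Matrix.mulVec, dotProduct, Pi.smul_apply, smul_eq_mul] at this
    rw [Matrix.mul_diagonal, Matrix.mul_apply]
    simp only [hU, Matrix.of_apply]
    rw [this, mul_comm]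
  have hA : A = U * Matrix.diagonal μ * U⁻¹ := by
    rw [← hAU, Matrix.mul_assoc, Matrix.mul_nonsing_inv _ hdet, Matrix.mul_one]
  have hexp : NormedSpace.exp A * U = U * Matrix.diagonal (NormedSpace.exp μ) := by
    conv_lhs => rw [hA]
    rw [Matrix.exp_conj _ _ hunit, Matrix.exp_diagonal, Matrix.mul_assoc,
      Matrix.nonsing_inv_mul _ hdet, Matrix.mul_one]
  ext x
  have h1 := congrFun (congrFun hexp x) p
  rw [Matrix.mul_diagonal, Matrix.mul_apply] at h1
  simp only [hU, Matrix.of_apply] at h1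
  simp only [Matrix.mulVec, dotProduct, Pi.smul_apply, smul_eq_mul]
  rw [h1, Pi.exp_def, Complex.exp_eq_exp_ℂ, mul_comm]

lemma torusKinetic_mulVec_char {H : Fin 3 → Fin 3 → (Fin 3 → ℤ) → ℝ}
    (hH : Summable fun z => |kinetic H z|) (p : Lat T S) :
    (torusKinetic H T S).mulVec (fun x => p.char x)
      = kineticSymbol H (momentum p.2) • fun x => p.char x := by
  classical
  ext x
  simp only [Matrix.mulVec, dotProduct, Pi.smul_apply, smul_eq_mul, torusKinetic_apply]
  rw [Fintype.sum_prod_type]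
  rw [Finset.sum_eq_single x.1 (fun a _ ha => by simp [ha.symm]) (by simp)]
  simp only [if_true]
  have hs : ∀ w : Fin 3 → ZMod S, Summable fun z : Fin 3 → ℤ =>
      ((Set.indicator {z : Fin 3 → ℤ | (fun i => (z i : ZMod S)) = x.2 - w} (kinetic H) z : ℝ) : ℂ)
        * p.char (x.1, w) := by
    intro w
    refine Summable.mul_right _ (Complex.ofRealCLM.summable ?_)
    exact Summable.of_norm_bounded hH fun z => norm_indicator_le_norm_self _ _
  simp only [Complex.ofReal_tsum, ← tsum_mul_right]
  rw [← Summable.tsum_finsetSum fun w _ => hs w]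
  unfold kineticSymbol
  rw [← tsum_mul_right]
  refine tsum_congr fun z => ?_
  rw [Finset.sum_eq_single (x.2 - fun i => (z i : ZMod S))]
  · rw [Set.indicator_of_mem (by simp), mul_assoc]
    congr 1
    have h2 : ((x.1, x.2 - fun i => (z i : ZMod S)) : Lat T S)
        = x + ((0, fun i => ((-z i : ℤ) : ZMod S)) : Lat T S) := by
      ext <;> simp [sub_eq_add_neg]
    rw [h2, Lat.char_add, mul_comm]
    congr 1
    simp only [Lat.char, mul_zero, AddChar.map_zero_eq_one, one_mul]
    have := prod_stdAddChar_intCast p.2 (-z)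
    simp only [Pi.neg_apply] at this
    rw [this, phase_neg_right]
    push_cast
    rw [mul_neg]
  · intro w _ hw
    rw [Set.indicator_of_notMem]
    · simp
    · intro h
      rw [Set.mem_ofPred_eq] at h
      exact hw (by rw [h]; abel)
  · simp

lemma timeDeriv_mulVec_char (p : Lat T S) :
    (timeDeriv T S).mulVec (fun x => p.char x)
      = ((ZMod.stdAddChar p.1 : ℂ) - 1) • fun x => p.char x := by
  ext x
  simp only [Matrix.mulVec, dotProduct, Pi.smul_apply, smul_eq_mul, timeDeriv, Matrix.of_apply,
    sub_mul, Finset.sum_sub_distrib, ite_mul, one_mul, zero_mul, Finset.sum_ite_eq',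
    Finset.mem_univ, if_true]
  simp only [Lat.char, mul_add, mul_one, AddChar.map_add_eq_mul]
  ring

/-- The symbol of `D₀` on the dual torus. -/
def dSymbol (ε : (Fin 3 → ℝ) → ℝ) (p : Lat T S) : ℂ :=
  1 - (Real.exp (-ε (momentum p.2)) : ℂ) * ZMod.stdAddChar p.1

/-- All of the model enters the estimates through this diagonalization of `D₀` and the bounds on the
dispersion relation. -/
lemma torusD_mulVec_char {m cH DH : ℝ} {H : Fin 3 → Fin 3 → (Fin 3 → ℤ) → ℝ}
    (h : IsBondOperator m cH DH H) (hm : 0 < m) (p : Lat T S) :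
    (torusD H T S).mulVec (fun x => p.char x)
      = dSymbol (dispersion H) p • fun x => p.char x := by
  have h1 : ∀ p : Lat T S, (-torusKinetic H T S).mulVec (fun x => p.char x)
      = (-kineticSymbol H (momentum p.2)) • fun x => p.char x := by
    intro p
    rw [Matrix.neg_mulVec, torusKinetic_mulVec_char (h.summable_kinetic hm), neg_smul]
  have h2 := exp_mulVec_char h1
  rw [torusD, Matrix.sub_mulVec, Matrix.sub_mulVec, ← Matrix.mulVec_mulVec,
    timeDeriv_mulVec_char, Matrix.mulVec_smul, h2, Matrix.one_mulVec, h.kineticSymbol_eq hm]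
  ext x
  simp only [Pi.sub_apply, Pi.smul_apply, smul_eq_mul, dSymbol, Complex.ofReal_exp,
    Complex.ofReal_neg]
  ring

end TorusD

/-! ### Block spin averages in momentum space -/

/-- The plane wave `z ↦ ζ₀ ^ z₀ ∏ ζ_i ^ z_i` on `ℤ × ℤ³` with the multipliers `ζ₀`, `ζ_i`. -/
def planeWave (ζ₀ : ℂ) (ζ : Fin 3 → ℂ) (z : ZLat) : ℂ := ζ₀ ^ z.1 * ∏ i, ζ i ^ z.2 i

/-- The average of `ζ ^ z` over the centred interval of `N` points (for odd `N`). -/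
def intervalAverage (N : ℕ) (ζ : ℂ) : ℂ :=
  (1 / (N : ℂ)) * ∑ z ∈ Finset.Icc (-(((N : ℤ) - 1) / 2)) (((N : ℤ) - 1) / 2), ζ ^ z

/-- The average of the plane wave with multipliers `ζ₀`, `ζ_i` over the box of side `L` points in
space and `L²` points in time. -/
def boxAverage (L : ℕ) (ζ₀ : ℂ) (ζ : Fin 3 → ℂ) : ℂ :=
  intervalAverage (L ^ 2) ζ₀ * ∏ i, intervalAverage L (ζ i)

/-- The factor by which `j` block spin averages multiply a plane wave. -/
def avgSymbol (L r j : ℕ) (ζ₀ : ℂ) (ζ : Fin 3 → ℂ) : ℂ :=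
  ∏ i ∈ Finset.range j, boxAverage L (ζ₀ ^ L ^ (2 * i)) (fun s => ζ s ^ L ^ i) ^ r

lemma planeWave_add {ζ₀ : ℂ} {ζ : Fin 3 → ℂ} (h₀ : ζ₀ ≠ 0) (h : ∀ i, ζ i ≠ 0) (x y : ZLat) :
    planeWave ζ₀ ζ (x + y) = planeWave ζ₀ ζ x * planeWave ζ₀ ζ y := by
  simp only [planeWave, Prod.fst_add, Prod.snd_add, Pi.add_apply, zpow_add₀ h₀, zpow_add₀ (h _),
    Finset.prod_mul_distrib]
  ring

lemma sum_blockBox_planeWave (L : ℕ) (ζ₀ : ℂ) (ζ : Fin 3 → ℂ) :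
    (1 / (L : ℂ) ^ 5) * ∑ z ∈ blockBox L, planeWave ζ₀ ζ z = boxAverage L ζ₀ ζ := by
  unfold blockBox planeWave boxAverage intervalAverage
  rw [Finset.sum_product]
  simp only [← Finset.mul_sum]
  rw [← Finset.sum_mul, ← Finset.prod_univ_sum
    (f := fun i (w : ℤ) => ζ i ^ w), Finset.prod_mul_distrib]
  simp only [Finset.prod_const, Finset.card_univ, Fintype.card_fin]
  push_cast
  ring

lemma avgProfile_nonneg (L r : ℕ) (x : ZLat) : 0 ≤ avgProfile L r x := by
  induction r generalizing x with
  | zero => unfold avgProfile; split_ifs <;> norm_num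
  | succ r ih =>
    unfold avgProfile
    exact mul_nonneg (by positivity) (Finset.sum_nonneg fun z _ => ih _)

lemma avgProfile_support_finite (L r : ℕ) : (Function.support (avgProfile L r)).Finite := by
  induction r with
  | zero =>
    refine (Set.finite_singleton (0 : ZLat)).subset fun x hx => ?_
    by_contra hne
    exact hx (if_neg hne)
  | succ r ih =>
    have : Function.support (avgProfile L (r + 1)) ⊆
        ⋃ z ∈ blockBox L, (fun x => x + z) '' Function.support (avgProfile L r) := by
      intro x hx
      rw [Function.mem_support, avgProfile] at hx
      obtain ⟨z, hz, hne⟩ := Finset.exists_ne_zero_of_sum_ne_zero (right_ne_zero_of_mul hx)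
      simp only [Set.mem_iUnion]
      exact ⟨z, hz, x - z, hne, by simp⟩
    exact ((blockBox L).finite_toSet.biUnion fun z _ => ih.image _).subset this

/-- The average of a function against the profile, as a finite sum. -/
lemma exists_avgProfile_finset (L r : ℕ) : ∃ F : Finset ZLat, ∀ f : ZLat → ℂ,
    ∑' x, (avgProfile L r x : ℂ) * f x = ∑ x ∈ F, (avgProfile L r x : ℂ) * f x := by
  refine ⟨(avgProfile_support_finite L r).toFinset, fun f => tsum_eq_sum fun x hx => ?_⟩
  rw [Set.Finite.mem_toFinset, Function.notMem_support] at hx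
  simp [hx]

lemma tsum_avgProfile_succ (L r : ℕ) (f : ZLat → ℂ) :
    ∑' x, (avgProfile L (r + 1) x : ℂ) * f x
      = (1 / (L : ℂ) ^ 5) * ∑ z ∈ blockBox L, ∑' x, (avgProfile L r x : ℂ) * f (x + z) := by
  have hfin : ∀ g : ZLat → ℂ, Summable fun x => (avgProfile L r x : ℂ) * g x := fun g =>
    summable_of_hasFiniteSupport ((avgProfile_support_finite L r).subset fun x hx => by
      intro h0; exact hx (by simp [h0]))
  have h1 : ∀ z : ZLat, ∑' x, (avgProfile L r x : ℂ) * f (x + z)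
      = ∑' x, (avgProfile L r (x - z) : ℂ) * f x := by
    intro z
    rw [← (Equiv.addRight z).tsum_eq fun x => (avgProfile L r (x - z) : ℂ) * f x]
    simp
  have h2 : ∀ z : ZLat, Summable fun x => (avgProfile L r (x - z) : ℂ) * f x := by
    intro z
    rw [← (Equiv.addRight z).summable_iff]
    simpa [Function.comp_def] using hfin fun x => f (x + z)
  simp only [h1]
  rw [← Summable.tsum_finsetSum fun z _ => h2 z, ← tsum_mul_left]
  refine tsum_congr fun x => ?_
  rw [avgProfile]
  push_cast
  rw [← Finset.sum_mul]
  ring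

lemma tsum_avgProfile_planeWave (L r : ℕ) {ζ₀ : ℂ} {ζ : Fin 3 → ℂ} (h₀ : ζ₀ ≠ 0)
    (h : ∀ i, ζ i ≠ 0) :
    ∑' x, (avgProfile L r x : ℂ) * planeWave ζ₀ ζ x = boxAverage L ζ₀ ζ ^ r := by
  induction r with
  | zero =>
    rw [tsum_eq_single 0 fun x hx => by simp [avgProfile, hx]]
    simp [avgProfile, planeWave]
  | succ r ih =>
    rw [tsum_avgProfile_succ]
    simp only [planeWave_add h₀ h, ← mul_assoc, tsum_mul_right, ih]
    rw [← Finset.mul_sum, mul_left_comm, sum_blockBox_planeWave, pow_succ]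

lemma blockAverage_planeWave (L r : ℕ) {ζ₀ : ℂ} {ζ : Fin 3 → ℂ} (h₀ : ζ₀ ≠ 0)
    (h : ∀ i, ζ i ≠ 0) :
    blockAverage L r (planeWave ζ₀ ζ)
      = boxAverage L ζ₀ ζ ^ r • planeWave (ζ₀ ^ L ^ 2) fun i => ζ i ^ L := by
  ext w
  unfold blockAverage
  simp only [planeWave_add h₀ h, Pi.smul_apply, smul_eq_mul, mul_left_comm _ (planeWave ζ₀ ζ _),
    tsum_mul_left, tsum_avgProfile_planeWave L r h₀ h]
  rw [mul_comm]
  congr 1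
  simp only [planeWave, zpow_mul]
  norm_cast

lemma blockAverage_smul (L r : ℕ) (c : ℂ) (f : ZLat → ℂ) :
    blockAverage L r (c • f) = c • blockAverage L r f := by
  ext w
  simp only [blockAverage, Pi.smul_apply, smul_eq_mul, mul_left_comm _ c, tsum_mul_left]

lemma blockAverage_sum (L r : ℕ) {ι : Type*} (s : Finset ι) (f : ι → ZLat → ℂ) :
    blockAverage L r (∑ i ∈ s, f i) = ∑ i ∈ s, blockAverage L r (f i) := by
  obtain ⟨F, hF⟩ := exists_avgProfile_finset L r
  ext w
  simp only [Finset.sum_apply, blockAverage, hF]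
  rw [Finset.sum_comm]
  simp only [Finset.mul_sum]

lemma iterate_blockAverage_smul (L r j : ℕ) (c : ℂ) (f : ZLat → ℂ) :
    (blockAverage L r)^[j] (c • f) = c • (blockAverage L r)^[j] f := by
  induction j generalizing f with
  | zero => rfl
  | succ j ih => simp only [Function.iterate_succ_apply, blockAverage_smul, ih]

lemma iterate_blockAverage_sum (L r j : ℕ) {ι : Type*} (s : Finset ι) (f : ι → ZLat → ℂ) :
    (blockAverage L r)^[j] (∑ i ∈ s, f i) = ∑ i ∈ s, (blockAverage L r)^[j] (f i) := by
  induction j generalizing f with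
  | zero => rfl
  | succ j ih => simp only [Function.iterate_succ_apply, blockAverage_sum, ih]

/-- Block averages map plane waves to plane waves; on the blocked lattice, the `j`-th iterate raises
the multipliers to the powers `L ^ (2j)` and `L ^ j`. -/
lemma iterate_blockAverage_planeWave (L r j : ℕ) {ζ₀ : ℂ} {ζ : Fin 3 → ℂ} (h₀ : ζ₀ ≠ 0)
    (h : ∀ i, ζ i ≠ 0) :
    (blockAverage L r)^[j] (planeWave ζ₀ ζ)
      = avgSymbol L r j ζ₀ ζ • planeWave (ζ₀ ^ L ^ (2 * j)) fun i => ζ i ^ L ^ j := by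
  induction j with
  | zero => simp [avgSymbol]
  | succ j ih =>
    rw [Function.iterate_succ_apply', ih, blockAverage_smul,
      blockAverage_planeWave L r (pow_ne_zero _ h₀) fun i => pow_ne_zero _ (h i), smul_smul,
      avgSymbol, avgSymbol, Finset.prod_range_succ]
    congr 2
    · rw [← pow_mul, ← pow_add]; ring_nf
    · ext i; rw [← pow_mul, ← pow_succ]

section Positivity

open scoped ComplexOrder

lemma blockAverage_real_nonneg (L r : ℕ) {f : ZLat → ℂ} (hf : ∀ x, 0 ≤ f x) (w : ZLat) :
    0 ≤ blockAverage L r f w := by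
  obtain ⟨F, hF⟩ := exists_avgProfile_finset L r
  rw [blockAverage, hF]
  exact Finset.sum_nonneg fun x _ => mul_nonneg (by
    rw [Complex.zero_le_real]; exact avgProfile_nonneg L r x) (hf _)

lemma iterate_blockAverage_nonneg (L r j : ℕ) {f : ZLat → ℂ} (hf : ∀ x, 0 ≤ f x) (w : ZLat) :
    0 ≤ (blockAverage L r)^[j] f w := by
  induction j generalizing f with
  | zero => exact hf w
  | succ j ih => exact ih fun x => blockAverage_real_nonneg L r hf x

lemma blockMatrix_nonneg (L r j T S T' S' : ℕ) (w : Lat T' S') (x : Lat T S) :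
    0 ≤ blockMatrix L r j T S T' S' w x := by
  refine iterate_blockAverage_nonneg L r j (fun z => ?_) _
  split_ifs <;> simp

end Positivity

section IntervalAverage

lemma sum_Icc_symm (M : ℕ) (f : ℤ → ℂ) :
    ∑ z ∈ Finset.Icc (-(M : ℤ)) M, f z = ∑ i ∈ Finset.range (2 * M + 1), f ((i : ℤ) - M) := by
  refine Finset.sum_nbij' (fun z => (z + M).toNat) (fun i => (i : ℤ) - M) ?_ ?_ ?_ ?_ ?_
  · intro z hz; simp only [Finset.mem_Icc, Finset.mem_range] at *; omega
  · intro i hi; simp only [Finset.mem_Icc, Finset.mem_range] at *; omega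
  · intro z hz; simp only [Finset.mem_Icc] at *; omega
  · intro i hi; simp only [Finset.mem_range] at *; omega
  · intro z hz; simp only [Finset.mem_Icc] at *; congr 1; omega

lemma intervalAverage_eq {N : ℕ} (hN : Odd N) (ζ : ℂ) : ∃ M : ℕ, N = 2 * M + 1 ∧
    intervalAverage N ζ = (1 / (N : ℂ)) * ∑ i ∈ Finset.range N, ζ ^ ((i : ℤ) - M) := by
  obtain ⟨M, rfl⟩ := hN
  refine ⟨M, rfl, ?_⟩
  rw [intervalAverage, ← sum_Icc_symm M fun z => ζ ^ z]
  have : (((2 * M + 1 : ℕ) : ℤ) - 1) / 2 = M := by push_cast; omega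
  rw [this]

/-- Orthogonality of the characters of a cyclic group of order `N`. -/
lemma intervalAverage_eq_zero {N : ℕ} (hN : Odd N) {ζ : ℂ} (h : ζ ^ N = 1) (h1 : ζ ≠ 1) :
    intervalAverage N ζ = 0 := by
  obtain ⟨M, hM, h2⟩ := intervalAverage_eq hN ζ
  have h0 : ζ ≠ 0 := by
    rintro rfl
    rw [zero_pow (by omega)] at h
    exact zero_ne_one h
  rw [h2]
  simp only [sub_eq_add_neg, zpow_add₀ h0, zpow_natCast, ← Finset.sum_mul]
  have := geom_sum_mul ζ N
  rw [h, sub_self] at this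
  rw [(mul_eq_zero.mp this).resolve_right (sub_ne_zero.mpr h1)]
  simp

lemma norm_zpow_sub_one_le {ζ : ℂ} (h : ‖ζ‖ = 1) (z : ℤ) : ‖ζ ^ z - 1‖ ≤ |(z : ℝ)| * ‖ζ - 1‖ := by
  have hnat : ∀ n : ℕ, ‖ζ ^ n - 1‖ ≤ n * ‖ζ - 1‖ := by
    intro n
    induction n with
    | zero => simp
    | succ n ih =>
      have : ζ ^ (n + 1) - 1 = ζ ^ n * (ζ - 1) + (ζ ^ n - 1) := by ring
      rw [this]
      refine (norm_add_le _ _).trans ?_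
      rw [norm_mul, norm_pow, h, one_pow, one_mul]
      push_cast; linarith
  have h0 : ζ ≠ 0 := by intro h0; simp [h0] at h
  obtain ⟨n, rfl | rfl⟩ := z.eq_nat_or_neg
  · simpa using hnat n
  · have : ζ ^ (-(n : ℤ)) - 1 = -(ζ ^ (-(n : ℤ)) * (ζ ^ n - 1)) := by
      rw [mul_sub, ← zpow_natCast, ← zpow_add₀ h0]; simp
    rw [this, norm_neg, norm_mul, norm_zpow, h, one_zpow, one_mul]
    simpa using hnat n

lemma norm_intervalAverage_le {N : ℕ} (hN : Odd N) {ζ : ℂ} (h : ‖ζ‖ = 1) :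
    ‖intervalAverage N ζ‖ ≤ 1 := by
  obtain ⟨M, hM, h2⟩ := intervalAverage_eq hN ζ
  have hN0 : (0 : ℝ) < N := by exact_mod_cast hN.pos
  rw [h2, norm_mul, norm_div, norm_one, Complex.norm_natCast, one_div, inv_mul_le_one₀ hN0]
  refine (norm_sum_le _ _).trans ?_
  simp [norm_zpow, h]

/-- On long wavelengths the average is close to one. -/
lemma norm_intervalAverage_sub_one_le {N : ℕ} (hN : Odd N) {ζ : ℂ} (h : ‖ζ‖ = 1) :
    ‖intervalAverage N ζ - 1‖ ≤ N / 2 * ‖ζ - 1‖ := by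
  obtain ⟨M, hM, h2⟩ := intervalAverage_eq hN ζ
  have hN0 : (0 : ℝ) < N := by exact_mod_cast hN.pos
  have hN0' : (N : ℂ) ≠ 0 := by exact_mod_cast hN.pos.ne'
  have h3 : intervalAverage N ζ - 1
      = (1 / (N : ℂ)) * ∑ i ∈ Finset.range N, (ζ ^ ((i : ℤ) - M) - 1) := by
    rw [h2, Finset.sum_sub_distrib, mul_sub]
    simp [hN0']
  rw [h3, norm_mul, norm_div, norm_one, Complex.norm_natCast, one_div, inv_mul_le_iff₀ hN0]
  refine (norm_sum_le _ _).trans ?_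
  refine (Finset.sum_le_card_nsmul _ _ (N / 2 * ‖ζ - 1‖) fun i hi => ?_).trans ?_
  · refine (norm_zpow_sub_one_le h _).trans (mul_le_mul_of_nonneg_right ?_ (norm_nonneg _))
    rw [Finset.mem_range] at hi
    rw [abs_le]
    have h4 : (N : ℝ) = 2 * M + 1 := by rw [hM]; push_cast; ring
    have h5 : (i : ℝ) + 1 ≤ N := by exact_mod_cast hi
    push_cast
    constructor <;> linarith [(Nat.cast_nonneg i : (0 : ℝ) ≤ i)]
  · simp

lemma intervalAverage_one {N : ℕ} (hN : Odd N) : intervalAverage N 1 = 1 := by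
  have := norm_intervalAverage_sub_one_le hN (ζ := 1) (by simp)
  simpa [sub_eq_zero] using this

lemma norm_prod_sub_one_le {ι : Type*} (s : Finset ι) (f : ι → ℂ) (h : ∀ i ∈ s, ‖f i‖ ≤ 1) :
    ‖∏ i ∈ s, f i - 1‖ ≤ ∑ i ∈ s, ‖f i - 1‖ := by
  classical
  induction s using Finset.induction_on with
  | empty => simp
  | insert a s ha ih =>
    rw [Finset.prod_insert ha, Finset.sum_insert ha]
    have : f a * ∏ i ∈ s, f i - 1 = f a * (∏ i ∈ s, f i - 1) + (f a - 1) := by ring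
    rw [this]
    refine (norm_add_le _ _).trans ?_
    rw [norm_mul, add_comm]
    refine add_le_add le_rfl ?_
    refine (mul_le_of_le_one_left (norm_nonneg _) (h a (Finset.mem_insert_self a s))).trans ?_
    exact ih fun i hi => h i (Finset.mem_insert_of_mem hi)

variable {L : ℕ} {ζ₀ : ℂ} {ζ : Fin 3 → ℂ}

lemma norm_boxAverage_le (hL : Odd L) (h₀ : ‖ζ₀‖ = 1) (h : ∀ i, ‖ζ i‖ = 1) :
    ‖boxAverage L ζ₀ ζ‖ ≤ 1 := by
  rw [boxAverage, norm_mul, norm_prod]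
  exact mul_le_one₀ (norm_intervalAverage_le hL.pow h₀)
    (Finset.prod_nonneg fun _ _ => norm_nonneg _)
    (Finset.prod_le_one (fun _ _ => norm_nonneg _) fun i _ => norm_intervalAverage_le hL (h i))

lemma norm_avgSymbol_le (hL : Odd L) (r j : ℕ) (h₀ : ‖ζ₀‖ = 1) (h : ∀ i, ‖ζ i‖ = 1) :
    ‖avgSymbol L r j ζ₀ ζ‖ ≤ 1 := by
  rw [avgSymbol, norm_prod]
  refine Finset.prod_le_one (fun _ _ => norm_nonneg _) fun i _ => ?_
  rw [norm_pow]
  exact pow_le_one₀ (norm_nonneg _) (norm_boxAverage_le hL (by simp [h₀]) (by simp [h]))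

lemma avgSymbol_one (hL : Odd L) (r j : ℕ) : avgSymbol L r j 1 1 = 1 := by
  simp [avgSymbol, boxAverage, intervalAverage_one hL, intervalAverage_one (hL.pow (n := 2))]

/-- The average of a plane wave that is trivial on the blocked lattice vanishes, unless the plane
wave is trivial. -/
lemma eq_one_of_avgSymbol_ne_zero (hL : Odd L) {r : ℕ} (hr : 1 ≤ r) {j : ℕ}
    (h₀ : ζ₀ ^ L ^ (2 * j) = 1) (h : ∀ i, ζ i ^ L ^ j = 1) (hne : avgSymbol L r j ζ₀ ζ ≠ 0) :
    ζ₀ = 1 ∧ ∀ i, ζ i = 1 := by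
  induction j with
  | zero => simpa using And.intro h₀ h
  | succ j ih =>
    rw [avgSymbol, Finset.prod_range_succ] at hne
    have h1 := (pow_ne_zero_iff (by omega)).mp (right_ne_zero_of_mul hne)
    rw [boxAverage] at h1
    refine ih ?_ (fun i => ?_) (left_ne_zero_of_mul hne)
    · by_contra hc
      refine left_ne_zero_of_mul h1 (intervalAverage_eq_zero hL.pow ?_ hc)
      rw [← pow_mul, ← pow_add, ← h₀]; ring_nf
    · by_contra hc
      refine right_ne_zero_of_mul h1 (Finset.prod_eq_zero (Finset.mem_univ i)
        (intervalAverage_eq_zero hL ?_ hc))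
      rw [← pow_mul, ← pow_succ, h]

lemma sum_range_sq_pow_le {L : ℕ} (hL : 2 ≤ L) (n : ℕ) :
    ∑ i ∈ Finset.range n, (L : ℝ) ^ (2 * (i + 1)) ≤ 2 * (L : ℝ) ^ (2 * n) := by
  have h2 : (2 : ℝ) ≤ L := by exact_mod_cast hL
  induction n with
  | zero => simp
  | succ n ih =>
    rw [Finset.sum_range_succ]
    have : (L : ℝ) ^ (2 * (n + 1)) = L ^ 2 * L ^ (2 * n) := by ring
    have h4 : (4 : ℝ) ≤ L ^ 2 := by nlinarith
    have h5 : 0 ≤ (L : ℝ) ^ (2 * n) := by positivity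
    nlinarith

/-- The averages are close to `1` for small temporal momenta. -/
lemma norm_avgSymbol_sub_one_le (hL : Odd L) (hL1 : 1 < L) (r n : ℕ) (h₀ : ‖ζ₀‖ = 1) :
    ‖avgSymbol L r n ζ₀ 1 - 1‖ ≤ r * (L : ℝ) ^ (2 * n) * ‖ζ₀ - 1‖ := by
  have h1 : ∀ i : ℕ, ‖boxAverage L (ζ₀ ^ L ^ (2 * i)) (fun _ => 1)‖ ≤ 1 := fun i =>
    norm_boxAverage_le hL (by simp [h₀]) (by simp)
  rw [avgSymbol]
  simp only [Pi.one_apply, one_pow]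
  refine (norm_prod_sub_one_le _ _ fun i _ => ?_).trans ?_
  · rw [norm_pow]; exact pow_le_one₀ (norm_nonneg _) (h1 i)
  have h2 : ∀ i ∈ Finset.range n, ‖boxAverage L (ζ₀ ^ L ^ (2 * i)) (fun _ => 1) ^ r - 1‖
      ≤ r * ‖ζ₀ - 1‖ / 2 * (L : ℝ) ^ (2 * (i + 1)) := by
    intro i _
    have h3 := norm_prod_sub_one_le (Finset.range r)
      (fun _ => boxAverage L (ζ₀ ^ L ^ (2 * i)) (fun _ => 1)) fun _ _ => h1 i
    rw [Finset.prod_const, Finset.sum_const, Finset.card_range, nsmul_eq_mul] at h3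
    refine h3.trans ?_
    have h4 : ‖boxAverage L (ζ₀ ^ L ^ (2 * i)) (fun _ => 1) - 1‖
        ≤ (L : ℝ) ^ 2 / 2 * ((L : ℝ) ^ (2 * i) * ‖ζ₀ - 1‖) := by
      simp only [boxAverage, intervalAverage_one hL, Finset.prod_const_one, mul_one]
      refine (norm_intervalAverage_sub_one_le (hL.pow (n := 2)) (by simp [h₀])).trans ?_
      push_cast
      refine mul_le_mul_of_nonneg_left ?_ (by positivity)
      have := norm_zpow_sub_one_le h₀ ((L ^ (2 * i) : ℕ) : ℤ)
      rw [zpow_natCast] at this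
      refine this.trans (le_of_eq ?_)
      push_cast
      rw [abs_of_nonneg (by positivity)]
    refine (mul_le_mul_of_nonneg_left h4 (Nat.cast_nonneg r)).trans (le_of_eq ?_)
    ring
  refine (Finset.sum_le_sum h2).trans ?_
  rw [← Finset.mul_sum]
  refine (mul_le_mul_of_nonneg_left (sum_range_sq_pow_le (by omega) n) (by positivity)).trans
    (le_of_eq ?_)
  ring

end IntervalAverage

section BlockMatrix

/-- The momentum of the blocked lattice to which a momentum of the fine lattice is reduced. -/
def Lat.coarse {T S : ℕ} (T' S' : ℕ) (p : Lat T S) : Lat T' S' :=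
  ((p.1.val : ZMod T'), fun i => ((p.2 i).val : ZMod S'))

/-- The factor by which `Q_j` multiplies the character with momentum `p`. -/
def blockSymbol {T S : ℕ} [NeZero T] [NeZero S] (L r j : ℕ) (p : Lat T S) : ℂ :=
  avgSymbol L r j (ZMod.stdAddChar p.1) fun i => ZMod.stdAddChar (p.2 i)

lemma stdAddChar_ne_zero {N : ℕ} [NeZero N] (a : ZMod N) : (ZMod.stdAddChar a : ℂ) ≠ 0 := by
  intro h
  simpa [h] using norm_stdAddChar a

lemma stdAddChar_mul_int_eq_zpow {N : ℕ} [NeZero N] (a : ZMod N) (z : ℤ) :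
    (ZMod.stdAddChar (a * (z : ZMod N)) : ℂ) = ZMod.stdAddChar a ^ z := by
  rw [← AddChar.map_zsmul_eq_zpow, zsmul_eq_mul, mul_comm]

lemma stdAddChar_pow_eq {N K K' : ℕ} [NeZero K] [NeZero K'] (h : K = N * K') (a : ZMod K) :
    (ZMod.stdAddChar a : ℂ) ^ N = ZMod.stdAddChar ((a.val : ℕ) : ZMod K') := by
  have hN : (N : ℂ) ≠ 0 := by
    intro h0
    exact NeZero.ne K (by rw [h, Nat.cast_eq_zero.mp h0, zero_mul])
  have hK' : (K' : ℂ) ≠ 0 := NeZero.ne _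
  have h1 : (ZMod.stdAddChar a : ℂ) = Complex.exp (2 * Real.pi * Complex.I * (a.val : ℤ) / K) := by
    conv_lhs => rw [← ZMod.natCast_zmod_val a, ← Int.cast_natCast, ZMod.stdAddChar_coe]
  have h2 : (ZMod.stdAddChar ((a.val : ℕ) : ZMod K') : ℂ)
      = Complex.exp (2 * Real.pi * Complex.I * (a.val : ℤ) / K') := by
    rw [← Int.cast_natCast, ZMod.stdAddChar_coe]
  have hK : (K : ℂ) = N * K' := by exact_mod_cast congrArg (Nat.cast (R := ℂ)) h
  rw [h1, h2, ← Complex.exp_nat_mul, hK]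
  congr 1
  field_simp

variable {L r j T S T' S' : ℕ} [NeZero T] [NeZero S] [NeZero T'] [NeZero S']

lemma Lat.char_proj (p : Lat T S) (z : ZLat) :
    p.char (z.proj T S) = planeWave (ZMod.stdAddChar p.1) (fun i => ZMod.stdAddChar (p.2 i)) z := by
  simp only [Lat.char, ZLat.proj, planeWave, stdAddChar_mul_int_eq_zpow]

lemma Lat.proj_lift (w : Lat T S) : w.lift.proj T S = w := by
  ext <;> simp [Lat.lift, ZLat.proj]

lemma blockMatrix_mulVec (f : Lat T S → ℂ) (w : Lat T' S') :
    (blockMatrix L r j T S T' S').mulVec f w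
      = (blockAverage L r)^[j] (fun z => f (z.proj T S)) w.lift := by
  simp only [Matrix.mulVec, dotProduct, blockMatrix, Matrix.of_apply, mul_comm _ (f _)]
  have h : (fun z : ZLat => f (z.proj T S))
      = ∑ x, f x • (fun z : ZLat => (Set.indicator {x} 1 (z.proj T S) : ℂ)) := by
    ext z
    simp only [Finset.sum_apply, Pi.smul_apply, smul_eq_mul]
    rw [Finset.sum_eq_single (z.proj T S)]
    · simp
    · intro x _ hx; simp [hx.symm]
    · simp
  rw [h, iterate_blockAverage_sum]
  simp only [iterate_blockAverage_smul, Finset.sum_apply, Pi.smul_apply, smul_eq_mul]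
  refine Finset.sum_congr rfl fun x _ => ?_
  refine congrArg (fun g => f x * (blockAverage L r)^[j] g w.lift) (funext fun z => ?_)
  by_cases hz : z.proj T S = x <;> simp [hz]

lemma blockMatrix_mulVec_char (hT : T = L ^ (2 * j) * T') (hS : S = L ^ j * S') (p : Lat T S) :
    (blockMatrix L r j T S T' S').mulVec (fun x => p.char x)
      = blockSymbol L r j p • fun w => (p.coarse T' S').char w := by
  ext w
  rw [blockMatrix_mulVec]
  simp only [Lat.char_proj]
  rw [iterate_blockAverage_planeWave L r j (stdAddChar_ne_zero _) fun i => stdAddChar_ne_zero _]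
  simp only [Pi.smul_apply, smul_eq_mul, blockSymbol]
  congr 1
  conv_rhs => rw [← Lat.proj_lift w, Lat.char_proj]
  simp only [Lat.coarse, stdAddChar_pow_eq hT, stdAddChar_pow_eq hS]

lemma norm_blockSymbol_le (hL : Odd L) (p : Lat T S) : ‖blockSymbol L r j p‖ ≤ 1 :=
  norm_avgSymbol_le hL r j (norm_stdAddChar _) fun _ => norm_stdAddChar _

lemma blockSymbol_zero (hL : Odd L) : blockSymbol L r j (0 : Lat T S) = 1 := by
  have := avgSymbol_one hL r j
  rw [blockSymbol]
  simp only [Prod.fst_zero, Prod.snd_zero, Pi.zero_apply, AddChar.map_zero_eq_one]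
  exact this

lemma Lat.coarse_zero : (0 : Lat T S).coarse T' S' = 0 := by
  ext <;> simp [Lat.coarse]

/-- In the fibre above zero momentum, only zero momentum itself survives the averaging. -/
lemma eq_zero_of_blockSymbol_ne_zero (hL : Odd L) (hr : 1 ≤ r) (hT : T = L ^ (2 * j) * T')
    (hS : S = L ^ j * S') {p : Lat T S} (hp : p.coarse T' S' = 0) (h : blockSymbol L r j p ≠ 0) :
    p = 0 := by
  have h1 : ∀ {N : ℕ} [NeZero N] (a : ZMod N), (ZMod.stdAddChar a : ℂ) = 1 → a = 0 := by
    intro N _ a ha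
    exact ZMod.injective_stdAddChar (by rw [ha, AddChar.map_zero_eq_one])
  have hp1 : ((p.1.val : ℕ) : ZMod T') = 0 := congrArg Prod.fst hp
  have hp2 : ∀ i, (((p.2 i).val : ℕ) : ZMod S') = 0 := fun i => congrFun (congrArg Prod.snd hp) i
  obtain ⟨h2, h3⟩ := eq_one_of_avgSymbol_ne_zero hL hr
    (by rw [stdAddChar_pow_eq hT, hp1, AddChar.map_zero_eq_one])
    (fun i => by rw [stdAddChar_pow_eq hS, hp2, AddChar.map_zero_eq_one]) h
  exact Prod.ext (h1 _ h2) (funext fun i => h1 _ (h3 i))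

/-- In momentum space, averaging sums over the fibre of fine momenta above a blocked momentum. -/
lemma fourierCoeff_blockMatrix (hT : T = L ^ (2 * j) * T') (hS : S = L ^ j * S')
    (f : Lat T S → ℂ) (k : Lat T' S') :
    fourierCoeff ((blockMatrix L r j T S T' S').mulVec f) k
      = ∑ p : Lat T S,
        if p.coarse T' S' = k then blockSymbol L r j p * fourierCoeff f p else 0 := by
  conv_lhs => rw [← fourier_inversion f]
  rw [Matrix.mulVec_sum, fourierCoeff_sum]
  refine Finset.sum_congr rfl fun p _ => ?_
  rw [Matrix.mulVec_smul, blockMatrix_mulVec_char hT hS, fourierCoeff_smul, fourierCoeff_smul,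
    fourierCoeff_char]
  split_ifs <;> ring

section Positivity

open scoped ComplexOrder

lemma star_blockMatrix (w : Lat T' S') (x : Lat T S) :
    star (blockMatrix L r j T S T' S' w x) = blockMatrix L r j T S T' S' w x := by
  have h := blockMatrix_nonneg L r j T S T' S' w x
  rw [← Complex.norm_of_nonneg' h, Complex.star_def, Complex.conj_ofReal]

lemma fourierCoeff_blockAdjoint [NeZero L] (hT : T = L ^ (2 * j) * T') (hS : S = L ^ j * S')
    (g : Lat T' S' → ℂ) (p : Lat T S) :
    fourierCoeff ((blockAdjoint L r j T S T' S').mulVec g) p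
      = star (blockSymbol L r j p) * fourierCoeff g (p.coarse T' S') := by
  have h1 : ∀ w, star (blockSymbol L r j p) * star ((p.coarse T' S').char w)
      = ∑ x, blockMatrix L r j T S T' S' w x * star (p.char x) := by
    intro w
    have := congrArg star (congrFun (blockMatrix_mulVec_char (r := r) hT hS p) w)
    simp only [Matrix.mulVec, dotProduct, Pi.smul_apply, smul_eq_mul, star_sum, star_mul',
      star_blockMatrix] at this
    rw [this]
  have hcard : (1 / (Fintype.card (Lat T S) : ℂ)) * (L : ℂ) ^ (5 * j)
      = 1 / (Fintype.card (Lat T' S') : ℂ) := by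
    have hL : (L : ℂ) ≠ 0 := NeZero.ne _
    have hT' : (T' : ℂ) ≠ 0 := NeZero.ne _
    have hS' : (S' : ℂ) ≠ 0 := NeZero.ne _
    rw [Lat.card_eq, Lat.card_eq, hT, hS]
    push_cast
    field_simp
    ring
  rw [blockAdjoint, Matrix.smul_mulVec, fourierCoeff_smul, fourierCoeff, ← mul_assoc,
    mul_comm ((L : ℂ) ^ (5 * j)), hcard, fourierCoeff, mul_left_comm]
  congr 1
  simp only [Matrix.mulVec, dotProduct, Matrix.transpose_apply, Finset.mul_sum]
  rw [Finset.sum_comm]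
  refine Finset.sum_congr rfl fun w _ => ?_
  rw [← mul_assoc, h1, Finset.sum_mul]
  exact Finset.sum_congr rfl fun x _ => by ring

/-- The sum of the squares of the averaging factors over the momenta that reduce to `k`. It is
the eigenvalue of `Q_j Q_j^*` at `k`. -/
def fibreWeight (L r j T S : ℕ) {T' S' : ℕ} [NeZero T] [NeZero S] (k : Lat T' S') : ℝ :=
  ∑ p : Lat T S, if p.coarse T' S' = k then ‖blockSymbol L r j p‖ ^ 2 else 0

lemma fibreWeight_nonneg (k : Lat T' S') : 0 ≤ fibreWeight L r j T S k :=
  Finset.sum_nonneg fun p _ => by split_ifs <;> positivity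

lemma block_mul_adjoint_mulVec_char [NeZero L] (hT : T = L ^ (2 * j) * T') (hS : S = L ^ j * S')
    (k : Lat T' S') :
    (blockMatrix L r j T S T' S' * blockAdjoint L r j T S T' S').mulVec (fun w => k.char w)
      = (fibreWeight L r j T S k : ℂ) • fun w => k.char w := by
  refine fourierCoeff_injective fun l => ?_
  rw [← Matrix.mulVec_mulVec, fourierCoeff_blockMatrix hT hS, fourierCoeff_smul, fourierCoeff_char]
  simp only [fourierCoeff_blockAdjoint hT hS, fourierCoeff_char]
  by_cases hk : k = l
  · subst hk
    simp only [fibreWeight, if_true, mul_one]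
    push_cast
    refine Finset.sum_congr rfl fun p _ => ?_
    split_ifs with h h'
    · rw [mul_one, Complex.star_def, Complex.mul_conj, Complex.normSq_eq_norm_sq]
    · exact absurd h.symm h'
    · simp
  · rw [if_neg hk, mul_zero]
    refine Finset.sum_eq_zero fun p _ => ?_
    split_ifs with h1 h2
    · exact absurd (h2.trans h1) hk
    · simp
    · rfl

lemma fibreWeight_zero (hL : Odd L) (hr : 1 ≤ r) (hT : T = L ^ (2 * j) * T')
    (hS : S = L ^ j * S') : fibreWeight L r j T S (0 : Lat T' S') = 1 := by
  rw [fibreWeight, Finset.sum_eq_single (0 : Lat T S)]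
  · rw [if_pos Lat.coarse_zero, blockSymbol_zero hL]; simp
  · intro p _ hp
    split_ifs with h
    · by_contra hne
      exact hp (eq_zero_of_blockSymbol_ne_zero hL hr hT hS h fun h0 => hne (by simp [h0]))
    · rfl
  · simp

/-- `Q_j Q_j^*` is a contraction: it has nonnegative matrix elements, and constants are
eigenvectors with eigenvalue `1`. -/
lemma fibreWeight_le_one (hL : Odd L) (hr : 1 ≤ r) (hT : T = L ^ (2 * j) * T')
    (hS : S = L ^ j * S') (k : Lat T' S') : fibreWeight L r j T S k ≤ 1 := by
  have : NeZero L := ⟨hL.pos.ne'⟩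
  set P := blockMatrix L r j T S T' S' * blockAdjoint L r j T S T' S' with hP
  have hnn : ∀ v w, 0 ≤ P v w := by
    intro v w
    rw [hP, Matrix.mul_apply]
    refine Finset.sum_nonneg fun x _ => mul_nonneg (blockMatrix_nonneg _ _ _ _ _ _ _ _ _) ?_
    rw [blockAdjoint, Matrix.smul_apply, Matrix.transpose_apply, smul_eq_mul]
    refine mul_nonneg (pow_nonneg (Nat.cast_nonneg L) _) (blockMatrix_nonneg _ _ _ _ _ _ _ _ _)
  have h1 := congrFun (block_mul_adjoint_mulVec_char (r := r) hT hS k) 0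
  have h2 := congrFun (block_mul_adjoint_mulVec_char (r := r) hT hS (0 : Lat T' S')) 0
  rw [fibreWeight_zero hL hr hT hS] at h2
  simp only [← hP, Matrix.mulVec, dotProduct, Pi.smul_apply, smul_eq_mul, Lat.char_zero_right,
    Lat.char_zero_left, mul_one, Complex.ofReal_one] at h1 h2
  have h3 : ‖∑ w, P 0 w * k.char w‖ ≤ ∑ w, ‖P 0 w‖ := by
    refine (norm_sum_le _ _).trans (le_of_eq ?_)
    simp only [norm_mul, Lat.norm_char, mul_one]
  have h4 : ((∑ w, ‖P 0 w‖ : ℝ) : ℂ) = 1 := by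
    rw [← h2]
    push_cast
    exact Finset.sum_congr rfl fun w _ => Complex.norm_of_nonneg' (hnn 0 w)
  have h5 : ∑ w, ‖P 0 w‖ = 1 := by exact_mod_cast h4
  rw [h1, h5, Complex.norm_real, Real.norm_eq_abs, abs_of_nonneg (fibreWeight_nonneg k)] at h3
  exact h3

end Positivity

/-- The eigenvalue of `1 + ∑_{j=1}^{n-1} L^{-2j} Q_j Q_j^*` at `k`. -/
def frakSymbol (L r n : ℕ) {T' S' : ℕ} [NeZero L] [NeZero T'] [NeZero S'] (k : Lat T' S') : ℝ :=
  1 + ∑ j ∈ Finset.Icc 1 (n - 1), (1 / (L : ℝ) ^ (2 * j)) *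
    fibreWeight L r j (L ^ (2 * j) * T') (L ^ j * S') k

variable [NeZero L]

lemma frakQInv_mulVec_char (n : ℕ) (k : Lat T' S') :
    (frakQInv L r n T' S').mulVec (fun w => k.char w)
      = (frakSymbol L r n k : ℂ) • fun w => k.char w := by
  rw [frakQInv, Matrix.add_mulVec, Matrix.one_mulVec, Matrix.sum_mulVec]
  simp only [Matrix.smul_mulVec, block_mul_adjoint_mulVec_char rfl rfl, smul_smul]
  rw [← Finset.sum_smul, frakSymbol]
  push_cast
  rw [add_smul, one_smul]

lemma one_le_frakSymbol (n : ℕ) (k : Lat T' S') : 1 ≤ frakSymbol L r n k := by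
  rw [frakSymbol, le_add_iff_nonneg_right]
  exact Finset.sum_nonneg fun j _ => mul_nonneg (by positivity) (fibreWeight_nonneg k)

/-- Each `Q_j Q_j^*` has norm at most one, so that the sum is dominated by a geometric series. -/
lemma frakSymbol_le_two (hL : Odd L) (hL1 : 1 < L) (hr : 1 ≤ r) (n : ℕ) (k : Lat T' S') :
    frakSymbol L r n k ≤ 2 := by
  have h1 : ∀ j ∈ Finset.Icc 1 (n - 1), (1 / (L : ℝ) ^ (2 * j)) *
      fibreWeight L r j (L ^ (2 * j) * T') (L ^ j * S') k ≤ (1 / 2 : ℝ) ^ j := by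
    intro j _
    have h2 := fibreWeight_le_one hL hr (j := j) (T' := T') (S' := S') rfl rfl k
    refine (mul_le_of_le_one_right (by positivity) h2).trans ?_
    rw [one_div_pow]
    refine one_div_le_one_div_of_le (by positivity) ?_
    have h3 : (2 : ℝ) ≤ L := by exact_mod_cast hL1
    rw [mul_comm, pow_mul]
    have h4 := pow_le_pow_left₀ (by norm_num) h3 j
    have h5 : (1 : ℝ) ≤ (L : ℝ) ^ j := one_le_pow₀ (by linarith)
    nlinarith
  have h2 : ∑ j ∈ Finset.Icc 1 (n - 1), (1 / 2 : ℝ) ^ j ≤ 1 := by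
    have : ∀ N : ℕ, ∑ j ∈ Finset.Icc 1 N, (1 / 2 : ℝ) ^ j = 1 - (1 / 2) ^ N := by
      intro N
      induction N with
      | zero => simp
      | succ N ih => rw [Finset.sum_Icc_succ_top (by omega), ih]; ring
    rw [this]
    have : (0 : ℝ) < (1 / 2) ^ (n - 1) := by positivity
    linarith
  rw [frakSymbol]
  linarith [Finset.sum_le_sum h1]

lemma isUnit_frakQInv (n : ℕ) : IsUnit (frakQInv L r n T' S') := by
  refine isUnit_of_eigen (frakQInv_mulVec_char n) fun p => ?_
  have := one_le_frakSymbol (L := L) (r := r) n p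
  exact_mod_cast (by linarith : (0 : ℝ) < frakSymbol L r n p).ne'

lemma frakQ_mulVec_char (a : ℝ) (n : ℕ) (k : Lat T' S') :
    (frakQ a L r n T' S').mulVec (fun w => k.char w)
      = ((a / frakSymbol L r n k : ℝ) : ℂ) • fun w => k.char w := by
  have hu := (Matrix.isUnit_iff_isUnit_det _).mp (isUnit_frakQInv (L := L) (r := r)
    (T' := T') (S' := S') n)
  have h0 : (frakSymbol L r n k : ℂ) ≠ 0 := by
    have := one_le_frakSymbol (L := L) (r := r) n k
    exact_mod_cast (by linarith : (0 : ℝ) < frakSymbol L r n k).ne'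
  have h1 := congrArg (fun v => (frakQInv L r n T' S')⁻¹.mulVec v)
    (frakQInv_mulVec_char (L := L) (r := r) n k)
  simp only [Matrix.mulVec_mulVec, Matrix.nonsing_inv_mul _ hu, Matrix.one_mulVec,
    Matrix.mulVec_smul] at h1
  rw [frakQ, Matrix.smul_mulVec]
  conv_rhs => rw [h1]
  rw [smul_smul]
  push_cast
  rw [div_mul_cancel₀ _ h0]

end BlockMatrix

/-! ### The gap of the propagator -/

/-- The denominator `1 - exp(-ε(k)) exp(2πi l / T)` of the propagator. -/
def propDenom {T : ℕ} [NeZero T] (ε : (Fin 3 → ℝ) → ℝ) (l : ZMod T) (k : Fin 3 → ℝ) : ℂ :=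
  1 - (Real.exp (-ε k) : ℂ) * ZMod.stdAddChar l

/-- The temporal frequency `|l| / T` of a mode, in `[0, 1/2]`. -/
def freq {T : ℕ} (l : ZMod T) : ℝ := (l.valMinAbs.natAbs : ℝ) / T

/-- The constant in the lower bound on the denominator of the propagator. -/
def gapConst (κ M : ℝ) : ℝ := min (κ / (2 * (1 + M))) 1

section Gap

variable {T : ℕ} [NeZero T]

lemma freq_nonneg (l : ZMod T) : 0 ≤ freq l := by unfold freq; positivity

lemma freq_le_half (l : ZMod T) : freq l ≤ 1 / 2 := by
  have hT : (0 : ℝ) < T := by exact_mod_cast NeZero.pos T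
  unfold freq
  rw [div_le_iff₀ hT]
  have h : ((2 * l.valMinAbs.natAbs : ℕ) : ℝ) ≤ T := by
    exact_mod_cast (by have := l.natAbs_valMinAbs_le; omega : 2 * l.valMinAbs.natAbs ≤ T)
  push_cast at h ⊢
  linarith

lemma freq_eq_zero {l : ZMod T} : freq l = 0 ↔ l = 0 := by
  have hT : (T : ℝ) ≠ 0 := NeZero.ne _
  simp [freq, hT]

lemma stdAddChar_eq_exp (l : ZMod T) : (ZMod.stdAddChar l : ℂ)
    = Complex.exp (Complex.I * ((2 * Real.pi * l.valMinAbs / T : ℝ) : ℂ)) := by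
  have := stdAddChar_mul_intCast l 1
  simpa using this

lemma freq_le_norm_stdAddChar_sub_one (l : ZMod T) :
    4 * freq l ≤ ‖(ZMod.stdAddChar l : ℂ) - 1‖ := by
  have hpi := Real.pi_pos
  have hT : (0 : ℝ) < T := by exact_mod_cast NeZero.pos T
  rw [stdAddChar_eq_exp, Complex.norm_exp_I_mul_ofReal_sub_one, norm_mul, Real.norm_eq_abs,
    Real.norm_eq_abs, abs_two]
  have habs : |2 * Real.pi * (l.valMinAbs : ℝ) / T / 2| = Real.pi * freq l := by
    rw [freq, Nat.cast_natAbs, Int.cast_abs,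
      show 2 * Real.pi * (l.valMinAbs : ℝ) / T / 2 = Real.pi * ((l.valMinAbs : ℝ) / T) by ring,
      abs_mul, abs_div, abs_of_pos hpi, abs_of_pos hT]
  have h := Real.mul_abs_le_abs_sin (x := 2 * Real.pi * (l.valMinAbs : ℝ) / T / 2) (by
    rw [habs]; nlinarith [freq_le_half l])
  rw [habs] at h
  have : 2 / Real.pi * (Real.pi * freq l) = 2 * freq l := by field_simp
  linarith

variable {κ M : ℝ} {ε : (Fin 3 → ℝ) → ℝ}

lemma DispersionBounds.M_nonneg (hε : DispersionBounds κ M ε) : 0 ≤ M :=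
  (hε.nonneg 0).trans (hε.upper 0)

lemma DispersionBounds.gapConst_pos (hε : DispersionBounds κ M ε) (hκ : 0 < κ) :
    0 < gapConst κ M := by
  have := hε.M_nonneg
  exact lt_min (by positivity) one_pos

lemma div_one_add_le_one_sub_exp_neg {x : ℝ} (hx : 0 ≤ x) : x / (1 + x) ≤ 1 - Real.exp (-x) := by
  have h := Real.add_one_le_exp x
  have h2 : Real.exp (-x) ≤ 1 / (1 + x) := by
    rw [Real.exp_neg, ← one_div]
    exact one_div_le_one_div_of_le (by linarith) (by linarith)
  have h3 : x / (1 + x) = 1 - 1 / (1 + x) := by field_simp; ring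
  linarith

lemma exp_neg_le_one {x : ℝ} (hx : 0 ≤ x) : Real.exp (-x) ≤ 1 := by
  rw [Real.exp_le_one_iff]; linarith

/-- The gap of `D₀`: the lower bound on the dispersion relation controls `1 - exp(-ε)`, and the
phase `exp(i k₀) - 1` controls the frequency. Both are at most a multiple of the modulus of the
denominator. -/
lemma DispersionBounds.gap (hε : DispersionBounds κ M ε) (l : ZMod T)
    {k : Fin 3 → ℝ} (hk : ‖k‖ ≤ 3 * Real.pi / 2) :
    gapConst κ M * (‖k‖ ^ 2 + freq l) ≤ ‖propDenom ε l k‖ := by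
  have hM := hε.M_nonneg
  have h0 := hε.nonneg k
  have h1 := hε.lower k hk
  set ρ := Real.exp (-ε k) with hρ
  have hρ1 : ρ ≤ 1 := exp_neg_le_one h0
  have hρ0 : 0 < ρ := Real.exp_pos _
  set ζ : ℂ := ZMod.stdAddChar l
  have hζ : ‖ζ‖ = 1 := norm_stdAddChar l
  have h2 : 1 - ρ ≤ ‖propDenom ε l k‖ := by
    have := norm_sub_norm_le (1 : ℂ) ((ρ : ℂ) * ζ)
    rw [norm_one, norm_mul, hζ, mul_one, Complex.norm_real, Real.norm_eq_abs,
      abs_of_pos hρ0] at this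
    exact this
  have h3 : ‖ζ - 1‖ ≤ 2 * ‖propDenom ε l k‖ := by
    have h4 : ζ - 1 = (1 - ρ : ℝ) * ζ - propDenom ε l k := by
      simp only [propDenom, ← hρ]; push_cast; ring
    rw [h4]
    refine (norm_sub_le _ _).trans ?_
    rw [norm_mul, hζ, mul_one, Complex.norm_real, Real.norm_eq_abs, abs_of_nonneg (by linarith)]
    linarith
  have h4 := freq_le_norm_stdAddChar_sub_one l
  have h5 : κ / (1 + M) * ‖k‖ ^ 2 ≤ 1 - ρ := by
    have h6 := div_one_add_le_one_sub_exp_neg h0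
    have h7 : ε k / (1 + M) ≤ ε k / (1 + ε k) :=
      div_le_div_of_nonneg_left h0 (by linarith) (by linarith [hε.upper k])
    have h8 : κ / (1 + M) * ‖k‖ ^ 2 ≤ ε k / (1 + M) := by
      rw [div_mul_eq_mul_div]
      exact div_le_div_of_nonneg_right h1 (by linarith)
    linarith
  have h9 : gapConst κ M * ‖k‖ ^ 2 ≤ κ / (2 * (1 + M)) * ‖k‖ ^ 2 :=
    mul_le_mul_of_nonneg_right (min_le_left _ _) (by positivity)
  have h10 : gapConst κ M * freq l ≤ 1 * freq l :=
    mul_le_mul_of_nonneg_right (min_le_right _ _) (freq_nonneg l)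
  have h11 : κ / (2 * (1 + M)) * ‖k‖ ^ 2 = (κ / (1 + M) * ‖k‖ ^ 2) / 2 := by
    field_simp
  linarith

lemma DispersionBounds.propDenom_re_nonneg (hε : DispersionBounds κ M ε) (l : ZMod T)
    (k : Fin 3 → ℝ) : 0 ≤ (propDenom ε l k).re := by
  have h := (Complex.re_le_norm ((Real.exp (-ε k) : ℂ) * ZMod.stdAddChar l))
  rw [norm_mul, norm_stdAddChar, mul_one, Complex.norm_real, Real.norm_eq_abs,
    abs_of_pos (Real.exp_pos _)] at h
  have := exp_neg_le_one (hε.nonneg k)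
  rw [propDenom, Complex.sub_re, Complex.one_re]
  linarith

end Gap

section Momentum

variable {T S : ℕ} [NeZero T] [NeZero S]

lemma abs_momentum (q : Fin 3 → ZMod S) (i : Fin 3) :
    |momentum q i| = 2 * Real.pi * freq (q i) := by
  have hS : (0 : ℝ) < S := by exact_mod_cast NeZero.pos S
  rw [momentum, freq, Nat.cast_natAbs, Int.cast_abs, abs_div, abs_mul, abs_of_pos hS,
    abs_of_pos Real.two_pi_pos, mul_div_assoc]

lemma norm_momentum_le (q : Fin 3 → ZMod S) : ‖momentum q‖ ≤ Real.pi := by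
  rw [pi_norm_le_iff_of_nonneg Real.pi_pos.le]
  intro i
  rw [Real.norm_eq_abs, abs_momentum]
  nlinarith [freq_le_half (q i), Real.pi_pos]

lemma norm_momentum_le' (q : Fin 3 → ZMod S) : ‖momentum q‖ ≤ 3 * Real.pi / 2 := by
  linarith [norm_momentum_le q, Real.pi_pos]

lemma freq_le_norm_momentum (q : Fin 3 → ZMod S) (i : Fin 3) :
    2 * Real.pi * freq (q i) ≤ ‖momentum q‖ := by
  rw [← abs_momentum]; exact norm_le_pi_norm (momentum q) i

lemma momentum_zero : momentum (0 : Fin 3 → ZMod S) = 0 := by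
  ext i; simp [momentum]

lemma momentum_eq_zero {q : Fin 3 → ZMod S} (h : ‖momentum q‖ = 0) : q = 0 := by
  ext i
  have h1 := freq_le_norm_momentum q i
  rw [h] at h1
  rw [Pi.zero_apply, ← freq_eq_zero]
  nlinarith [freq_nonneg (q i), Real.pi_gt_three]

variable {κ M : ℝ} {ε : (Fin 3 → ℝ) → ℝ}

lemma dSymbol_eq (p : Lat T S) : dSymbol ε p = propDenom ε p.1 (momentum p.2) := rfl

lemma DispersionBounds.dSymbol_eq_of_spatial_zero (hε : DispersionBounds κ M ε) {p : Lat T S}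
    (hp : p.2 = 0) : dSymbol ε p = 1 - ZMod.stdAddChar p.1 := by
  rw [dSymbol, hp, momentum_zero, hε.zero]; simp

lemma DispersionBounds.dSymbol_ne_zero (hε : DispersionBounds κ M ε) (hκ : 0 < κ) {p : Lat T S}
    (hp : p ≠ 0) : dSymbol ε p ≠ 0 := by
  intro h0
  have h := hε.gap p.1 (norm_momentum_le' p.2)
  rw [← dSymbol_eq, h0, norm_zero] at h
  have hc := hε.gapConst_pos hκ
  have h1 : ‖momentum p.2‖ ^ 2 + freq p.1 ≤ 0 := by
    by_contra hc'
    push Not at hc'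
    linarith [mul_pos hc hc']
  have h2 := freq_nonneg p.1
  have h3 : ‖momentum p.2‖ = 0 := by nlinarith [norm_nonneg (momentum p.2)]
  have h4 : freq p.1 = 0 := by nlinarith [norm_nonneg (momentum p.2)]
  exact hp (Prod.ext (freq_eq_zero.mp h4) (momentum_eq_zero h3))

end Momentum

/-! ### The Green's function in momentum space -/

section Fibre

variable {ι κ : Type*} [Fintype ι] [DecidableEq ι] [DecidableEq κ] {A q f g : ι → ℂ} {b : κ → ℝ}
  {c : ι → κ}

/-- The sum over the other momenta of the fibre of `i` that dresses the averaging operator. -/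
def fibreSum (A q : ι → ℂ) (c : ι → κ) (i : ι) : ℂ :=
  ∑ j, if j ≠ i ∧ c j = c i then ((‖q j‖ ^ 2 : ℝ) : ℂ) / A j else 0

/-- The equation satisfied by the Fourier coefficients of a solution of
`(D_n + Q_n^* 𝔔_n Q_n) f = g`. On each fibre it is a diagonal plus a rank one problem. -/
def FibreEquation (A q : ι → ℂ) (b : κ → ℝ) (c : ι → κ) (f g : ι → ℂ) : Prop :=
  ∀ i, A i * f i + star (q i) * (b (c i) * ∑ j, if c j = c i then q j * f j else 0) = g i

lemma mul_star_eq (z : ℂ) : z * star z = ((‖z‖ ^ 2 : ℝ) : ℂ) := by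
  rw [Complex.star_def, Complex.mul_conj, Complex.normSq_eq_norm_sq]

/-- The diagonal coefficient of the inverse, from the resolvent formula for rank one
perturbations. -/
lemma FibreEquation.diag {i : ι}
    (h : FibreEquation A q b c f (Pi.single i 1)) (hA : ∀ j, j ≠ i → c j = c i → A j ≠ 0) :
    f i * (A i * (1 + b (c i) * fibreSum A q c i) + b (c i) * ((‖q i‖ ^ 2 : ℝ) : ℂ))
      = 1 + b (c i) * fibreSum A q c i := by
  set s : ℂ := ∑ j, if c j = c i then q j * f j else 0 with hs
  have h1 : ∀ j, j ≠ i → c j = c i → f j = -(star (q j) * (b (c i) * s)) / A j := by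
    intro j hj hc
    have := h j
    rw [hc, ← hs, Pi.single_eq_of_ne hj] at this
    rw [eq_div_iff (hA j hj hc)]
    linear_combination this
  have h2 : s = q i * f i + -(b (c i) * s) * fibreSum A q c i := by
    conv_lhs => rw [hs]
    rw [← Finset.add_sum_erase _ _ (Finset.mem_univ i), if_pos rfl, fibreSum, Finset.mul_sum,
      ← Finset.add_sum_erase Finset.univ (fun j => -(b (c i) * s) *
        if j ≠ i ∧ c j = c i then ((‖q j‖ ^ 2 : ℝ) : ℂ) / A j else 0) (Finset.mem_univ i)]
    rw [if_neg (by simp), mul_zero, zero_add]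
    congr 1
    refine Finset.sum_congr rfl fun j hj => ?_
    have hj' := Finset.ne_of_mem_erase hj
    by_cases hc : c j = c i
    · rw [if_pos hc, if_pos ⟨hj', hc⟩, h1 j hj' hc, ← mul_star_eq]
      ring
    · rw [if_neg hc, if_neg (by tauto), mul_zero]
  have h3 := h i
  rw [← hs, Pi.single_eq_same] at h3
  rw [← mul_star_eq]
  linear_combination (1 + b (c i) * fibreSum A q c i) * h3 - star (q i) * b (c i) * h2

/-- On a fibre on which some `A` vanishes and `q = 1` there, the other coefficients are those of
the inverse of `A`. -/
lemma FibreEquation.of_zero {i i₀ : ι} (h : FibreEquation A q b c f (Pi.single i 1))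
    (hi : i ≠ i₀) (hc : c i = c i₀) (hA : A i₀ = 0) (hq : q i₀ = 1) : A i * f i = 1 := by
  have h0 := h i₀
  rw [hA, hq, zero_mul, zero_add, star_one, one_mul, Pi.single_eq_of_ne hi.symm] at h0
  have h1 := h i
  rw [hc, h0, mul_zero, add_zero, Pi.single_eq_same] at h1
  exact h1

/-- Uniqueness, on a fibre on which no `A` vanishes. -/
lemma FibreEquation.eq_zero {i : ι} (h : FibreEquation A q b c f 0)
    (hA : ∀ j, c j = c i → A j ≠ 0)
    (hW : 1 + b (c i) * ∑ j, (if c j = c i then ((‖q j‖ ^ 2 : ℝ) : ℂ) / A j else 0) ≠ 0) :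
    f i = 0 := by
  set s : ℂ := ∑ j, if c j = c i then q j * f j else 0 with hs
  have h1 : ∀ j, c j = c i → f j = -(star (q j) * (b (c i) * s)) / A j := by
    intro j hc
    have := h j
    rw [hc, ← hs, Pi.zero_apply] at this
    rw [eq_div_iff (hA j hc)]
    linear_combination this
  have h2 : s = -(b (c i) * s) * ∑ j, (if c j = c i then ((‖q j‖ ^ 2 : ℝ) : ℂ) / A j else 0) := by
    conv_lhs => rw [hs]
    rw [Finset.mul_sum]
    refine Finset.sum_congr rfl fun j _ => ?_
    by_cases hc : c j = c i
    · rw [if_pos hc, if_pos hc, h1 j hc, ← mul_star_eq]; ring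
    · rw [if_neg hc, if_neg hc, mul_zero]
  have h3 : s = 0 := by
    have : s * (1 + b (c i) * ∑ j, (if c j = c i then ((‖q j‖ ^ 2 : ℝ) : ℂ) / A j else 0)) = 0 := by
      linear_combination h2
    exact (mul_eq_zero.mp this).resolve_right hW
  rw [h1 i rfl, h3]; simp

lemma div_re_nonneg {x : ℝ} (hx : 0 ≤ x) {z : ℂ} (hz : 0 ≤ z.re) : 0 ≤ ((x : ℂ) / z).re := by
  rw [div_eq_mul_inv, Complex.re_ofReal_mul, Complex.inv_re]
  exact mul_nonneg hx (div_nonneg hz (Complex.normSq_nonneg z))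

lemma one_le_re_one_add {x : ℝ} (hx : 0 ≤ x) {z : ℂ} (hz : 0 ≤ z.re) :
    1 ≤ (1 + (x : ℂ) * z).re := by
  rw [Complex.add_re, Complex.one_re, Complex.re_ofReal_mul]
  linarith [mul_nonneg hx hz]

lemma fibreSum_re_nonneg (hA : ∀ j, 0 ≤ (A j).re) (i : ι) : 0 ≤ (fibreSum A q c i).re := by
  rw [fibreSum, Complex.re_sum]
  refine Finset.sum_nonneg fun j _ => ?_
  split_ifs
  · exact div_re_nonneg (by positivity) (hA j)
  · simp

/-- The diagonal coefficient differs from `1 / A` by at most `β / |A|²`. -/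
lemma norm_diag_sub_inv_le {x A E : ℂ} {β : ℝ} (h : x * (A * E + β) = E) (hA : A ≠ 0)
    (hAre : 0 ≤ A.re) (hE : 1 ≤ E.re) (hβ : 0 ≤ β) : ‖x - 1 / A‖ ≤ β / ‖A‖ ^ 2 := by
  have hW : 1 ≤ (E + (β : ℂ) / A).re := by
    rw [Complex.add_re]; linarith [div_re_nonneg hβ hAre]
  have hWn : 1 ≤ ‖E + (β : ℂ) / A‖ := hW.trans (Complex.re_le_norm _)
  have hW0 : E + (β : ℂ) / A ≠ 0 := fun h0 => by rw [h0, norm_zero] at hWn; linarith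
  have hx : x - 1 / A = -((β : ℂ) / (A ^ 2 * (E + (β : ℂ) / A))) := by
    have h1 : A * (E + (β : ℂ) / A) = A * E + β := by rw [mul_add, mul_div_cancel₀ _ hA]
    have h3 : A * E + β ≠ 0 := by
      rw [← h1]; exact mul_ne_zero hA hW0
    rw [eq_div_iff h3 |>.mpr h, div_sub_div _ _ h3 hA, ← neg_div, sq, mul_assoc, h1, mul_one,
      mul_comm (A * E + (β : ℂ)) A]
    ring
  rw [hx, norm_neg, norm_div, norm_mul, norm_pow, Complex.norm_real, Real.norm_eq_abs,
    abs_of_nonneg hβ]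
  have hA' : 0 < ‖A‖ ^ 2 := by positivity
  exact div_le_div_of_nonneg_left hβ hA' (le_mul_of_one_le_right hA'.le hWn)

/-- For real positive `A` the difference from `1 / A` is at most `1 / A`. -/
lemma norm_diag_sub_inv_le_of_pos {x E : ℂ} {A β : ℝ} (h : x * ((A : ℂ) * E + β) = E)
    (hA : 0 < A) (hE : 1 ≤ E.re) (hβ : 0 ≤ β) : ‖x - 1 / A‖ ≤ 1 / A := by
  have hre : A + β ≤ ((A : ℂ) * E + β).re := by
    rw [Complex.add_re, Complex.re_ofReal_mul, Complex.ofReal_re]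
    nlinarith
  have hn : A + β ≤ ‖(A : ℂ) * E + β‖ := hre.trans (Complex.re_le_norm _)
  have h0 : (A : ℂ) * E + β ≠ 0 := fun h0 => by rw [h0, norm_zero] at hn; linarith
  have hA' : (A : ℂ) ≠ 0 := by exact_mod_cast hA.ne'
  have hx : x - 1 / A = -((β : ℂ) / (A * (A * E + β))) := by
    rw [eq_div_iff h0 |>.mpr h, div_sub_div _ _ h0 hA', ← neg_div, mul_one,
      mul_comm ((A : ℂ) * E + (β : ℂ)) (A : ℂ)]
    ring
  rw [hx, norm_neg, norm_div, norm_mul, Complex.norm_real, Complex.norm_real, Real.norm_eq_abs,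
    Real.norm_eq_abs, abs_of_nonneg hβ, abs_of_pos hA, div_le_div_iff₀ (by positivity) hA, one_mul]
  nlinarith

/-- When `A` is small, the averaging term `β` bounds the diagonal coefficient `x` of the inverse. -/
lemma norm_diag_le {x A E : ℂ} {β β₀ C : ℝ} (h : x * (A * E + β) = E) (hE : ‖E‖ ≤ C)
    (hβ : β₀ ≤ β) (hβ₀ : 0 < β₀) (hA : ‖A‖ * C ≤ β₀ / 2) : ‖x‖ ≤ 2 * C / β₀ := by
  have h1 : β₀ / 2 ≤ ‖A * E + β‖ := by
    have h2 := norm_sub_le (A * E + β) (A * E)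
    rw [add_sub_cancel_left, Complex.norm_real, Real.norm_eq_abs, abs_of_nonneg (by linarith),
      norm_mul] at h2
    have := mul_le_mul_of_nonneg_left hE (norm_nonneg A)
    linarith
  have h2 : ‖x‖ * ‖A * E + β‖ = ‖E‖ := by rw [← norm_mul, h]
  rw [le_div_iff₀ hβ₀]
  nlinarith [norm_nonneg x]

end Fibre

section Green

variable {L r n T S T' S' : ℕ} [NeZero L] [NeZero T] [NeZero S] [NeZero T'] [NeZero S']
  {κ M a : ℝ} {ε : (Fin 3 → ℝ) → ℝ} {H : Fin 3 → Fin 3 → (Fin 3 → ℤ) → ℝ}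

/-- The symbol of `D_n`. -/
def scaledSymbol (ε : (Fin 3 → ℝ) → ℝ) (L n : ℕ) (p : Lat T S) : ℂ :=
  (L : ℂ) ^ (2 * n) * dSymbol ε p

/-- The Fourier coefficients of `(D_n + Q_n^* 𝔔_n Q_n) f`. -/
lemma fibreEquation_greenInv (hT : T = L ^ (2 * n) * T') (hS : S = L ^ n * S')
    (hD : ∀ p : Lat T S, (torusD H T S).mulVec (fun x => p.char x)
      = dSymbol ε p • fun x => p.char x) (f : Lat T S → ℂ) :
    FibreEquation (scaledSymbol ε L n) (blockSymbol L r n)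
      (fun k : Lat T' S' => a / frakSymbol L r n k) (Lat.coarse T' S') (fourierCoeff f)
      (fourierCoeff ((greenInv H a L r n T S T' S').mulVec f)) := by
  intro p
  rw [greenInv, Matrix.add_mulVec, fourierCoeff_add, ← Matrix.mulVec_mulVec,
    ← Matrix.mulVec_mulVec, fourierCoeff_blockAdjoint hT hS,
    fourierCoeff_mulVec_of_eigen (frakQ_mulVec_char a n), fourierCoeff_blockMatrix hT hS,
    scaledD, Matrix.smul_mulVec, fourierCoeff_smul, fourierCoeff_mulVec_of_eigen hD, scaledSymbol]
  ring

lemma scaledSymbol_re_nonneg (hε : DispersionBounds κ M ε) (p : Lat T S) :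
    0 ≤ (scaledSymbol ε L n p).re := by
  have : scaledSymbol ε L n p = (((L : ℝ) ^ (2 * n) : ℝ) : ℂ) * dSymbol ε p := by
    rw [scaledSymbol]; push_cast; rfl
  rw [this, Complex.re_ofReal_mul]
  exact mul_nonneg (by positivity) (hε.propDenom_re_nonneg _ _)

lemma scaledSymbol_ne_zero (hε : DispersionBounds κ M ε) (hκ : 0 < κ) {p : Lat T S}
    (hp : p ≠ 0) : scaledSymbol ε L n p ≠ 0 :=
  mul_ne_zero (pow_ne_zero _ (NeZero.ne _)) (hε.dSymbol_ne_zero hκ hp)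

lemma scaledSymbol_zero (hε : DispersionBounds κ M ε) :
    scaledSymbol ε L n (0 : Lat T S) = 0 := by
  rw [scaledSymbol, hε.dSymbol_eq_of_spatial_zero rfl]; simp

/-- Invertibility is decided fibre by fibre in momentum space: in each fibre the operator is a
diagonal one with non-negative real part, plus a positive one of rank one. The only fibre in which
the diagonal part vanishes somewhere is that of zero momentum, and there the rank one part does not
vanish. -/
lemma isUnit_greenInv (hL : Odd L) (ha : 0 < a) (hT : T = L ^ (2 * n) * T') (hS : S = L ^ n * S')
    (hε : DispersionBounds κ M ε) (hκ : 0 < κ)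
    (hD : ∀ p : Lat T S, (torusD H T S).mulVec (fun x => p.char x)
      = dSymbol ε p • fun x => p.char x) : IsUnit (greenInv H a L r n T S T' S') := by
  rw [← Matrix.mulVec_injective_iff_isUnit]
  refine (injective_iff_map_eq_zero (Matrix.mulVecLin (greenInv H a L r n T S T' S'))).mpr ?_
  intro f hf
  rw [Matrix.mulVecLin_apply] at hf
  have heq := fibreEquation_greenInv (r := r) (a := a) hT hS hD f
  have h0 : fourierCoeff ((greenInv H a L r n T S T' S').mulVec f) = 0 := by
    ext p; rw [hf]; simp [fourierCoeff]
  rw [h0] at heq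
  have hb : ∀ k : Lat T' S', 0 < a / frakSymbol L r n k := fun k =>
    div_pos ha (by linarith [one_le_frakSymbol (L := L) (r := r) n k])
  -- away from the zero momentum, `A ≠ 0`
  have hne : ∀ p : Lat T S, p.coarse T' S' ≠ 0 → fourierCoeff f p = 0 := by
    intro p hp
    have hq : ∀ q : Lat T S, q.coarse T' S' = p.coarse T' S' → q ≠ 0 := by
      rintro q hq rfl
      exact hp (by rw [← hq, Lat.coarse_zero])
    refine heq.eq_zero (fun q hc => scaledSymbol_ne_zero hε hκ (hq q hc)) fun hW => ?_
    have h1 := one_le_re_one_add (hb (p.coarse T' S')).le (z := ∑ q : Lat T S,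
      if q.coarse T' S' = p.coarse T' S' then
        ((‖blockSymbol L r n q‖ ^ 2 : ℝ) : ℂ) / scaledSymbol ε L n q else 0) (by
      rw [Complex.re_sum]
      refine Finset.sum_nonneg fun q _ => ?_
      split_ifs
      · exact div_re_nonneg (by positivity) (scaledSymbol_re_nonneg hε q)
      · simp)
    rw [hW] at h1
    norm_num at h1
  -- on the fibre of the zero momentum the averaging operator forces the average to vanish
  have h1 := heq 0
  rw [scaledSymbol_zero hε, zero_mul, zero_add, blockSymbol_zero hL, star_one, one_mul,
    Lat.coarse_zero, Pi.zero_apply] at h1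
  have h2 := (mul_eq_zero.mp h1).resolve_left (by exact_mod_cast (hb 0).ne')
  have h3 : ∀ p : Lat T S, p.coarse T' S' = 0 → p ≠ 0 → fourierCoeff f p = 0 := by
    intro p hp hp0
    have := heq p
    rw [hp, h1, mul_zero, add_zero, Pi.zero_apply] at this
    exact (mul_eq_zero.mp this).resolve_left (scaledSymbol_ne_zero hε hκ hp0)
  have h4 : fourierCoeff f 0 = 0 := by
    rw [Finset.sum_eq_single (0 : Lat T S)] at h2
    · rw [if_pos Lat.coarse_zero, blockSymbol_zero hL, one_mul] at h2
      exact h2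
    · intro p _ hp
      split_ifs with hc
      · rw [h3 p hc hp, mul_zero]
      · rfl
    · simp
  refine fourierCoeff_injective fun p => ?_
  have : fourierCoeff (0 : Lat T S → ℂ) p = 0 := by simp [fourierCoeff]
  rw [this]
  by_cases hp : p = 0
  · rw [hp, h4]
  · by_cases hc : p.coarse T' S' = 0
    · exact h3 p hc hp
    · exact hne p hc

/-- The diagonal Fourier coefficient of `S_n`. -/
def greenDiag (H : Fin 3 → Fin 3 → (Fin 3 → ℤ) → ℝ) (a : ℝ) (L r n : ℕ) {T S : ℕ} (T' S' : ℕ)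
    [NeZero L] [NeZero T] [NeZero S] [NeZero T'] [NeZero S'] (p : Lat T S) : ℂ :=
  fourierCoeff ((greenInv H a L r n T S T' S')⁻¹.mulVec fun x => p.char x) p

/-- The hypotheses on the lattices and on the kinetic energy. -/
structure GreenSetup (κ M a : ℝ) (ε : (Fin 3 → ℝ) → ℝ) (H : Fin 3 → Fin 3 → (Fin 3 → ℤ) → ℝ)
    (L r n T S T' S' : ℕ) [NeZero T] [NeZero S] : Prop where
  odd : Odd L
  one_lt : 1 < L
  one_le_r : 1 ≤ r
  a_pos : 0 < a
  κ_pos : 0 < κ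
  time : T = L ^ (2 * n) * T'
  space : S = L ^ n * S'
  bounds : DispersionBounds κ M ε
  symbol : ∀ p : Lat T S, (torusD H T S).mulVec (fun x => p.char x)
      = dSymbol ε p • fun x => p.char x

/-- The effective strength of the averaging term at a fine momentum. -/
def avgStrength (a : ℝ) (L r n : ℕ) {T S : ℕ} (T' S' : ℕ) [NeZero L] [NeZero T] [NeZero S]
    [NeZero T'] [NeZero S'] (p : Lat T S) : ℝ :=
  a / frakSymbol L r n (p.coarse T' S') * ‖blockSymbol L r n p‖ ^ 2

/-- The dressing factor `1 + 𝔔(k) ∑ |q|² / A` over the other momenta of the fibre. -/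
def dressing (ε : (Fin 3 → ℝ) → ℝ) (a : ℝ) (L r n : ℕ) {T S : ℕ} (T' S' : ℕ) [NeZero L]
    [NeZero T] [NeZero S] [NeZero T'] [NeZero S'] (p : Lat T S) : ℂ :=
  1 + ((a / frakSymbol L r n (p.coarse T' S') : ℝ) : ℂ) *
    fibreSum (scaledSymbol ε L n) (blockSymbol L r n) (Lat.coarse T' S') p

namespace GreenSetup

variable (hg : GreenSetup κ M a ε H L r n T S T' S')
include hg

lemma fibreEquation (p : Lat T S) :
    FibreEquation (scaledSymbol ε L n) (blockSymbol L r n)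
      (fun k : Lat T' S' => a / frakSymbol L r n k) (Lat.coarse T' S')
      (fourierCoeff ((greenInv H a L r n T S T' S')⁻¹.mulVec fun x => p.char x))
      (Pi.single p 1) := by
  have h := fibreEquation_greenInv (r := r) (a := a) hg.time hg.space hg.symbol
    ((greenInv H a L r n T S T' S')⁻¹.mulVec fun x => p.char x)
  have hu := (Matrix.isUnit_iff_isUnit_det _).mp
    (isUnit_greenInv (r := r) hg.odd hg.a_pos hg.time hg.space hg.bounds hg.κ_pos hg.symbol)
  rw [Matrix.mulVec_mulVec, Matrix.mul_nonsing_inv _ hu, Matrix.one_mulVec] at h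
  convert h using 1
  ext q
  rw [fourierCoeff_char, Pi.single_apply]
  simp only [eq_comm]

lemma strength_nonneg (k : Lat T' S') : 0 ≤ a / frakSymbol L r n k :=
  div_nonneg hg.a_pos.le (by linarith [one_le_frakSymbol (L := L) (r := r) n k])

lemma strength_le (k : Lat T' S') : a / frakSymbol L r n k ≤ a :=
  div_le_self hg.a_pos.le (one_le_frakSymbol (L := L) (r := r) n k)

lemma le_strength (k : Lat T' S') : a / 2 ≤ a / frakSymbol L r n k :=
  div_le_div_of_nonneg_left hg.a_pos.le (by linarith [one_le_frakSymbol (L := L) (r := r) n k])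
    (frakSymbol_le_two hg.odd hg.one_lt hg.one_le_r n k)

lemma avgStrength_nonneg (p : Lat T S) : 0 ≤ avgStrength a L r n T' S' p :=
  mul_nonneg (hg.strength_nonneg _) (by positivity)

lemma avgStrength_le (p : Lat T S) : avgStrength a L r n T' S' p ≤ a := by
  have h1 := hg.strength_le (p.coarse T' S')
  have h2 : ‖blockSymbol L r n p‖ ^ 2 ≤ 1 :=
    pow_le_one₀ (norm_nonneg _) (norm_blockSymbol_le hg.odd p)
  exact (mul_le_of_le_one_right (hg.strength_nonneg _) h2).trans h1

lemma one_le_dressing_re (p : Lat T S) : 1 ≤ (dressing ε a L r n T' S' p).re :=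
  one_le_re_one_add (hg.strength_nonneg _)
    (fibreSum_re_nonneg (fun q => scaledSymbol_re_nonneg hg.bounds q) p)

/-- The resolvent formula for rank one perturbations, with the denominators cleared so that it also
holds where the symbol of `D_n` vanishes. -/
lemma greenDiag_mul (p : Lat T S)
    (hA : ∀ q : Lat T S, q ≠ p → q.coarse T' S' = p.coarse T' S' → scaledSymbol ε L n q ≠ 0) :
    greenDiag H a L r n T' S' p *
      (scaledSymbol ε L n p * dressing ε a L r n T' S' p + (avgStrength a L r n T' S' p : ℂ))
      = dressing ε a L r n T' S' p := by
  have := (hg.fibreEquation p).diag hA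
  rw [greenDiag, dressing, avgStrength]
  push_cast at this ⊢
  exact this

lemma greenDiag_of_coarse_eq_zero {p : Lat T S} (hp : p ≠ 0) (hc : p.coarse T' S' = 0) :
    greenDiag H a L r n T' S' p = 1 / scaledSymbol ε L n p := by
  have := (hg.fibreEquation p).of_zero hp (by rw [hc, Lat.coarse_zero])
    (scaledSymbol_zero hg.bounds) (blockSymbol_zero hg.odd)
  rw [greenDiag, eq_div_iff (scaledSymbol_ne_zero hg.bounds hg.κ_pos hp), mul_comm, this]

lemma scaledSymbol_ne_zero_of_fibre {p : Lat T S} (hc : p.coarse T' S' ≠ 0) (q : Lat T S)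
    (hq : q.coarse T' S' = p.coarse T' S') : scaledSymbol ε L n q ≠ 0 := by
  refine scaledSymbol_ne_zero hg.bounds hg.κ_pos ?_
  rintro rfl
  exact hc (by rw [← hq, Lat.coarse_zero])

/-- Away from zero momentum, the averaging term changes the propagator only at second order. -/
lemma norm_greenDiag_sub_inv_le {p : Lat T S} (hp : p ≠ 0) :
    ‖greenDiag H a L r n T' S' p - 1 / scaledSymbol ε L n p‖
      ≤ a / ‖scaledSymbol ε L n p‖ ^ 2 := by
  have ha := hg.a_pos
  by_cases hc : p.coarse T' S' = 0
  · rw [hg.greenDiag_of_coarse_eq_zero hp hc, sub_self, norm_zero]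
    positivity
  · refine (norm_diag_sub_inv_le (hg.greenDiag_mul p fun q _ =>
      hg.scaledSymbol_ne_zero_of_fibre hc q) (scaledSymbol_ne_zero hg.bounds hg.κ_pos hp)
      (scaledSymbol_re_nonneg hg.bounds p) (hg.one_le_dressing_re p)
      (hg.avgStrength_nonneg p)).trans ?_
    exact div_le_div_of_nonneg_right (hg.avgStrength_le p) (by positivity)

/-- For vanishing temporal momentum `A` is real. -/
lemma norm_greenDiag_sub_inv_le_of_temporal_zero {p : Lat T S} (hp : p ≠ 0) (hp1 : p.1 = 0) :
    ‖greenDiag H a L r n T' S' p - 1 / scaledSymbol ε L n p‖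
      ≤ 1 / ‖scaledSymbol ε L n p‖ := by
  by_cases hc : p.coarse T' S' = 0
  · rw [hg.greenDiag_of_coarse_eq_zero hp hc, sub_self, norm_zero]
    positivity
  · set A : ℝ := (L : ℝ) ^ (2 * n) * (1 - Real.exp (-ε (momentum p.2))) with hA
    have hA' : scaledSymbol ε L n p = (A : ℂ) := by
      rw [scaledSymbol, dSymbol, hp1, AddChar.map_zero_eq_one, hA]; push_cast; ring
    have hA0 : 0 < A := by
      have h1 : 0 ≤ A := mul_nonneg (by positivity)
        (by linarith [exp_neg_le_one (hg.bounds.nonneg (momentum p.2))])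
      refine lt_of_le_of_ne h1 fun h0 => ?_
      have := scaledSymbol_ne_zero (L := L) (n := n) hg.bounds hg.κ_pos hp
      rw [hA', ← h0] at this
      exact this (by simp)
    have h2 := hg.greenDiag_mul p fun q _ => hg.scaledSymbol_ne_zero_of_fibre hc q
    rw [hA'] at h2 ⊢
    rw [Complex.norm_real, Real.norm_eq_abs, abs_of_pos hA0]
    exact norm_diag_sub_inv_le_of_pos h2 hA0 (hg.one_le_dressing_re p) (hg.avgStrength_nonneg p)

end GreenSetup

end Green

/-! ### Spatially constant modes of the Green's function -/

/-- Two different momenta that reduce to the same momentum of the blocked lattice are at least one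
reciprocal lattice spacing apart. -/
lemma inv_le_freq_add_freq {K N K' : ℕ} [NeZero K] [NeZero K'] (hK : K = N * K') {x y : ZMod K}
    (h : ((x.val : ℕ) : ZMod K') = ((y.val : ℕ) : ZMod K')) (hxy : x ≠ y) :
    1 / (N : ℝ) ≤ freq x + freq y := by
  have hK0 : (0 : ℝ) < K := by exact_mod_cast NeZero.pos K
  have hK'0 : (0 : ℝ) < K' := by exact_mod_cast NeZero.pos K'
  have hN0 : (0 : ℝ) < N := by
    refine lt_of_le_of_ne (Nat.cast_nonneg N) fun h0 => ?_
    have : N = 0 := by exact_mod_cast h0.symm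
    exact NeZero.ne K (by rw [hK, this, zero_mul])
  have hcast : ∀ x : ZMod K, ((x.valMinAbs : ℤ) : ZMod K') = ((x.val : ℕ) : ZMod K') := by
    intro x
    have h1 : ((x.valMinAbs : ℤ) : ZMod K) = ((x.val : ℤ) : ZMod K) := by simp
    rw [ZMod.intCast_eq_intCast_iff_dvd_sub] at h1
    have h2 : ((x.valMinAbs : ℤ) : ZMod K') = ((x.val : ℤ) : ZMod K') := by
      rw [ZMod.intCast_eq_intCast_iff_dvd_sub]
      exact (Int.natCast_dvd_natCast.mpr (by rw [hK]; exact dvd_mul_left _ _)).trans h1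
    rw [h2]; simp
  have h1 : ((x.valMinAbs : ℤ) : ZMod K') = ((y.valMinAbs : ℤ) : ZMod K') := by
    rw [hcast, hcast, h]
  rw [ZMod.intCast_eq_intCast_iff_dvd_sub] at h1
  have h2 : y.valMinAbs - x.valMinAbs ≠ 0 := by
    intro h0
    exact hxy ((ZMod.valMinAbs_inj).mp (by omega))
  have h3 := Int.le_of_dvd (abs_pos.mpr h2) ((dvd_abs _ _).mpr h1)
  have h4 : (K' : ℝ) ≤ (x.valMinAbs.natAbs : ℝ) + y.valMinAbs.natAbs := by
    have : (K' : ℤ) ≤ x.valMinAbs.natAbs + y.valMinAbs.natAbs := by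
      have := abs_sub y.valMinAbs x.valMinAbs
      rw [Int.natCast_natAbs, Int.natCast_natAbs]
      linarith
    exact_mod_cast this
  have h5 : (1 : ℝ) / N = K' / K := by
    rw [hK]; push_cast; field_simp
  rw [h5, freq, freq, ← add_div]
  exact div_le_div_of_nonneg_right h4 hK0.le

/-- The bound on the dressing factor near zero momentum. -/
def dressingConst (κ M a : ℝ) : ℝ := 1 + 2 * a / gapConst κ M

/-- The size of `A` up to which a spatially constant mode counts as a zero mode. -/
def zeroModeRadius (κ M a : ℝ) (r : ℕ) : ℝ := min (1 / (2 * r)) (a / (16 * dressingConst κ M a))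

/-- The bound on the spatially constant modes of the Green's function. -/
def zeroModeConst (κ M a : ℝ) (r : ℕ) : ℝ :=
  16 * dressingConst κ M a / a
    + (1 + a / zeroModeRadius κ M a r) / zeroModeRadius κ M a r

section

variable {L r n T S T' S' : ℕ} [NeZero L] [NeZero T] [NeZero S] [NeZero T'] [NeZero S']
  {κ M a : ℝ} {ε : (Fin 3 → ℝ) → ℝ} {H : Fin 3 → Fin 3 → (Fin 3 → ℤ) → ℝ}

namespace GreenSetup

variable (hg : GreenSetup κ M a ε H L r n T S T' S')
include hg

lemma L_pos : (0 : ℝ) < L := by exact_mod_cast hg.odd.pos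

lemma norm_scaledSymbol (p : Lat T S) :
    ‖scaledSymbol ε L n p‖ = (L : ℝ) ^ (2 * n) * ‖dSymbol ε p‖ := by
  rw [scaledSymbol, norm_mul, norm_pow, Complex.norm_natCast]

lemma gap_le_norm_dSymbol (p : Lat T S) :
    gapConst κ M * (‖momentum p.2‖ ^ 2 + freq p.1) ≤ ‖dSymbol ε p‖ :=
  hg.bounds.gap p.1 (norm_momentum_le' p.2)

/-- The other momenta in the fibre of a spatially constant mode of small temporal frequency
are of high energy. -/
lemma half_gap_le_norm_scaledSymbol {p q : Lat T S} (hp : p.2 = 0)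
    (hf : freq p.1 ≤ 1 / (2 * (L : ℝ) ^ (2 * n))) (hq : q ≠ p)
    (hc : q.coarse T' S' = p.coarse T' S') : gapConst κ M / 2 ≤ ‖scaledSymbol ε L n q‖ := by
  have hL := hg.L_pos
  have hc0 := hg.bounds.gapConst_pos hg.κ_pos
  have hLn : (0 : ℝ) < (L : ℝ) ^ (2 * n) := by positivity
  have key : 1 / (2 * (L : ℝ) ^ (2 * n)) ≤ ‖momentum q.2‖ ^ 2 + freq q.1 := by
    by_cases hq2 : q.2 = 0
    -- both frequencies reduce to the same one on the blocked lattice, hence cannot both be small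
    · have hq1 : q.1 ≠ p.1 := fun h => hq (Prod.ext h (by rw [hq2, hp]))
      have h1 := inv_le_freq_add_freq hg.time (congrArg Prod.fst hc) hq1
      push_cast at h1
      have h2 : 1 / (L : ℝ) ^ (2 * n) = 2 * (1 / (2 * (L : ℝ) ^ (2 * n))) := by field_simp
      nlinarith [sq_nonneg ‖momentum q.2‖]
    · obtain ⟨i, hi⟩ : ∃ i, q.2 i ≠ 0 := by
        by_contra! h; exact hq2 (funext h)
      -- a non-zero spatial component that reduces to zero is at least `2π / L ^ n`
      have h1 : (((q.2 i).val : ℕ) : ZMod S') = (((0 : ZMod S).val : ℕ) : ZMod S') := by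
        have := congrFun (congrArg Prod.snd hc) i
        simp only [Lat.coarse, hp, Pi.zero_apply] at this
        exact this
      have h2 := inv_le_freq_add_freq hg.space h1 hi
      rw [freq_eq_zero.mpr rfl, add_zero] at h2
      push_cast at h2
      have h3 := freq_le_norm_momentum q.2 i
      have h4 : 1 / (L : ℝ) ^ n ≤ ‖momentum q.2‖ := by
        nlinarith [Real.pi_gt_three, freq_nonneg (q.2 i)]
      have h5 : (1 / (L : ℝ) ^ n) ^ 2 ≤ ‖momentum q.2‖ ^ 2 :=
        pow_le_pow_left₀ (by positivity) h4 2
      have h6 : (1 / (L : ℝ) ^ n) ^ 2 = 1 / (L : ℝ) ^ (2 * n) := by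
        rw [div_pow, one_pow, ← pow_mul, mul_comm n 2]
      have h7 : 1 / (2 * (L : ℝ) ^ (2 * n)) ≤ 1 / (L : ℝ) ^ (2 * n) :=
        one_div_le_one_div_of_le hLn (by linarith)
      linarith [freq_nonneg q.1]
  rw [hg.norm_scaledSymbol]
  have h1 := hg.gap_le_norm_dSymbol q
  have h2 := mul_le_mul_of_nonneg_left key hc0.le
  calc gapConst κ M / 2 = (L : ℝ) ^ (2 * n) * (gapConst κ M * (1 / (2 * (L : ℝ) ^ (2 * n)))) := by
        field_simp
    _ ≤ _ := mul_le_mul_of_nonneg_left (h2.trans h1) hLn.le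

/-- The other momenta in the fibre have energies bounded below, and the averaging symbols are square
summable over the fibre. -/
lemma norm_dressing_le {p : Lat T S} (hp : p.2 = 0)
    (hf : freq p.1 ≤ 1 / (2 * (L : ℝ) ^ (2 * n))) :
    ‖dressing ε a L r n T' S' p‖ ≤ dressingConst κ M a := by
  have hc0 := hg.bounds.gapConst_pos hg.κ_pos
  have h1 : ‖fibreSum (scaledSymbol ε L n) (blockSymbol L r n) (Lat.coarse T' S') p‖
      ≤ 2 / gapConst κ M := by
    refine (norm_sum_le _ _).trans ?_
    have h2 : ∀ q : Lat T S, ‖(if q ≠ p ∧ q.coarse T' S' = p.coarse T' S' then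
        ((‖blockSymbol L r n q‖ ^ 2 : ℝ) : ℂ) / scaledSymbol ε L n q else 0)‖
        ≤ 2 / gapConst κ M *
          (if q.coarse T' S' = p.coarse T' S' then ‖blockSymbol L r n q‖ ^ 2 else 0) := by
      intro q
      by_cases hq : q ≠ p ∧ q.coarse T' S' = p.coarse T' S'
      · rw [if_pos hq, if_pos hq.2, norm_div, Complex.norm_real, Real.norm_eq_abs,
          abs_of_nonneg (by positivity)]
        have h3 := hg.half_gap_le_norm_scaledSymbol hp hf hq.1 hq.2
        rw [div_mul_eq_mul_div, div_le_div_iff₀ (by linarith) hc0]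
        nlinarith [sq_nonneg ‖blockSymbol L r n q‖]
      · rw [if_neg hq, norm_zero]
        refine mul_nonneg (by positivity) ?_
        split_ifs <;> positivity
    refine (Finset.sum_le_sum fun q _ => h2 q).trans ?_
    rw [← Finset.mul_sum]
    exact mul_le_of_le_one_right (by positivity)
      (fibreWeight_le_one hg.odd hg.one_le_r hg.time hg.space (p.coarse T' S'))
  rw [dressing, dressingConst]
  refine (norm_add_le _ _).trans ?_
  rw [norm_one, norm_mul, Complex.norm_real, Real.norm_eq_abs, abs_of_nonneg (hg.strength_nonneg _)]
  have := mul_le_mul (hg.strength_le (p.coarse T' S')) h1 (norm_nonneg _) hg.a_pos.le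
  have h3 : a * (2 / gapConst κ M) = 2 * a / gapConst κ M := by ring
  linarith

lemma dressingConst_pos : 0 < dressingConst κ M a := by
  have hc0 := hg.bounds.gapConst_pos hg.κ_pos
  have := hg.a_pos
  unfold dressingConst; positivity

lemma zeroModeRadius_pos : 0 < zeroModeRadius κ M a r := by
  have h1 := hg.dressingConst_pos
  have h2 := hg.a_pos
  have h3 : (0 : ℝ) < r := by exact_mod_cast hg.one_le_r
  exact lt_min (by positivity) (by positivity)

lemma zeroModeRadius_le_one : zeroModeRadius κ M a r ≤ 1 := by
  have h3 : (1 : ℝ) ≤ r := by exact_mod_cast hg.one_le_r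
  refine (min_le_left _ _).trans ?_
  rw [div_le_one (by positivity)]
  linarith

lemma zeroModeConst_pos : 0 < zeroModeConst κ M a r := by
  have h1 := hg.dressingConst_pos
  have h2 := hg.a_pos
  have h3 := hg.zeroModeRadius_pos
  unfold zeroModeConst; positivity

/-- Modes with small `A`: the averaging term provides a mass. -/
lemma norm_greenDiag_le_of_small {p : Lat T S} (hp : p.2 = 0)
    (hA : ‖scaledSymbol ε L n p‖ ≤ zeroModeRadius κ M a r) :
    ‖greenDiag H a L r n T' S' p‖ ≤ 16 * dressingConst κ M a / a := by
  have hL := hg.L_pos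
  have hLn : (0 : ℝ) < (L : ℝ) ^ (2 * n) := by positivity
  have ha := hg.a_pos
  have hC := hg.dressingConst_pos
  have hr : (0 : ℝ) < r := by exact_mod_cast hg.one_le_r
  have hnorm : ‖scaledSymbol ε L n p‖
      = (L : ℝ) ^ (2 * n) * ‖(ZMod.stdAddChar p.1 : ℂ) - 1‖ := by
    rw [hg.norm_scaledSymbol, hg.bounds.dSymbol_eq_of_spatial_zero hp, norm_sub_rev]
  have hf : freq p.1 ≤ 1 / (2 * (L : ℝ) ^ (2 * n)) := by
    have h1 := freq_le_norm_stdAddChar_sub_one p.1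
    have h2 := mul_le_mul_of_nonneg_left h1 hLn.le
    rw [← hnorm] at h2
    have h3 := hg.zeroModeRadius_le_one
    rw [le_div_iff₀ (by positivity)]
    linarith
  have hq : 1 / 2 ≤ ‖blockSymbol L r n p‖ := by
    have h1 := norm_avgSymbol_sub_one_le hg.odd hg.one_lt r n (norm_stdAddChar p.1)
    have h2 : blockSymbol L r n p = avgSymbol L r n (ZMod.stdAddChar p.1) 1 := by
      rw [blockSymbol, hp]
      congr 1
      ext i
      simp
    rw [← h2, mul_assoc, ← hnorm] at h1
    have h3 := hA.trans (min_le_left _ _)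
    rw [le_div_iff₀ (by positivity)] at h3
    have h4 := norm_sub_norm_le (1 : ℂ) (1 - blockSymbol L r n p)
    rw [sub_sub_cancel, norm_one, norm_sub_rev] at h4
    nlinarith
  have hβ : a / 8 ≤ avgStrength a L r n T' S' p := by
    rw [avgStrength]
    have h1 := hg.le_strength (p.coarse T' S')
    have h2 : (1 / 2 : ℝ) ^ 2 ≤ ‖blockSymbol L r n p‖ ^ 2 := pow_le_pow_left₀ (by norm_num) hq 2
    nlinarith
  have hmul := hg.greenDiag_mul p fun q hq hc h0 => by
    have h1 := hg.half_gap_le_norm_scaledSymbol hp hf hq hc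
    rw [h0, norm_zero] at h1
    linarith [hg.bounds.gapConst_pos hg.κ_pos]
  have := norm_diag_le hmul (hg.norm_dressing_le hp hf) hβ (by positivity) (by
    have h3 := hA.trans (min_le_right _ _)
    rw [le_div_iff₀ (by positivity)] at h3
    linarith)
  refine this.trans (le_of_eq ?_)
  field_simp
  ring

lemma norm_greenDiag_le_of_large {p : Lat T S}
    (hA : zeroModeRadius κ M a r < ‖scaledSymbol ε L n p‖) :
    ‖greenDiag H a L r n T' S' p‖
      ≤ (1 + a / zeroModeRadius κ M a r) / ‖scaledSymbol ε L n p‖ := by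
  have hR := hg.zeroModeRadius_pos
  have ha := hg.a_pos
  have hA0 : 0 < ‖scaledSymbol ε L n p‖ := hR.trans hA
  have hp : p ≠ 0 := by
    rintro rfl
    rw [scaledSymbol_zero hg.bounds, norm_zero] at hA0
    exact lt_irrefl _ hA0
  have h1 := hg.norm_greenDiag_sub_inv_le hp
  have h2 := norm_sub_norm_le (greenDiag H a L r n T' S' p) (1 / scaledSymbol ε L n p)
  rw [norm_div, norm_one] at h2
  have h3 : a / ‖scaledSymbol ε L n p‖ ^ 2
      ≤ (a / zeroModeRadius κ M a r) / ‖scaledSymbol ε L n p‖ := by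
    rw [sq, ← div_div]
    exact div_le_div_of_nonneg_right (div_le_div_of_nonneg_left ha.le hR hA.le) hA0.le
  rw [add_div]
  linarith

/-- Spatially constant modes are bounded by `min 1 (1 / |A|)` up to a constant. -/
lemma norm_greenDiag_le_of_spatial_zero {p : Lat T S} (hp : p.2 = 0) :
    ‖greenDiag H a L r n T' S' p‖ ≤ zeroModeConst κ M a r ∧
      ‖greenDiag H a L r n T' S' p‖ * ‖scaledSymbol ε L n p‖ ≤ zeroModeConst κ M a r := by
  have hR := hg.zeroModeRadius_pos
  have hR1 := hg.zeroModeRadius_le_one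
  have ha := hg.a_pos
  have hC := hg.dressingConst_pos
  have h16 : 0 < 16 * dressingConst κ M a / a := by positivity
  have hB : 0 < 1 + a / zeroModeRadius κ M a r := by positivity
  have hB2 : 1 + a / zeroModeRadius κ M a r
      ≤ (1 + a / zeroModeRadius κ M a r) / zeroModeRadius κ M a r := by
    rw [le_div_iff₀ hR]; exact mul_le_of_le_one_right hB.le hR1
  by_cases hA : ‖scaledSymbol ε L n p‖ ≤ zeroModeRadius κ M a r
  · have h1 := hg.norm_greenDiag_le_of_small hp hA
    unfold zeroModeConst
    have h2 := mul_le_of_le_one_right (norm_nonneg (greenDiag H a L r n T' S' p)) (hA.trans hR1)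
    constructor <;> linarith
  · push Not at hA
    have h1 := hg.norm_greenDiag_le_of_large hA
    have hA0 : 0 < ‖scaledSymbol ε L n p‖ := hR.trans hA
    have h2 := (le_div_iff₀ hA0).mp h1
    have h3 : (1 + a / zeroModeRadius κ M a r) / ‖scaledSymbol ε L n p‖
        ≤ (1 + a / zeroModeRadius κ M a r) / zeroModeRadius κ M a r :=
      div_le_div_of_nonneg_left hB.le hR hA.le
    unfold zeroModeConst
    constructor <;> linarith

end GreenSetup
end

/-! ### Sums over the dual torus -/

/-- A non-zero distance from the origin occurs at most twice on a discrete circle. -/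
lemma sum_erase_zero_le {N : ℕ} [NeZero N] {g : ℕ → ℝ} (hg : ∀ j, 0 ≤ g j) :
    ∑ l ∈ Finset.univ.erase (0 : ZMod N), g l.valMinAbs.natAbs
      ≤ 2 * ∑ j ∈ Finset.range N, g (j + 1) := by
  have hhalf : ∀ s : Finset (ZMod N), (∀ l ∈ s, l ≠ 0) →
      (∀ l ∈ s, ∀ m ∈ s, l.valMinAbs.natAbs = m.valMinAbs.natAbs → l = m) →
      ∑ l ∈ s, g l.valMinAbs.natAbs ≤ ∑ j ∈ Finset.range N, g (j + 1) := by
    intro s h0 hinj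
    have h1 : ∑ l ∈ s, g l.valMinAbs.natAbs
        = ∑ j ∈ s.image (fun l => l.valMinAbs.natAbs - 1), g (j + 1) := by
      have hpos : ∀ l ∈ s, 1 ≤ l.valMinAbs.natAbs := fun l hl => by
        have h := (ZMod.valMinAbs_eq_zero l).not.mpr (h0 l hl)
        omega
      rw [Finset.sum_image]
      · refine Finset.sum_congr rfl fun l hl => ?_
        rw [Nat.sub_add_cancel (hpos l hl)]
      · intro l hl m hm h
        refine hinj l hl m hm ?_
        have := hpos l hl
        have := hpos m hm
        simp only at h
        omega
    rw [h1]
    refine Finset.sum_le_sum_of_subset_of_nonneg ?_ fun _ _ _ => hg _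
    intro j hj
    rw [Finset.mem_image] at hj
    obtain ⟨l, _, rfl⟩ := hj
    have := l.natAbs_valMinAbs_le
    have := NeZero.pos N
    rw [Finset.mem_range]; omega
  rw [← Finset.sum_filter_add_sum_filter_not _ fun l : ZMod N => 0 ≤ l.valMinAbs, two_mul]
  refine add_le_add (hhalf _ ?_ ?_) (hhalf _ ?_ ?_)
  · intro l hl; simp only [Finset.mem_filter, Finset.mem_erase] at hl; exact hl.1.1
  · intro l hl m hm h
    simp only [Finset.mem_filter] at hl hm
    exact ZMod.valMinAbs_inj.mp (by omega)
  · intro l hl; simp only [Finset.mem_filter, Finset.mem_erase] at hl; exact hl.1.1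
  · intro l hl m hm h
    simp only [Finset.mem_filter] at hl hm
    exact ZMod.valMinAbs_inj.mp (by omega)

/-- The frequency sum, which gains one power of the energy `x`. -/
lemma sum_inv_sq_freq_le {T : ℕ} [NeZero T] {x : ℝ} (hx : 0 < x) :
    (1 / (T : ℝ)) * ∑ l ∈ Finset.univ.erase (0 : ZMod T), 1 / (x + freq l) ^ 2 ≤ 2 / x := by
  have hT : (0 : ℝ) < T := by exact_mod_cast NeZero.pos T
  have h1 := sum_erase_zero_le (N := T) (g := fun j => 1 / (x + (j : ℝ) / T) ^ 2)
    fun j => by positivity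
  -- each term is dominated by a telescoping difference
  have h2 : ∀ N : ℕ, ∑ j ∈ Finset.range N, 1 / (x + ((j + 1 : ℕ) : ℝ) / T) ^ 2
      ≤ T * (1 / x - 1 / (x + (N : ℝ) / T)) := by
    intro N
    induction N with
    | zero => simp
    | succ N ih =>
      rw [Finset.sum_range_succ]
      have hN : 0 < x + (N : ℝ) / T := by positivity
      have hN1 : x + ((N + 1 : ℕ) : ℝ) / T = x + (N : ℝ) / T + 1 / T := by push_cast; ring
      have h3 : 1 / (x + ((N + 1 : ℕ) : ℝ) / T) ^ 2
          ≤ T * (1 / (x + (N : ℝ) / T) - 1 / (x + ((N + 1 : ℕ) : ℝ) / T)) := by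
        rw [hN1]
        set y := x + (N : ℝ) / T
        have h4 : T * (1 / y - 1 / (y + 1 / T)) = 1 / (y * (y + 1 / T)) := by
          field_simp; ring
        rw [h4]
        have h5 : 0 < 1 / (T : ℝ) := by positivity
        exact one_div_le_one_div_of_le (by positivity) (by nlinarith)
      linarith
  have h3 : (T : ℝ) * (1 / x - 1 / (x + (T : ℝ) / T)) ≤ T * (1 / x) := by
    have : 0 < 1 / (x + (T : ℝ) / T) := by positivity
    nlinarith
  have h4 : ∑ l ∈ Finset.univ.erase (0 : ZMod T), 1 / (x + freq l) ^ 2 ≤ 2 * (T * (1 / x)) :=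
    h1.trans (by linarith [h2 T])
  calc _ ≤ (1 / (T : ℝ)) * (2 * (T * (1 / x))) := mul_le_mul_of_nonneg_left h4 (by positivity)
    _ = 2 / x := by field_simp

lemma sum_inv_sqrt_le (N : ℕ) : ∑ j ∈ Finset.range N, 1 / √((j + 1 : ℕ) : ℝ) ≤ 2 * √N := by
  induction N with
  | zero => simp
  | succ N ih =>
    rw [Finset.sum_range_succ]
    have h1 : 0 < √((N + 1 : ℕ) : ℝ) := Real.sqrt_pos.mpr (by positivity)
    have h2 : √((N + 1 : ℕ) : ℝ) ^ 2 = N + 1 := by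
      rw [Real.sq_sqrt (by positivity)]; push_cast; ring
    have h3 : √(N : ℝ) ^ 2 = N := Real.sq_sqrt (by positivity)
    have h4 : 1 / √((N + 1 : ℕ) : ℝ) ≤ 2 * (√((N + 1 : ℕ) : ℝ) - √N) := by
      rw [div_le_iff₀ h1]
      nlinarith [sq_nonneg (√((N + 1 : ℕ) : ℝ) - √N)]
    linarith

lemma sum_inv_sqrt_freq_le {T : ℕ} [NeZero T] :
    (1 / (T : ℝ)) * ∑ l ∈ Finset.univ.erase (0 : ZMod T), 1 / √(freq l) ≤ 4 := by
  have hT : (0 : ℝ) < T := by exact_mod_cast NeZero.pos T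
  have h1 := sum_erase_zero_le (N := T) (g := fun j => 1 / √((j : ℝ) / T)) fun j => by positivity
  have h2 : ∀ j : ℕ, 1 / √(((j + 1 : ℕ) : ℝ) / T) = √T * (1 / √((j + 1 : ℕ) : ℝ)) := by
    intro j
    rw [Real.sqrt_div (by positivity)]
    field_simp
  simp only [h2, ← Finset.mul_sum] at h1
  have h3 := mul_le_mul_of_nonneg_left (sum_inv_sqrt_le T) (Real.sqrt_nonneg (T : ℝ))
  have h4 : √(T : ℝ) * √T = T := Real.mul_self_sqrt hT.le
  have h5 : ∑ l ∈ Finset.univ.erase (0 : ZMod T), 1 / √(freq l) ≤ 4 * T := by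
    refine h1.trans ?_
    nlinarith
  rw [one_div, inv_mul_le_iff₀ hT]
  linarith

lemma sum_inv_two_thirds_le (N : ℕ) :
    ∑ j ∈ Finset.range N, (((j + 1 : ℕ) : ℝ) ^ (-(2 / 3) : ℝ)) ≤ 3 * (N : ℝ) ^ (1 / 3 : ℝ) := by
  induction N with
  | zero => simp
  | succ N ih =>
    rw [Finset.sum_range_succ]
    -- with the cube roots `b` and `c`, the new term is `1 / b²`, at most the increment `3 (b - c)`
    set b : ℝ := ((N + 1 : ℕ) : ℝ) ^ (1 / 3 : ℝ) with hb
    set c : ℝ := (N : ℝ) ^ (1 / 3 : ℝ) with hc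
    have hb0 : 0 < b := Real.rpow_pos_of_pos (by positivity) _
    have hc0 : 0 ≤ c := Real.rpow_nonneg (by positivity) _
    have hb3 : b ^ 3 = N + 1 := by
      rw [hb, ← Real.rpow_natCast, ← Real.rpow_mul (by positivity)]; norm_num
    have hc3 : c ^ 3 = N := by
      rw [hc, ← Real.rpow_natCast, ← Real.rpow_mul (by positivity)]; norm_num
    have hcb : c ≤ b := Real.rpow_le_rpow (by positivity) (by push_cast; linarith) (by norm_num)
    have h1 : ((N + 1 : ℕ) : ℝ) ^ (-(2 / 3) : ℝ) = 1 / b ^ 2 := by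
      rw [hb, ← Real.rpow_natCast, ← Real.rpow_mul (by positivity), Real.rpow_neg (by positivity),
        one_div]
      norm_num
    rw [h1]
    have h2 : 1 / b ^ 2 ≤ 3 * (b - c) := by
      rw [div_le_iff₀ (by positivity)]
      have h3 : (b - c) * (b ^ 2 + b * c + c ^ 2) = 1 := by nlinarith
      have h4 : b ^ 2 + b * c + c ^ 2 ≤ 3 * b ^ 2 := by nlinarith
      nlinarith [sub_nonneg.mpr hcb]
    linarith

/-- The factor for one direction in the bound of `1 / ‖k‖²` by a product over the three directions.
-/
lemma sum_max_freq_le {S : ℕ} [NeZero S] :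
    ∑ l : ZMod S, (max (freq l) (1 / S)) ^ (-(2 / 3) : ℝ) ≤ 7 * S := by
  have hS : (0 : ℝ) < S := by exact_mod_cast NeZero.pos S
  have hS1 : (1 : ℝ) ≤ S := by exact_mod_cast NeZero.one_le
  rw [← Finset.add_sum_erase _ _ (Finset.mem_univ (0 : ZMod S))]
  have hpow : (1 / (S : ℝ)) ^ (-(2 / 3) : ℝ) = (S : ℝ) ^ (2 / 3 : ℝ) := by
    rw [one_div, Real.inv_rpow hS.le, Real.rpow_neg hS.le, inv_inv]
  have hpow1 : (S : ℝ) ^ (2 / 3 : ℝ) ≤ S := by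
    conv_rhs => rw [← Real.rpow_one (S : ℝ)]
    exact Real.rpow_le_rpow_of_exponent_le hS1 (by norm_num)
  have h0 : (max (freq (0 : ZMod S)) (1 / S)) ^ (-(2 / 3) : ℝ) ≤ S := by
    rw [freq_eq_zero.mpr rfl, max_eq_right (by positivity), hpow]
    exact hpow1
  have h1 := sum_erase_zero_le (N := S) (g := fun j => (max ((j : ℝ) / S) (1 / S)) ^ (-(2 / 3) : ℝ))
    fun j => by positivity
  have h2 : ∀ j : ℕ, (max (((j + 1 : ℕ) : ℝ) / S) (1 / S)) ^ (-(2 / 3) : ℝ)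
      = (S : ℝ) ^ (2 / 3 : ℝ) * ((j + 1 : ℕ) : ℝ) ^ (-(2 / 3) : ℝ) := by
    intro j
    rw [max_eq_left (div_le_div_of_nonneg_right (by push_cast; linarith
      [(Nat.cast_nonneg j : (0 : ℝ) ≤ j)]) hS.le), div_eq_mul_one_div,
      Real.mul_rpow (by positivity) (by positivity), hpow, mul_comm]
  simp only [h2, ← Finset.mul_sum] at h1
  have h3 := mul_le_mul_of_nonneg_left (sum_inv_two_thirds_le S)
    (Real.rpow_nonneg hS.le (2 / 3 : ℝ))
  have h4 : (S : ℝ) ^ (2 / 3 : ℝ) * (3 * (S : ℝ) ^ (1 / 3 : ℝ)) = 3 * S := by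
    rw [mul_left_comm, ← Real.rpow_add hS]; norm_num
  have h5 : ∑ l ∈ Finset.univ.erase (0 : ZMod S), (max (freq l) (1 / S)) ^ (-(2 / 3) : ℝ)
      ≤ 2 * (3 * S) := h1.trans (by linarith)
  linarith

lemma inv_le_norm_momentum {S : ℕ} [NeZero S] {q : Fin 3 → ZMod S} (hq : q ≠ 0) :
    2 * Real.pi / S ≤ ‖momentum q‖ := by
  have hS : (0 : ℝ) < S := by exact_mod_cast NeZero.pos S
  obtain ⟨i, hi⟩ : ∃ i, q i ≠ 0 := by
    by_contra! h; exact hq (funext h)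
  have h1 := freq_le_norm_momentum q i
  have h2 : 1 / (S : ℝ) ≤ freq (q i) := by
    unfold freq
    refine div_le_div_of_nonneg_right ?_ hS.le
    have := (ZMod.valMinAbs_eq_zero (q i)).not.mpr hi
    exact_mod_cast (by omega : 1 ≤ (q i).valMinAbs.natAbs)
  have h3 : 2 * Real.pi / S = 2 * Real.pi * (1 / S) := by ring
  rw [h3]
  nlinarith [Real.pi_pos]

lemma norm_momentum_pos {S : ℕ} [NeZero S] {q : Fin 3 → ZMod S} (hq : q ≠ 0) :
    0 < ‖momentum q‖ := by
  have hS : (0 : ℝ) < S := by exact_mod_cast NeZero.pos S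
  exact lt_of_lt_of_le (by positivity) (inv_le_norm_momentum hq)

/-- `1 / |k|²` is summable over the momenta in three dimensions, by comparison with a product. -/
lemma sum_inv_norm_momentum_sq_le {S : ℕ} [NeZero S] :
    (1 / (S : ℝ) ^ 3) * ∑ q ∈ Finset.univ.erase (0 : Fin 3 → ZMod S), 1 / ‖momentum q‖ ^ 2
      ≤ 343 := by
  have hS : (0 : ℝ) < S := by exact_mod_cast NeZero.pos S
  set w : ZMod S → ℝ := fun l => (max (freq l) (1 / S)) ^ (-(2 / 3) : ℝ) with hw
  have hw0 : ∀ l, 0 ≤ w l := fun l => Real.rpow_nonneg (le_max_of_le_left (freq_nonneg l)) _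
  have h1 : ∀ q ∈ Finset.univ.erase (0 : Fin 3 → ZMod S),
      1 / ‖momentum q‖ ^ 2 ≤ ∏ i, w (q i) := by
    intro q hq
    have hq0 := Finset.ne_of_mem_erase hq
    have hpos := norm_momentum_pos hq0
    have hlow := inv_le_norm_momentum hq0
    have h2 : ∀ i, ‖momentum q‖ ^ (-(2 / 3) : ℝ) ≤ w (q i) := by
      intro i
      refine Real.rpow_le_rpow_of_nonpos (lt_max_of_lt_right (by positivity)) ?_ (by norm_num)
      have h3 := freq_le_norm_momentum q i
      have h4 : 1 / (S : ℝ) ≤ 2 * Real.pi / S :=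
        div_le_div_of_nonneg_right (by linarith [Real.pi_gt_three]) hS.le
      exact max_le (by nlinarith [Real.pi_gt_three, freq_nonneg (q i)]) (h4.trans hlow)
    have h3 : ∏ _i : Fin 3, ‖momentum q‖ ^ (-(2 / 3) : ℝ) = 1 / ‖momentum q‖ ^ 2 := by
      rw [Finset.prod_const, Finset.card_univ, Fintype.card_fin, ← Real.rpow_natCast,
        ← Real.rpow_mul hpos.le, one_div, ← Real.rpow_natCast, ← Real.rpow_neg hpos.le]
      norm_num
    rw [← h3]
    exact Finset.prod_le_prod (fun i _ => Real.rpow_nonneg hpos.le _) fun i _ => h2 i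
  have h2 : ∑ q ∈ Finset.univ.erase (0 : Fin 3 → ZMod S), 1 / ‖momentum q‖ ^ 2
      ≤ (7 * (S : ℝ)) ^ 3 := by
    refine (Finset.sum_le_sum h1).trans ?_
    refine (Finset.sum_le_sum_of_subset_of_nonneg (Finset.erase_subset _ _)
      fun q _ _ => Finset.prod_nonneg fun i _ => hw0 _).trans ?_
    have h3 : ∑ q : Fin 3 → ZMod S, ∏ i, w (q i) = (∑ l, w l) ^ 3 := by
      have := Finset.prod_univ_sum (fun _ : Fin 3 => (Finset.univ : Finset (ZMod S)))
        (fun _ l => w l)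
      simp only [Fintype.piFinset_univ, Finset.prod_const, Finset.card_univ, Fintype.card_fin]
        at this
      exact this.symm
    rw [h3]
    exact pow_le_pow_left₀ (Finset.sum_nonneg fun l _ => hw0 l) sum_max_freq_le 3
  rw [one_div, inv_mul_le_iff₀ (by positivity)]
  refine h2.trans (le_of_eq ?_)
  ring

section

variable {L r n T S T' S' : ℕ} [NeZero L] [NeZero T] [NeZero S] [NeZero T'] [NeZero S']
  {κ M a : ℝ} {ε : (Fin 3 → ℝ) → ℝ} {H : Fin 3 → Fin 3 → (Fin 3 → ℤ) → ℝ}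

namespace GreenSetup

variable (hg : GreenSetup κ M a ε H L r n T S T' S')
include hg

lemma pow_le_T : (L : ℝ) ^ (2 * n) ≤ T := by
  have h : L ^ (2 * n) ≤ T := by
    rw [hg.time]; exact Nat.le_mul_of_pos_right _ (NeZero.pos T')
  exact_mod_cast h

lemma pow_le_S : (L : ℝ) ^ n ≤ S := by
  have h : L ^ n ≤ S := by
    rw [hg.space]; exact Nat.le_mul_of_pos_right _ (NeZero.pos S')
  exact_mod_cast h

/-- The contribution of the modes that are not spatially constant: the averaging term changes the
propagator little. -/
lemma sum_greenDiag_sub_inv_le :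
    (L : ℝ) ^ (4 * n) * ((1 / ((T : ℝ) * (S : ℝ) ^ 3)) *
      ∑ q ∈ Finset.univ.erase (0 : Fin 3 → ZMod S), ∑ l : ZMod T,
        ‖greenDiag H a L r n T' S' (l, q) - 1 / scaledSymbol ε L n ((l, q) : Lat T S)‖)
      ≤ 343 * (2 * a / gapConst κ M ^ 2 + 1 / gapConst κ M) := by
  have hc0 := hg.bounds.gapConst_pos hg.κ_pos
  have ha := hg.a_pos
  have hL := hg.L_pos
  have hT : (0 : ℝ) < T := by exact_mod_cast NeZero.pos T
  have hS : (0 : ℝ) < S := by exact_mod_cast NeZero.pos S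
  have hTL := hg.pow_le_T
  set c := gapConst κ M
  have hq : ∀ q ∈ Finset.univ.erase (0 : Fin 3 → ZMod S),
      (L : ℝ) ^ (4 * n) * ((1 / (T : ℝ)) * ∑ l : ZMod T,
        ‖greenDiag H a L r n T' S' (l, q) - 1 / scaledSymbol ε L n ((l, q) : Lat T S)‖)
      ≤ (2 * a / c ^ 2 + 1 / c) * (1 / ‖momentum q‖ ^ 2) := by
    intro q hq
    have hq0 := Finset.ne_of_mem_erase hq
    have hk := norm_momentum_pos hq0
    have hne : ∀ l : ZMod T, ((l, q) : Lat T S) ≠ 0 := fun l h => hq0 (congrArg Prod.snd h)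
    have hlow : ∀ l : ZMod T, (L : ℝ) ^ (2 * n) * (c * (‖momentum q‖ ^ 2 + freq l))
        ≤ ‖scaledSymbol ε L n ((l, q) : Lat T S)‖ := by
      intro l
      rw [hg.norm_scaledSymbol]
      exact mul_le_mul_of_nonneg_left (hg.gap_le_norm_dSymbol (l, q)) (by positivity)
    have h4n : (L : ℝ) ^ (4 * n) = ((L : ℝ) ^ (2 * n)) ^ 2 := by rw [← pow_mul]; ring_nf
    have hLn : 0 < (L : ℝ) ^ (2 * n) := by positivity
    rw [← Finset.add_sum_erase _ _ (Finset.mem_univ (0 : ZMod T)), mul_add, mul_add]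
    have h0 : (L : ℝ) ^ (4 * n) * ((1 / (T : ℝ)) *
        ‖greenDiag H a L r n T' S' ((0, q) : Lat T S) - 1 / scaledSymbol ε L n ((0, q) : Lat T S)‖)
        ≤ 1 / c * (1 / ‖momentum q‖ ^ 2) := by
      have h1 := hg.norm_greenDiag_sub_inv_le_of_temporal_zero (hne 0)
        (rfl : ((0, q) : Lat T S).1 = 0)
      have h2 := hlow 0
      rw [freq_eq_zero.mpr rfl, add_zero] at h2
      have h3 : 1 / ‖scaledSymbol ε L n ((0, q) : Lat T S)‖
          ≤ 1 / ((L : ℝ) ^ (2 * n) * (c * ‖momentum q‖ ^ 2)) :=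
        one_div_le_one_div_of_le (by positivity) h2
      calc _ ≤ (L : ℝ) ^ (4 * n) * ((1 / (L : ℝ) ^ (2 * n)) *
            (1 / ((L : ℝ) ^ (2 * n) * (c * ‖momentum q‖ ^ 2)))) := by
            gcongr
            exact h1.trans h3
        _ = 1 / c * (1 / ‖momentum q‖ ^ 2) := by
            rw [h4n]; field_simp
    have h1 : (L : ℝ) ^ (4 * n) * ((1 / (T : ℝ)) * ∑ l ∈ Finset.univ.erase (0 : ZMod T),
        ‖greenDiag H a L r n T' S' ((l, q) : Lat T S) - 1 / scaledSymbol ε L n ((l, q) : Lat T S)‖)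
        ≤ 2 * a / c ^ 2 * (1 / ‖momentum q‖ ^ 2) := by
      have h2 : ∀ l : ZMod T, (L : ℝ) ^ (4 * n) *
          ‖greenDiag H a L r n T' S' (l, q) - 1 / scaledSymbol ε L n ((l, q) : Lat T S)‖
          ≤ a / c ^ 2 * (1 / (‖momentum q‖ ^ 2 + freq l) ^ 2) := by
        intro l
        have hf := freq_nonneg l
        have h3 := hg.norm_greenDiag_sub_inv_le (hne l)
        have h4 : a / ‖scaledSymbol ε L n ((l, q) : Lat T S)‖ ^ 2
            ≤ a / ((L : ℝ) ^ (2 * n) * (c * (‖momentum q‖ ^ 2 + freq l))) ^ 2 :=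
          div_le_div_of_nonneg_left ha.le (by positivity)
            (pow_le_pow_left₀ (by positivity) (hlow l) 2)
        calc _ ≤ (L : ℝ) ^ (4 * n) *
              (a / ((L : ℝ) ^ (2 * n) * (c * (‖momentum q‖ ^ 2 + freq l))) ^ 2) := by
              gcongr; exact h3.trans h4
          _ = _ := by
            rw [h4n]; field_simp
      rw [mul_left_comm, Finset.mul_sum]
      calc _ ≤ (1 / (T : ℝ)) * ∑ l ∈ Finset.univ.erase (0 : ZMod T),
            a / c ^ 2 * (1 / (‖momentum q‖ ^ 2 + freq l) ^ 2) := by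
            exact mul_le_mul_of_nonneg_left (Finset.sum_le_sum fun l _ => h2 l) (by positivity)
        _ = a / c ^ 2 * ((1 / (T : ℝ)) * ∑ l ∈ Finset.univ.erase (0 : ZMod T),
            1 / (‖momentum q‖ ^ 2 + freq l) ^ 2) := by rw [← Finset.mul_sum]; ring
        _ ≤ a / c ^ 2 * (2 / ‖momentum q‖ ^ 2) := by
            gcongr; exact sum_inv_sq_freq_le (by positivity)
        _ = _ := by ring
    linarith
  have hsum := sum_inv_norm_momentum_sq_le (S := S)
  calc _ = (1 / (S : ℝ) ^ 3) * ∑ q ∈ Finset.univ.erase (0 : Fin 3 → ZMod S),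
        (L : ℝ) ^ (4 * n) * ((1 / (T : ℝ)) * ∑ l : ZMod T,
        ‖greenDiag H a L r n T' S' (l, q) - 1 / scaledSymbol ε L n ((l, q) : Lat T S)‖) := by
        rw [← Finset.mul_sum, ← Finset.mul_sum]
        field_simp
    _ ≤ (1 / (S : ℝ) ^ 3) * ∑ q ∈ Finset.univ.erase (0 : Fin 3 → ZMod S),
        (2 * a / c ^ 2 + 1 / c) * (1 / ‖momentum q‖ ^ 2) := by
        exact mul_le_mul_of_nonneg_left (Finset.sum_le_sum hq) (by positivity)
    _ = (2 * a / c ^ 2 + 1 / c) * ((1 / (S : ℝ) ^ 3) *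
        ∑ q ∈ Finset.univ.erase (0 : Fin 3 → ZMod S), 1 / ‖momentum q‖ ^ 2) := by
        rw [← Finset.mul_sum]; ring
    _ ≤ (2 * a / c ^ 2 + 1 / c) * 343 := by gcongr
    _ = _ := by ring

/-- The contribution of the spatially constant modes. -/
lemma sum_greenDiag_zero_le :
    (L : ℝ) ^ (4 * n) * ((1 / ((T : ℝ) * (S : ℝ) ^ 3)) *
      ∑ l : ZMod T, ‖greenDiag H a L r n T' S' ((l, 0) : Lat T S)‖)
      ≤ zeroModeConst κ M a r * (1 + 4 / √(gapConst κ M)) := by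
  have hc0 := hg.bounds.gapConst_pos hg.κ_pos
  have hL := hg.L_pos
  have hT : (0 : ℝ) < T := by exact_mod_cast NeZero.pos T
  have hS : (0 : ℝ) < S := by exact_mod_cast NeZero.pos S
  have hTL := hg.pow_le_T
  have hSL := hg.pow_le_S
  have hZ := hg.zeroModeConst_pos
  set c := gapConst κ M
  set Z := zeroModeConst κ M a r
  have hLn : 0 < (L : ℝ) ^ n := by positivity
  have hL1 : 1 ≤ (L : ℝ) ^ n := one_le_pow₀ (by exact_mod_cast hg.one_lt.le)
  have h2n : (L : ℝ) ^ (2 * n) = ((L : ℝ) ^ n) ^ 2 := by rw [← pow_mul]; ring_nf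
  have h4n : (L : ℝ) ^ (4 * n) = ((L : ℝ) ^ n) ^ 4 := by rw [← pow_mul]; ring_nf
  have hsc : 0 < √c := Real.sqrt_pos.mpr hc0
  have h1 : ∀ l ∈ Finset.univ.erase (0 : ZMod T),
      ‖greenDiag H a L r n T' S' ((l, 0) : Lat T S)‖
        ≤ Z / ((L : ℝ) ^ n * √c) * (1 / √(freq l)) := by
    intro l hl
    obtain ⟨h2, h3⟩ := hg.norm_greenDiag_le_of_spatial_zero (p := ((l, 0) : Lat T S)) rfl
    have hf : 0 < freq l := lt_of_le_of_ne (freq_nonneg l) fun h =>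
      Finset.ne_of_mem_erase hl (freq_eq_zero.mp h.symm)
    have h4 : (L : ℝ) ^ (2 * n) * (c * freq l) ≤ ‖scaledSymbol ε L n ((l, 0) : Lat T S)‖ := by
      rw [hg.norm_scaledSymbol]
      have := hg.gap_le_norm_dSymbol ((l, 0) : Lat T S)
      rw [momentum_zero, norm_zero] at this
      refine mul_le_mul_of_nonneg_left (le_trans (le_of_eq ?_) this) (by positivity)
      simp [c]
    set x := ‖greenDiag H a L r n T' S' ((l, 0) : Lat T S)‖
    have hx : 0 ≤ x := norm_nonneg _
    have h5 : x * ((L : ℝ) ^ n * √c * √(freq l)) ≤ Z := by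
      apply le_of_sq_le_sq _ hZ.le
      have h6 : (x * ((L : ℝ) ^ n * √c * √(freq l))) ^ 2
          = x * (x * ((L : ℝ) ^ (2 * n) * (c * freq l))) := by
        rw [mul_pow, mul_pow, mul_pow, Real.sq_sqrt hc0.le, Real.sq_sqrt hf.le, h2n]; ring
      rw [h6, sq]
      have h7 := mul_le_mul_of_nonneg_left h4 hx
      exact mul_le_mul h2 (h7.trans h3) (by positivity) hZ.le
    have hsf : 0 < √(freq l) := Real.sqrt_pos.mpr hf
    rw [div_mul_div_comm, mul_one, le_div_iff₀ (by positivity)]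
    exact h5
  have hzero := (hg.norm_greenDiag_le_of_spatial_zero (p := ((0, 0) : Lat T S)) rfl).1
  have h2 : (1 / (T : ℝ)) * ∑ l : ZMod T, ‖greenDiag H a L r n T' S' ((l, 0) : Lat T S)‖
      ≤ Z / ((L : ℝ) ^ n) ^ 2 + Z / ((L : ℝ) ^ n * √c) * 4 := by
    rw [← Finset.add_sum_erase _ _ (Finset.mem_univ (0 : ZMod T)), mul_add]
    refine add_le_add ?_ ?_
    · rw [← h2n, div_eq_mul_one_div Z, mul_comm]
      gcongr
    · calc _ ≤ (1 / (T : ℝ)) * ∑ l ∈ Finset.univ.erase (0 : ZMod T),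
            Z / ((L : ℝ) ^ n * √c) * (1 / √(freq l)) := by
            gcongr with l hl; exact h1 l hl
        _ = Z / ((L : ℝ) ^ n * √c) * ((1 / (T : ℝ)) *
            ∑ l ∈ Finset.univ.erase (0 : ZMod T), 1 / √(freq l)) := by
            rw [← Finset.mul_sum]; ring
        _ ≤ _ := by gcongr; exact sum_inv_sqrt_freq_le
  calc _ = (L : ℝ) ^ (4 * n) / (S : ℝ) ^ 3 * ((1 / (T : ℝ)) *
        ∑ l : ZMod T, ‖greenDiag H a L r n T' S' ((l, 0) : Lat T S)‖) := by field_simp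
    _ ≤ (L : ℝ) ^ (4 * n) / ((L : ℝ) ^ n) ^ 3 *
        (Z / ((L : ℝ) ^ n) ^ 2 + Z / ((L : ℝ) ^ n * √c) * 4) := by gcongr
    _ = Z / (L : ℝ) ^ n + Z * (4 / √c) := by rw [h4n]; field_simp
    _ ≤ Z + Z * (4 / √c) := by gcongr; exact div_le_self hZ.le hL1
    _ = _ := by ring

end GreenSetup
end

/-! ### Second differences of the propagator -/

lemma abs_exp_neg_sub_le {x y : ℝ} (hx : 0 ≤ x) (hy : 0 ≤ y) :
    |Real.exp (-x) - Real.exp (-y)| ≤ |x - y| := by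
  have key : ∀ x y : ℝ, 0 ≤ y → Real.exp (-y) - Real.exp (-x) ≤ |x - y| := by
    intro x y hy
    have h1 := Real.add_one_le_exp (y - x)
    have h2 : Real.exp (-x) = Real.exp (-y) * Real.exp (y - x) := by
      rw [← Real.exp_add]; ring_nf
    have h3 := exp_neg_le_one hy
    have h4 := Real.exp_pos (-y)
    have h5 : Real.exp (-y) - Real.exp (-x) ≤ Real.exp (-y) * (x - y) := by
      rw [h2]; nlinarith
    refine h5.trans ?_
    calc Real.exp (-y) * (x - y) ≤ Real.exp (-y) * |x - y| :=
          mul_le_mul_of_nonneg_left (le_abs_self _) h4.le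
      _ ≤ 1 * |x - y| := mul_le_mul_of_nonneg_right h3 (abs_nonneg _)
      _ = |x - y| := one_mul _
  rw [abs_le]
  constructor
  · linarith [key x y hy]
  · have := key y x hx
    rw [abs_sub_comm]; exact this

/-- Taylor expansion of `exp(-x)` to second order. -/
lemma abs_exp_neg_second_le {x y : ℝ} (hx : 0 ≤ x) (hy : 0 ≤ y) :
    |Real.exp (-y) - Real.exp (-x) + Real.exp (-x) * (y - x)| ≤ (y - x) ^ 2 := by
  have h1 := Real.add_one_le_exp (x - y)
  have h2 : Real.exp (-y) = Real.exp (-x) * Real.exp (x - y) := by rw [← Real.exp_add]; ring_nf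
  have h1' := Real.add_one_le_exp (y - x)
  have h2' : Real.exp (-x) = Real.exp (-y) * Real.exp (y - x) := by rw [← Real.exp_add]; ring_nf
  have h4 := Real.exp_pos (-y)
  have h5 := Real.exp_pos (-x)
  have hlow : 0 ≤ Real.exp (-y) - Real.exp (-x) + Real.exp (-x) * (y - x) := by
    have : Real.exp (-x) * (x - y + 1) ≤ Real.exp (-y) := by
      rw [h2]; exact mul_le_mul_of_nonneg_left h1 h5.le
    linarith
  rw [abs_of_nonneg hlow]
  have hup : Real.exp (-y) - Real.exp (-x) ≤ -(Real.exp (-y) * (y - x)) := by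
    have : Real.exp (-y) * (y - x + 1) ≤ Real.exp (-x) := by
      rw [h2']; exact mul_le_mul_of_nonneg_left h1' h4.le
    linarith
  have h6 := abs_exp_neg_sub_le hx hy
  have h7 : (Real.exp (-x) - Real.exp (-y)) * (y - x) ≤ |x - y| * |y - x| := by
    refine (le_abs_self _).trans ?_
    rw [abs_mul]
    exact mul_le_mul_of_nonneg_right h6 (abs_nonneg _)
  rw [abs_sub_comm x y, ← sq, sq_abs] at h7
  linarith

/-- The second difference of an inverse, in terms of first and second differences. -/
lemma norm_second_diff_inv_le {d₀ d₁ d₂ : ℂ} {g s t : ℝ} (h₀ : g ≤ ‖d₀‖) (h₁ : g ≤ ‖d₁‖)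
    (h₂ : g ≤ ‖d₂‖) (hg : 0 < g) (hs : ‖d₁ + d₂ - 2 * d₀‖ ≤ s) (ht₁ : ‖d₁ - d₀‖ ≤ t)
    (ht₂ : ‖d₂ - d₀‖ ≤ t) :
    ‖d₁⁻¹ + d₂⁻¹ - 2 * d₀⁻¹‖ ≤ s / g ^ 2 + 2 * t ^ 2 / g ^ 3 := by
  have n0 : d₀ ≠ 0 := norm_pos_iff.mp (hg.trans_le h₀)
  have n1 : d₁ ≠ 0 := norm_pos_iff.mp (hg.trans_le h₁)
  have n2 : d₂ ≠ 0 := norm_pos_iff.mp (hg.trans_le h₂)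
  have hid : d₁⁻¹ + d₂⁻¹ - 2 * d₀⁻¹
      = -((d₁ + d₂ - 2 * d₀) / (d₁ * d₂)) - 2 * ((d₁ - d₀) * (d₂ - d₀)) / (d₀ * d₁ * d₂) + 0 := by
    field_simp
    ring
  have ht : 0 ≤ t := (norm_nonneg _).trans ht₁
  have hs0 : 0 ≤ s := (norm_nonneg _).trans hs
  rw [hid, add_zero]
  refine (norm_sub_le _ _).trans (add_le_add ?_ ?_)
  · rw [norm_neg, norm_div, norm_mul, sq]
    exact div_le_div₀ hs0 hs (by positivity) (mul_le_mul h₁ h₂ hg.le (hg.le.trans h₁))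
  · rw [norm_div, norm_mul, norm_mul, norm_mul, norm_mul]
    refine div_le_div₀ (by positivity) ?_ (by positivity) ?_
    · rw [sq, Complex.norm_ofNat]
      exact mul_le_mul_of_nonneg_left (mul_le_mul ht₁ ht₂ (norm_nonneg _) ht) (by norm_num)
    · calc g ^ 3 = g * g * g := by ring
        _ ≤ ‖d₀‖ * ‖d₁‖ * ‖d₂‖ := by gcongr

lemma norm_diff_inv_le {d₁ d₂ : ℂ} {g t : ℝ} (h₁ : g ≤ ‖d₁‖) (h₂ : g ≤ ‖d₂‖) (hg : 0 < g)
    (ht : ‖d₁ - d₂‖ ≤ t) : ‖d₁⁻¹ - d₂⁻¹‖ ≤ t / g ^ 2 := by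
  have n1 : d₁ ≠ 0 := norm_pos_iff.mp (hg.trans_le h₁)
  have n2 : d₂ ≠ 0 := norm_pos_iff.mp (hg.trans_le h₂)
  have hid : d₁⁻¹ - d₂⁻¹ = -((d₁ - d₂) / (d₁ * d₂)) := by
    field_simp; ring
  have ht0 : 0 ≤ t := (norm_nonneg _).trans ht
  rw [hid, norm_neg, norm_div, norm_mul, sq]
  exact div_le_div₀ ht0 ht (by positivity) (mul_le_mul h₁ h₂ hg.le (hg.le.trans h₁))

/-- The second difference of a product with a plane wave. -/
lemma norm_second_diff_mul_phase_le {f₀ f₁ f₂ : ℂ} {x A B C : ℝ} (hA : ‖f₁ + f₂ - 2 * f₀‖ ≤ A)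
    (hB : ‖f₁ - f₂‖ ≤ B) (hC : ‖f₀‖ ≤ C) :
    ‖f₁ * Complex.exp (Complex.I * x) + f₂ * Complex.exp (Complex.I * (-x : ℝ)) - 2 * f₀‖
      ≤ A + B * |x| + C * |x| ^ 2 := by
  set e := Complex.exp (Complex.I * x) with he
  set e' := Complex.exp (Complex.I * (-x : ℝ)) with he'
  have hee : e * e' = 1 := by
    rw [he, he', ← Complex.exp_add]; simp
  have h1 : ‖e - 1‖ ≤ |x| := Real.norm_exp_I_mul_ofReal_sub_one_le (x := x)
  have h2 : ‖e' - 1‖ ≤ |x| := by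
    have := Real.norm_exp_I_mul_ofReal_sub_one_le (x := -x)
    rwa [Real.norm_eq_abs, abs_neg] at this
  have hn : ‖e‖ = 1 := by rw [he, mul_comm, Complex.norm_exp_ofReal_mul_I]
  have hn' : ‖e'‖ = 1 := by rw [he', mul_comm, Complex.norm_exp_ofReal_mul_I]
  have hid : f₁ * e + f₂ * e' - 2 * f₀ = (f₁ + f₂ - 2 * f₀) * ((e + e') / 2)
      + (f₁ - f₂) * ((e - e') / 2) + f₀ * (-((e - 1) * (e' - 1))) := by
    linear_combination f₀ * hee
  have h3 : ‖(e + e') / 2‖ ≤ 1 := by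
    rw [norm_div, Complex.norm_ofNat, div_le_one (by norm_num)]
    exact (norm_add_le _ _).trans (by rw [hn, hn']; norm_num)
  have h4 : ‖(e - e') / 2‖ ≤ |x| := by
    rw [norm_div, Complex.norm_ofNat, div_le_iff₀ (by norm_num)]
    have : e - e' = (e - 1) - (e' - 1) := by ring
    rw [this]
    exact (norm_sub_le _ _).trans (by linarith)
  have h5 : ‖-((e - 1) * (e' - 1))‖ ≤ |x| ^ 2 := by
    rw [norm_neg, norm_mul, sq]
    exact mul_le_mul h1 h2 (norm_nonneg _) (abs_nonneg _)
  rw [hid]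
  refine (norm_add₃_le).trans ?_
  rw [norm_mul, norm_mul, norm_mul]
  have hA0 := (norm_nonneg _).trans hA
  have hB0 := (norm_nonneg _).trans hB
  have hC0 := (norm_nonneg _).trans hC
  refine add_le_add (add_le_add ?_ ?_) ?_
  · exact (mul_le_mul hA h3 (norm_nonneg _) hA0).trans (by rw [mul_one])
  · exact mul_le_mul hB h4 (norm_nonneg _) hB0
  · exact mul_le_mul hC h5 (norm_nonneg _) hC0

/-- The propagator at temporal mode `l`, times a spatial plane wave. -/
def propWave {T : ℕ} [NeZero T] (ε : (Fin 3 → ℝ) → ℝ) (l : ZMod T) (y : Fin 3 → ℤ)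
    (k : Fin 3 → ℝ) : ℂ :=
  (propDenom ε l k)⁻¹ * Complex.exp (Complex.I * (phase k y : ℂ))

/-- The constant in the bound on second differences of the propagator. -/
def secondDiffConst (κ M : ℝ) : ℝ :=
  16 * (M + 80 * M ^ 2) / gapConst κ M ^ 2 + 512 * M ^ 2 / gapConst κ M ^ 3
    + 128 * M / gapConst κ M ^ 2 + 44 / gapConst κ M

section

variable {T : ℕ} [NeZero T] {κ M : ℝ} {ε : (Fin 3 → ℝ) → ℝ}

lemma norm_propDenom_sub (l : ZMod T) (k k' : Fin 3 → ℝ) :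
    ‖propDenom ε l k - propDenom ε l k'‖ = |Real.exp (-ε k) - Real.exp (-ε k')| := by
  have : propDenom ε l k - propDenom ε l k'
      = -(((Real.exp (-ε k) - Real.exp (-ε k') : ℝ) : ℂ) * ZMod.stdAddChar l) := by
    simp only [propDenom]; push_cast; ring
  rw [this, norm_neg, norm_mul, norm_stdAddChar, mul_one, Complex.norm_real, Real.norm_eq_abs]

/-- The contributions to the second difference of the propagator, collected in terms of the step
`u`, the separation `Y` and the energy `Λ`. -/
lemma second_diff_arith {M c Λ K u Y x : ℝ} (hM : 0 ≤ M) (hc0 : 0 < c) (hΛ0 : 0 < Λ)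
    (hK : 0 ≤ K) (hu : 0 ≤ u) (hY : 0 ≤ Y) (hx0 : 0 ≤ x) (hKΛ : K ^ 2 ≤ Λ) (hK4 : K ≤ 4)
    (hΛ1 : Λ ≤ 11) (hx : x ≤ u * Y) :
    (M + 80 * M ^ 2) * u ^ 2 / (c * Λ / 4) ^ 2 + 2 * (2 * M * K * u) ^ 2 / (c * Λ / 4) ^ 3
      + 2 * M * K * u / (c * Λ / 4) ^ 2 * x + 1 / (c * Λ / 4) * x ^ 2
      ≤ (16 * (M + 80 * M ^ 2) / c ^ 2 + 512 * M ^ 2 / c ^ 3 + 128 * M / c ^ 2 + 44 / c)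
        * (1 + Y) ^ 2 * u ^ 2 / Λ ^ 2 := by
  set U := u ^ 2 / Λ ^ 2 with hU
  have hU0 : 0 ≤ U := by positivity
  have t1 : (M + 80 * M ^ 2) * u ^ 2 / (c * Λ / 4) ^ 2 = 16 * (M + 80 * M ^ 2) / c ^ 2 * U := by
    rw [hU]; field_simp; ring
  have t2 : 2 * (2 * M * K * u) ^ 2 / (c * Λ / 4) ^ 3 ≤ 512 * M ^ 2 / c ^ 3 * U := by
    have h1 : 2 * (2 * M * K * u) ^ 2 / (c * Λ / 4) ^ 3
        = 512 * M ^ 2 / c ^ 3 * U * (K ^ 2 / Λ) := by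
      rw [hU]; field_simp; ring
    rw [h1]
    refine mul_le_of_le_one_right (by positivity) ?_
    rwa [div_le_one hΛ0]
  have t3 : 2 * M * K * u / (c * Λ / 4) ^ 2 * x ≤ 128 * M / c ^ 2 * U * Y := by
    calc 2 * M * K * u / (c * Λ / 4) ^ 2 * x ≤ 2 * M * K * u / (c * Λ / 4) ^ 2 * (u * Y) := by
          gcongr
      _ = 32 * M / c ^ 2 * U * Y * K := by rw [hU]; field_simp; ring
      _ ≤ 32 * M / c ^ 2 * U * Y * 4 := by gcongr
      _ = _ := by ring
  have t4 : 1 / (c * Λ / 4) * x ^ 2 ≤ 44 / c * U * Y ^ 2 := by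
    calc 1 / (c * Λ / 4) * x ^ 2 ≤ 1 / (c * Λ / 4) * (u * Y) ^ 2 := by gcongr
      _ = 4 / c * U * Y ^ 2 * Λ := by rw [hU]; field_simp
      _ ≤ 4 / c * U * Y ^ 2 * 11 := by gcongr
      _ = _ := by ring
  have hfinal : (16 * (M + 80 * M ^ 2) / c ^ 2 + 512 * M ^ 2 / c ^ 3 + 128 * M / c ^ 2 + 44 / c)
        * (1 + Y) ^ 2 * u ^ 2 / Λ ^ 2
      = 16 * (M + 80 * M ^ 2) / c ^ 2 * U * (1 + Y) ^ 2 + 512 * M ^ 2 / c ^ 3 * U * (1 + Y) ^ 2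
        + 128 * M / c ^ 2 * U * (1 + Y) ^ 2 + 44 / c * U * (1 + Y) ^ 2 := by
    rw [hU]; ring
  rw [hfinal, t1]
  have q1 : (1 : ℝ) ≤ (1 + Y) ^ 2 := by nlinarith
  have q2 : Y ≤ (1 + Y) ^ 2 := by nlinarith
  have q3 : Y ^ 2 ≤ (1 + Y) ^ 2 := by nlinarith
  refine add_le_add (add_le_add (add_le_add ?_ ?_) ?_) ?_
  · exact le_mul_of_one_le_right (by positivity) q1
  · exact t2.trans (le_mul_of_one_le_right (by positivity) q1)
  · exact t3.trans (mul_le_mul_of_nonneg_left q2 (by positivity))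
  · exact t4.trans (mul_le_mul_of_nonneg_left q3 (by positivity))

set_option maxHeartbeats 1000000 in
/-- The second difference of the propagator gains two powers of the step `u` and loses one power of
the energy `‖k‖ ^ 2 + |l|`; shifts by at most `‖k‖ / 2` keep away from the singularity. -/
lemma DispersionBounds.norm_second_diff_propWave_le (hε : DispersionBounds κ M ε) (hκ : 0 < κ)
    (l : ZMod T) (y : Fin 3 → ℤ) {k u : Fin 3 → ℝ} (hk0 : 0 < ‖k‖) (hk : ‖k‖ ≤ Real.pi)
    (hu : ‖u‖ ≤ ‖k‖ / 2) :
    ‖propWave ε l y (k + u) + propWave ε l y (k - u) - 2 * propWave ε l y k‖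
      ≤ secondDiffConst κ M * (1 + oneLength y) ^ 2 * ‖u‖ ^ 2 / (‖k‖ ^ 2 + freq l) ^ 2 := by
  have hc0 := hε.gapConst_pos hκ
  have hM := hε.M_nonneg
  have hY := oneLength_nonneg y
  have hf := freq_nonneg l
  have hf2 := freq_le_half l
  have hpi := Real.pi_lt_d2
  have hpi0 := Real.pi_pos
  have hu0 := norm_nonneg u
  set c := gapConst κ M
  set Λ := ‖k‖ ^ 2 + freq l with hΛ
  have hΛ0 : 0 < Λ := by positivity
  have hΛ1 : Λ ≤ 11 := by nlinarith
  have hk2 : ‖k‖ ^ 2 ≤ 10 := by nlinarith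
  set g := c * Λ / 4 with hgdef
  have hg0 : 0 < g := by positivity
  -- the shifted momenta have the same gap up to a factor of four
  have hlow : ∀ k' : Fin 3 → ℝ, ‖k‖ / 2 ≤ ‖k'‖ → ‖k'‖ ≤ 3 * Real.pi / 2 →
      g ≤ ‖propDenom ε l k'‖ := by
    intro k' h1 h2
    refine le_trans ?_ (hε.gap l h2)
    have h3 : (‖k‖ / 2) ^ 2 ≤ ‖k'‖ ^ 2 := pow_le_pow_left₀ (by positivity) h1 2
    have h4 : Λ / 4 ≤ ‖k'‖ ^ 2 + freq l := by rw [hΛ]; nlinarith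
    calc g = c * (Λ / 4) := by rw [hgdef]; ring
      _ ≤ _ := mul_le_mul_of_nonneg_left h4 hc0.le
  have hp1 : ‖k‖ / 2 ≤ ‖k + u‖ := by
    have := norm_sub_le (k + u) u
    rw [add_sub_cancel_right] at this; linarith
  have hp2 : ‖k + u‖ ≤ 3 * Real.pi / 2 := (norm_add_le _ _).trans (by linarith)
  have hm1 : ‖k‖ / 2 ≤ ‖k - u‖ := by
    have := norm_add_le (k - u) u
    rw [sub_add_cancel] at this; linarith
  have hm2 : ‖k - u‖ ≤ 3 * Real.pi / 2 := (norm_sub_le _ _).trans (by linarith)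
  have g0 := hlow k (by linarith) (by linarith)
  have gp := hlow _ hp1 hp2
  have gm := hlow _ hm1 hm2
  -- differences of the dispersion relation
  have hsd := hε.second_diff k u
  have hfd := hε.first_diff k u
  have hu2 : M * ‖u‖ ^ 2 ≤ M * ‖k‖ * ‖u‖ / 2 := by
    have : ‖u‖ * ‖u‖ ≤ ‖k‖ / 2 * ‖u‖ := mul_le_mul_of_nonneg_right hu hu0
    nlinarith
  set b := 2 * M * ‖k‖ * ‖u‖ with hb
  have hb0 : 0 ≤ b := by positivity
  have hdp : |ε (k + u) - ε k| ≤ b := by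
    rw [abs_le] at hsd hfd ⊢
    constructor <;> linarith [hsd.1, hsd.2, hfd.1, hfd.2]
  have hdm : |ε (k - u) - ε k| ≤ b := by
    rw [abs_le] at hsd hfd ⊢
    constructor <;> linarith [hsd.1, hsd.2, hfd.1, hfd.2]
  have ht1 : ‖propDenom ε l (k + u) - propDenom ε l k‖ ≤ b := by
    rw [norm_propDenom_sub]
    exact (abs_exp_neg_sub_le (hε.nonneg _) (hε.nonneg _)).trans hdp
  have ht2 : ‖propDenom ε l (k - u) - propDenom ε l k‖ ≤ b := by
    rw [norm_propDenom_sub]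
    exact (abs_exp_neg_sub_le (hε.nonneg _) (hε.nonneg _)).trans hdm
  have ht3 : ‖propDenom ε l (k + u) - propDenom ε l (k - u)‖ ≤ b := by
    rw [norm_propDenom_sub]
    exact (abs_exp_neg_sub_le (hε.nonneg _) (hε.nonneg _)).trans hfd
  have hs : ‖propDenom ε l (k + u) + propDenom ε l (k - u) - 2 * propDenom ε l k‖
      ≤ (M + 80 * M ^ 2) * ‖u‖ ^ 2 := by
    have h1 : propDenom ε l (k + u) + propDenom ε l (k - u) - 2 * propDenom ε l k
        = -(((Real.exp (-ε (k + u)) + Real.exp (-ε (k - u)) - 2 * Real.exp (-ε k) : ℝ) : ℂ)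
          * ZMod.stdAddChar l) := by
      simp only [propDenom]; push_cast; ring
    rw [h1, norm_neg, norm_mul, norm_stdAddChar, mul_one, Complex.norm_real, Real.norm_eq_abs]
    have e1 := abs_exp_neg_second_le (hε.nonneg k) (hε.nonneg (k + u))
    have e2 := abs_exp_neg_second_le (hε.nonneg k) (hε.nonneg (k - u))
    have e3 : |Real.exp (-ε k) * (ε (k + u) + ε (k - u) - 2 * ε k)| ≤ M * ‖u‖ ^ 2 := by
      rw [abs_mul, abs_of_pos (Real.exp_pos _)]
      exact (mul_le_of_le_one_left (abs_nonneg _) (exp_neg_le_one (hε.nonneg k))).trans hsd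
    have e4 : (ε (k + u) - ε k) ^ 2 ≤ b ^ 2 := by
      rw [← sq_abs]; exact pow_le_pow_left₀ (abs_nonneg _) hdp 2
    have e5 : (ε (k - u) - ε k) ^ 2 ≤ b ^ 2 := by
      rw [← sq_abs]; exact pow_le_pow_left₀ (abs_nonneg _) hdm 2
    have e6 : b ^ 2 ≤ 40 * (M ^ 2 * ‖u‖ ^ 2) := by
      have : b ^ 2 = 4 * ‖k‖ ^ 2 * (M ^ 2 * ‖u‖ ^ 2) := by rw [hb]; ring
      rw [this]
      exact mul_le_mul_of_nonneg_right (by linarith) (by positivity)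
    have e7 : (M + 80 * M ^ 2) * ‖u‖ ^ 2 = M * ‖u‖ ^ 2 + 2 * (40 * (M ^ 2 * ‖u‖ ^ 2)) := by ring
    rw [e7]
    rw [abs_le] at e1 e2 e3 ⊢
    have e8 : Real.exp (-ε k) * (ε (k + u) + ε (k - u) - 2 * ε k)
      = Real.exp (-ε k) * (ε (k + u) - ε k) + Real.exp (-ε k) * (ε (k - u) - ε k) := by ring
    rw [e8] at e3
    obtain ⟨e1, e1'⟩ := e1
    obtain ⟨e2, e2'⟩ := e2
    obtain ⟨e3, e3'⟩ := e3
    constructor <;> linarith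
  have hA := norm_second_diff_inv_le g0 gp gm hg0 hs ht1 ht2
  have hB := norm_diff_inv_le gp gm hg0 ht3
  have hC : ‖(propDenom ε l k)⁻¹‖ ≤ 1 / g := by
    rw [norm_inv, ← one_div]; exact one_div_le_one_div_of_le hg0 g0
  have key := norm_second_diff_mul_phase_le (x := phase u y) hA hB hC
  have hfac : propWave ε l y (k + u) + propWave ε l y (k - u) - 2 * propWave ε l y k
      = ((propDenom ε l (k + u))⁻¹ * Complex.exp (Complex.I * (phase u y : ℂ))
        + (propDenom ε l (k - u))⁻¹ * Complex.exp (Complex.I * ((-phase u y : ℝ) : ℂ))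
        - 2 * (propDenom ε l k)⁻¹) * Complex.exp (Complex.I * (phase k y : ℂ)) := by
    simp only [propWave, phase_add_left, phase_sub_left, Complex.ofReal_add, Complex.ofReal_sub,
      mul_add, mul_sub, Complex.exp_add, Complex.exp_sub, Complex.ofReal_neg, mul_neg,
      Complex.exp_neg, div_eq_mul_inv]
    ring
  rw [hfac, norm_mul, mul_comm Complex.I (phase k y : ℂ), Complex.norm_exp_ofReal_mul_I, mul_one]
  refine key.trans ?_
  have hphase : |phase u y| ≤ ‖u‖ * oneLength y := abs_phase_le u y
  exact second_diff_arith hM hc0 hΛ0 (norm_nonneg k) hu0 hY (abs_nonneg _)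
    (by rw [hΛ]; linarith) (by linarith) hΛ1 hphase

end

open MeasureTheory

/-! ### Integration over the momentum torus -/

lemma integrableOn_abs_rpow (R : ℝ) (hR : 0 ≤ R) :
    IntegrableOn (fun x : ℝ => |x| ^ (-(2 / 3) : ℝ)) (Set.Icc (-R) R) := by
  have h1 : IntervalIntegrable (fun x : ℝ => |x| ^ (-(2 / 3) : ℝ)) volume 0 R := by
    refine (intervalIntegral.intervalIntegrable_rpow' (a := 0) (b := R)
      (r := (-(2 / 3) : ℝ)) (by norm_num)).congr ?_
    intro x hx
    rw [Set.uIoc_of_le hR] at hx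
    simp only [abs_of_pos hx.1]
  have h2 : IntervalIntegrable (fun x : ℝ => |x| ^ (-(2 / 3) : ℝ)) volume (-R) 0 := by
    have := (IntervalIntegrable.iff_comp_neg).mp h1
    simp only [abs_neg, neg_zero] at this
    exact this.symm
  exact (intervalIntegrable_iff_integrableOn_Icc_of_le (by linarith)).mp (h2.trans h1)

/-- In three dimensions `|k|⁻²` is integrable at the origin. It is dominated by
`∏ i, |k i| ^ (-2/3)`. -/
lemma integrableOn_inv_norm_sq (R : ℝ) (hR : 0 ≤ R) :
    IntegrableOn (fun k : Fin 3 → ℝ => 1 / ‖k‖ ^ 2) (Metric.closedBall 0 R) := by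
  have hball : Metric.closedBall (0 : Fin 3 → ℝ) R = Set.univ.pi fun _ => Set.Icc (-R) R := by
    rw [closedBall_pi _ hR]
    simp [Real.closedBall_eq_Icc]
  have hdom : IntegrableOn (fun k : Fin 3 → ℝ => ∏ i, |k i| ^ (-(2 / 3) : ℝ))
      (Metric.closedBall 0 R) := by
    rw [hball, IntegrableOn, volume_pi, Measure.restrict_pi_pi]
    exact Integrable.fintype_prod fun _ => integrableOn_abs_rpow R hR
  have hne : ∀ᵐ k : Fin 3 → ℝ, ∀ i, k i ≠ 0 :=
    ae_all_iff.mpr fun i => Measure.ae_eval_ne (μ := fun _ : Fin 3 => (volume : Measure ℝ)) i 0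
  refine hdom.mono' ?_ ?_
  · exact (measurable_const.div (measurable_norm.pow_const 2)).aestronglyMeasurable
  · refine ae_restrict_of_ae (hne.mono fun k hk => ?_)
    have hpos : ∀ i, 0 < |k i| := fun i => abs_pos.mpr (hk i)
    have hle : ∀ i, |k i| ≤ ‖k‖ := fun i => norm_le_pi_norm k i
    have hk0 : 0 < ‖k‖ := (hpos 0).trans_le (hle 0)
    rw [Real.norm_of_nonneg (by positivity)]
    have h1 : (1 / ‖k‖ ^ 2 : ℝ) = ∏ _i : Fin 3, ‖k‖ ^ (-(2 / 3) : ℝ) := by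
      rw [Finset.prod_const, Finset.card_univ, Fintype.card_fin, ← Real.rpow_mul_natCast hk0.le,
        one_div, ← Real.rpow_natCast, ← Real.rpow_neg hk0.le]
      norm_num
    rw [h1]
    refine Finset.prod_le_prod (fun i _ => by positivity) fun i _ => ?_
    exact Real.rpow_le_rpow_of_nonpos (hpos i) (hle i) (by norm_num)

/-- The interval of length `2π / S` centred at `2π a / S`. -/
def gridCell (S : ℕ) (a : ZMod S) : Set ℝ :=
  Set.Ioc (2 * Real.pi * (a.valMinAbs : ℝ) / S - Real.pi / S)
    (2 * Real.pi * (a.valMinAbs : ℝ) / S + Real.pi / S)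

lemma mem_gridCell_iff {S : ℕ} [NeZero S] (a : ZMod S) (x : ℝ) :
    x ∈ gridCell S a ↔ x + -(a.valMinAbs) • (2 * Real.pi / S) ∈
      Set.Ioc (-(Real.pi / S)) (-(Real.pi / S) + 2 * Real.pi / S) := by
  have h1 : 2 * Real.pi * (a.valMinAbs : ℝ) / S = (a.valMinAbs : ℝ) * (2 * Real.pi / S) := by ring
  have h2 : 2 * Real.pi / S = Real.pi / S + Real.pi / S := by ring
  simp only [gridCell, Set.mem_Ioc, zsmul_eq_mul, Int.cast_neg, h1]
  constructor <;> rintro ⟨h3, h4⟩ <;> constructor <;> linarith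

/-- The grid cells make up a fundamental domain for `2πℤ` in `ℝ`. -/
lemma existsUnique_mem_gridCell {S : ℕ} [NeZero S] (x : ℝ) :
    ∃! j : ℤ, x + 2 * Real.pi * (j : ℝ) ∈ ⋃ a : ZMod S, gridCell S a := by
  have hS : (0 : ℝ) < S := Nat.cast_pos.mpr (NeZero.pos S)
  have hp : 0 < 2 * Real.pi / S := by positivity
  have hSp : (S : ℝ) * (2 * Real.pi / S) = 2 * Real.pi := by field_simp
  have key : ∀ j : ℤ, ∀ a : ZMod S, x + 2 * Real.pi * (j : ℝ) ∈ gridCell S a ↔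
      x + (S * j - a.valMinAbs) • (2 * Real.pi / S) ∈
        Set.Ioc (-(Real.pi / S)) (-(Real.pi / S) + 2 * Real.pi / S) := by
    intro j a
    rw [mem_gridCell_iff]
    have : x + 2 * Real.pi * (j : ℝ) + -(a.valMinAbs) • (2 * Real.pi / S)
        = x + (S * j - a.valMinAbs) • (2 * Real.pi / S) := by
      rw [zsmul_eq_mul, zsmul_eq_mul]; push_cast; linear_combination -(j : ℝ) * hSp
    rw [this]
  obtain ⟨N, hN, huniq⟩ := existsUnique_add_zsmul_mem_Ioc hp x (-(Real.pi / S))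
  have hdvd : (S : ℤ) ∣ N + ((-N : ℤ) : ZMod S).valMinAbs := by
    rw [← ZMod.intCast_zmod_eq_zero_iff_dvd]
    push_cast [ZMod.coe_valMinAbs]
    simp
  obtain ⟨j, hj⟩ := hdvd
  refine ⟨j, ?_, ?_⟩
  · refine Set.mem_iUnion.mpr ⟨((-N : ℤ) : ZMod S), ?_⟩
    rw [key, ← hj, add_sub_cancel_right]
    exact hN
  · intro j' hj'
    obtain ⟨a, ha⟩ := Set.mem_iUnion.mp hj'
    rw [key] at ha
    have hN' := huniq _ ha
    have ha' : ((-N : ℤ) : ZMod S) = a := by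
      rw [← hN']
      push_cast [ZMod.coe_valMinAbs]
      simp
    rw [ha', ← hN', sub_add_cancel] at hj
    exact mul_left_cancel₀ (by exact_mod_cast NeZero.ne S) hj

lemma gridCell_disjoint {S : ℕ} [NeZero S] : Pairwise (Function.onFun Disjoint (gridCell S)) := by
  intro a b hab
  rw [Function.onFun, Set.disjoint_left]
  intro x ha hb
  have hS : (0 : ℝ) < S := Nat.cast_pos.mpr (NeZero.pos S)
  rw [mem_gridCell_iff] at ha hb
  have := (existsUnique_add_zsmul_mem_Ioc (show 0 < 2 * Real.pi / S by positivity) x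
    (-(Real.pi / S))).unique ha hb
  exact hab (ZMod.injective_valMinAbs (neg_injective this))

/-- The lattice `2πℤ³`. -/
def momentumLattice : AddSubgroup (Fin 3 → ℝ) :=
  AddMonoidHom.range
    { toFun := fun (j : Fin 3 → ℤ) i => 2 * Real.pi * (j i : ℝ)
      map_zero' := by ext; simp
      map_add' := fun j j' => by ext; simp [mul_add] }

lemma mem_momentumLattice (j : Fin 3 → ℤ) : (fun i => 2 * Real.pi * (j i : ℝ)) ∈ momentumLattice :=
  ⟨j, rfl⟩

instance : Countable momentumLattice :=
  (Set.countable_range _).to_subtype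

/-- The union of the cells of the spatial momentum grid is a fundamental domain for `2πℤ³`. -/
lemma isAddFundamentalDomain_grid (S : ℕ) [NeZero S] :
    IsAddFundamentalDomain momentumLattice
      (Set.univ.pi fun _ : Fin 3 => ⋃ a : ZMod S, gridCell S a) volume := by
  refine IsAddFundamentalDomain.mk' ?_ fun x => ?_
  · exact (MeasurableSet.univ_pi fun _ => MeasurableSet.iUnion fun _ =>
      measurableSet_Ioc).nullMeasurableSet
  · choose j hj huniq using fun i => existsUnique_mem_gridCell (S := S) (x i)
    refine ⟨⟨_, mem_momentumLattice j⟩, ?_, ?_⟩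
    · intro i _
      have := hj i
      simp only [AddSubgroup.vadd_def, vadd_eq_add, Pi.add_apply]
      rwa [add_comm]
    · rintro ⟨_, j', rfl⟩ h
      have : j' = j := by
        funext i
        refine huniq i _ ?_
        have := h i (Set.mem_univ i)
        simp only [AddSubgroup.vadd_def, vadd_eq_add, Pi.add_apply] at this
        rwa [add_comm] at this
      subst this
      rfl

lemma momentumCell_eq : momentumCell = Set.univ.pi fun _ : Fin 3 => ⋃ a : ZMod 1, gridCell 1 a := by
  have : ⋃ a : ZMod 1, gridCell 1 a = Set.Ioc (-Real.pi) Real.pi := by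
    have h : ∀ a : ZMod 1, gridCell 1 a = Set.Ioc (-Real.pi) Real.pi := by
      intro a
      rw [Subsingleton.elim a 0]
      simp [gridCell]
    simp only [h, Set.iUnion_const]
  rw [momentumCell, this]

/-- A periodic function over the momentum torus, as a sum of integrals over the cells centred at the
momenta of the finite lattice. -/
lemma integral_momentumCell_eq_sum {S : ℕ} [NeZero S] {f : (Fin 3 → ℝ) → ℂ}
    (hf : ∀ k (j : Fin 3 → ℤ), f (fun i => k i + 2 * Real.pi * (j i : ℝ)) = f k)
    (hint : IntegrableOn f momentumCell) :
    (∀ q : Fin 3 → ZMod S, IntegrableOn (fun u => f (momentum q + u))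
      (Metric.closedBall 0 (Real.pi / S))) ∧
    ∫ k in momentumCell, f k
      = ∑ q : Fin 3 → ZMod S, ∫ u in Metric.closedBall 0 (Real.pi / S), f (momentum q + u) := by
  have hinv : ∀ (g : momentumLattice) (x : Fin 3 → ℝ), f (g +ᵥ x) = f x := by
    rintro ⟨_, j, rfl⟩ x
    rw [← hf x j]
    congr 1
    funext i
    simp only [AddSubgroup.vadd_def, vadd_eq_add, Pi.add_apply]
    exact add_comm _ _
  have h1 := isAddFundamentalDomain_grid 1
  have hS := isAddFundamentalDomain_grid S
  have hS0 : (0 : ℝ) < S := Nat.cast_pos.mpr (NeZero.pos S)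
  rw [momentumCell_eq] at hint ⊢
  rw [h1.integrableOn_iff hS hinv] at hint
  rw [h1.setIntegral_eq hS hinv]
  rw [← Set.iUnion_univ_pi] at hint ⊢
  have hball : ∀ q : Fin 3 → ZMod S, (Set.univ.pi fun i => gridCell S (q i))
      =ᵐ[volume] Metric.closedBall (momentum q) (Real.pi / S) := by
    intro q
    have h2 : Metric.closedBall (momentum q) (Real.pi / S)
        = Set.Icc (fun i => momentum q i - Real.pi / S) (fun i => momentum q i + Real.pi / S) := by
      rw [closedBall_pi _ (by positivity), ← Set.pi_univ_Icc]
      simp only [Real.closedBall_eq_Icc]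
    rw [h2]
    exact Measure.univ_pi_Ioc_ae_eq_Icc
  have hpre : ∀ q : Fin 3 → ZMod S, (fun u => momentum q + u) ⁻¹'
      Metric.closedBall (momentum q) (Real.pi / S) = Metric.closedBall 0 (Real.pi / S) := by
    intro q
    ext u
    simp [dist_eq_norm]
  have hq : ∀ q : Fin 3 → ZMod S, IntegrableOn f (Set.univ.pi fun i => gridCell S (q i)) :=
    fun q => hint.mono_set (Set.subset_iUnion (fun q : Fin 3 → ZMod S =>
      Set.univ.pi fun i => gridCell S (q i)) q)
  refine ⟨fun q => ?_, ?_⟩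
  · have h2 := (hq q).congr_set_ae (hball q).symm
    rw [← (measurePreserving_add_left volume (momentum q)).integrableOn_comp_preimage
      (measurableEmbedding_addLeft _), hpre] at h2
    exact h2
  · rw [integral_iUnion_fintype _ _ hq]
    · refine Finset.sum_congr rfl fun q _ => ?_
      rw [setIntegral_congr_set (hball q), ← hpre q]
      exact ((measurePreserving_add_left volume (momentum q)).setIntegral_preimage_emb
        (measurableEmbedding_addLeft _) f _).symm
    · exact fun q => MeasurableSet.univ_pi fun i => measurableSet_Ioc
    · intro q q' hqq
      obtain ⟨i, hi⟩ := Function.ne_iff.mp hqq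
      exact Set.disjoint_univ_pi.mpr ⟨i, gridCell_disjoint hi⟩

/-- The midpoint rule: the linear term drops out by symmetry. -/
lemma norm_integral_closedBall_sub_le {r E : ℝ} {f : (Fin 3 → ℝ) → ℂ} (hr : 0 ≤ r)
    (hf : IntegrableOn f (Metric.closedBall 0 r)) (z : ℂ)
    (hE : ∀ u ∈ Metric.closedBall (0 : Fin 3 → ℝ) r, ‖f u + f (-u) - 2 * z‖ ≤ E) :
    ‖(∫ u in Metric.closedBall 0 r, f u) - ((2 * r) ^ 3 : ℝ) * z‖ ≤ (2 * r) ^ 3 * (E / 2) := by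
  have hvol : volume.real (Metric.closedBall (0 : Fin 3 → ℝ) r) = (2 * r) ^ 3 := by
    rw [Measure.real, Real.volume_pi_closedBall _ hr, ENNReal.toReal_ofReal (by positivity)]
    simp
  have hpre : (fun u : Fin 3 → ℝ => -u) ⁻¹' Metric.closedBall 0 r = Metric.closedBall 0 r := by
    ext u; simp
  have hme : MeasurableEmbedding fun u : Fin 3 → ℝ => -u :=
    (MeasurableEquiv.neg _).measurableEmbedding
  have hmp := Measure.measurePreserving_neg (volume : Measure (Fin 3 → ℝ))
  have hneg : ∫ u in Metric.closedBall 0 r, f (-u) = ∫ u in Metric.closedBall 0 r, f u := by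
    have := hmp.setIntegral_preimage_emb hme f (Metric.closedBall 0 r)
    rwa [hpre] at this
  have hnegint : IntegrableOn (fun u => f (-u)) (Metric.closedBall 0 r) := by
    have := hf
    rw [← hmp.integrableOn_comp_preimage hme, hpre] at this
    exact this
  have hfin : volume (Metric.closedBall (0 : Fin 3 → ℝ) r) ≠ ⊤ := measure_closedBall_lt_top.ne
  have hkey : ∫ u in Metric.closedBall 0 r, (f u + f (-u) - 2 * z)
      = 2 * ((∫ u in Metric.closedBall 0 r, f u) - ((2 * r) ^ 3 : ℝ) * z) := by
    rw [integral_sub (f := fun u => f u + f (-u)) (hf.add hnegint) (integrableOn_const hfin),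
      integral_add hf hnegint, hneg, setIntegral_const, hvol, Complex.real_smul]
    ring
  have hnorm := norm_setIntegral_le_of_norm_le_const (lt_top_iff_ne_top.mpr hfin) hE
  rw [hkey, norm_mul, Complex.norm_ofNat, hvol] at hnorm
  linarith

/-! ### The momentum integral and the momentum sum -/

section

variable {T : ℕ} [NeZero T] {κ M : ℝ} {ε : (Fin 3 → ℝ) → ℝ}

/-- `∫ dk / |k|²` over the momentum torus. -/
def momentumIntegral : ℝ := ∫ k in Metric.closedBall (0 : Fin 3 → ℝ) Real.pi, 1 / ‖k‖ ^ 2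

lemma momentumIntegral_nonneg : 0 ≤ momentumIntegral :=
  integral_nonneg fun k => by positivity

lemma momentumCell_ae_eq : momentumCell =ᵐ[volume] Metric.closedBall (0 : Fin 3 → ℝ) Real.pi := by
  have h : Metric.closedBall (0 : Fin 3 → ℝ) Real.pi
      = Set.Icc (fun _ => -Real.pi) (fun _ => Real.pi) := by
    rw [closedBall_pi _ Real.pi_pos.le, ← Set.pi_univ_Icc]
    simp [Real.closedBall_eq_Icc]
  rw [h]
  exact Measure.univ_pi_Ioc_ae_eq_Icc

lemma ae_ne_zero : ∀ᵐ k : Fin 3 → ℝ, k ≠ 0 := Measure.ae_ne volume 0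

lemma DispersionBounds.propWave_periodic (hε : DispersionBounds κ M ε) (l : ZMod T)
    (y : Fin 3 → ℤ) (k : Fin 3 → ℝ) (j : Fin 3 → ℤ) :
    propWave ε l y (fun i => k i + 2 * Real.pi * (j i : ℝ)) = propWave ε l y k := by
  have h : Complex.exp (Complex.I * (phase (fun i => k i + 2 * Real.pi * (j i : ℝ)) y : ℂ))
      = Complex.exp (Complex.I * (phase k y : ℂ)) := by
    rw [phase_periodic, Complex.exp_eq_exp_iff_exists_int]
    exact ⟨∑ i, j i * y i, by push_cast; ring⟩
  rw [propWave, propWave, propDenom, propDenom, hε.periodic, h]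

lemma DispersionBounds.measurable_propWave (hε : DispersionBounds κ M ε) (l : ZMod T)
    (y : Fin 3 → ℤ) : Measurable (propWave ε l y) := by
  have h1 : Continuous (propDenom ε l) := by
    have := hε.continuous
    unfold propDenom
    fun_prop
  have h2 : Continuous fun k => Complex.exp (Complex.I * (phase k y : ℂ)) := by
    unfold phase
    fun_prop
  exact h1.measurable.inv.mul h2.measurable

lemma norm_propWave (l : ZMod T) (y : Fin 3 → ℤ) (k : Fin 3 → ℝ) :
    ‖propWave ε l y k‖ = ‖propDenom ε l k‖⁻¹ := by
  rw [propWave, norm_mul, norm_inv, mul_comm Complex.I, Complex.norm_exp_ofReal_mul_I, mul_one]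

lemma DispersionBounds.norm_propWave_le (hε : DispersionBounds κ M ε) (hκ : 0 < κ) (l : ZMod T)
    (y : Fin 3 → ℤ) {k : Fin 3 → ℝ} (hk : ‖k‖ ≤ Real.pi) (hk0 : k ≠ 0) :
    ‖propWave ε l y k‖ ≤ 1 / gapConst κ M * (1 / ‖k‖ ^ 2) := by
  have hc := hε.gapConst_pos hκ
  have hk1 : 0 < ‖k‖ := norm_pos_iff.mpr hk0
  have h := hε.gap l (show ‖k‖ ≤ 3 * Real.pi / 2 by linarith [Real.pi_pos])
  rw [norm_propWave, ← one_div, one_div_mul_one_div]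
  refine one_div_le_one_div_of_le (by positivity) (le_trans ?_ h)
  exact mul_le_mul_of_nonneg_left (by linarith [freq_nonneg l]) hc.le

lemma DispersionBounds.integrableOn_propWave (hε : DispersionBounds κ M ε) (hκ : 0 < κ)
    (l : ZMod T) (y : Fin 3 → ℤ) : IntegrableOn (propWave ε l y) momentumCell := by
  refine IntegrableOn.congr_set_ae ?_ momentumCell_ae_eq
  refine ((integrableOn_inv_norm_sq Real.pi Real.pi_pos.le).const_mul (1 / gapConst κ M)).mono'
    (hε.measurable_propWave l y).aestronglyMeasurable ?_
  filter_upwards [ae_restrict_mem Metric.isClosed_closedBall.measurableSet,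
    ae_restrict_of_ae ae_ne_zero] with k hk hk0
  exact hε.norm_propWave_le hκ l y (by simpa using hk) hk0

lemma DispersionBounds.norm_integral_propWave_le (hε : DispersionBounds κ M ε) (hκ : 0 < κ)
    (l : ZMod T) (y : Fin 3 → ℤ) :
    ‖∫ k in momentumCell, propWave ε l y k‖ ≤ 1 / gapConst κ M * momentumIntegral := by
  rw [setIntegral_congr_set momentumCell_ae_eq, momentumIntegral, ← integral_const_mul]
  refine norm_integral_le_of_norm_le
    ((integrableOn_inv_norm_sq Real.pi Real.pi_pos.le).const_mul (1 / gapConst κ M)) ?_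
  filter_upwards [ae_restrict_mem Metric.isClosed_closedBall.measurableSet,
    ae_restrict_of_ae ae_ne_zero] with k hk hk0
  exact hε.norm_propWave_le hκ l y (by simpa using hk) hk0

/-- The temporal sum of the propagator: a geometric series, of which the Fourier transform picks out
a single term. -/
lemma norm_sum_stdAddChar_mul_inv_le (t : ZMod T) {x : ℝ} (hx : 0 < x) :
    ‖(1 / (T : ℂ)) * ∑ l : ZMod T, ZMod.stdAddChar (l * t) *
      (1 - (Real.exp (-x) : ℂ) * ZMod.stdAddChar l)⁻¹‖ ≤ 1 + 1 / (T * x) := by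
  have hT : (0 : ℝ) < T := by exact_mod_cast NeZero.pos T
  have hTc : (T : ℂ) ≠ 0 := by exact_mod_cast NeZero.ne T
  set ρ := Real.exp (-x) with hρ
  have hρ0 : 0 < ρ := Real.exp_pos _
  have hρ1 : ρ < 1 := by rw [hρ, Real.exp_lt_one_iff]; linarith
  have hρT : ρ ^ T < 1 := pow_lt_one₀ hρ0.le hρ1 (NeZero.ne T)
  -- finite geometric series, as the character has order dividing `T`
  have hgeom : ∀ l : ZMod T, (1 - (ρ : ℂ) * ZMod.stdAddChar l)⁻¹
      = (1 - (ρ : ℂ) ^ T)⁻¹ *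
        ∑ j ∈ Finset.range T, (ρ : ℂ) ^ j * ZMod.stdAddChar (l * (j : ZMod T)) := by
    intro l
    have h1 : ∀ j : ℕ, (ZMod.stdAddChar (l * (j : ZMod T)) : ℂ) = ZMod.stdAddChar l ^ j := by
      intro j
      rw [mul_comm, ← nsmul_eq_mul, AddChar.map_nsmul_eq_pow]
    have h2 : ((ZMod.stdAddChar l : ℂ)) ^ T = 1 := by
      rw [← h1]; simp
    have h3 : (1 - (ρ : ℂ) ^ T) ≠ 0 := by
      have : ((1 - ρ ^ T : ℝ) : ℂ) ≠ 0 := Complex.ofReal_ne_zero.mpr (by linarith)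
      push_cast at this
      exact this
    have h4 : (1 - (ρ : ℂ) * ZMod.stdAddChar l)
        * ∑ j ∈ Finset.range T, (ρ : ℂ) ^ j * ZMod.stdAddChar (l * (j : ZMod T))
        = 1 - (ρ : ℂ) ^ T := by
      simp only [h1, ← mul_pow]
      rw [mul_neg_geom_sum, mul_pow, h2, mul_one]
    have h5 : (1 - (ρ : ℂ) * ZMod.stdAddChar l) ≠ 0 := by
      intro h; rw [h, zero_mul] at h4; exact h3 h4.symm
    rw [← h4]
    field_simp
    rw [div_self]
    intro h; rw [h, mul_zero] at h4; exact h3 h4.symm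
  have hsum : ∑ l : ZMod T, ZMod.stdAddChar (l * t) * (1 - (ρ : ℂ) * ZMod.stdAddChar l)⁻¹
      = (1 - (ρ : ℂ) ^ T)⁻¹ * ∑ j ∈ Finset.range T, (ρ : ℂ) ^ j *
        (if t + (j : ZMod T) = 0 then (T : ℂ) else 0) := by
    simp only [hgeom, ← sum_stdAddChar_mul, Finset.mul_sum]
    rw [Finset.sum_comm]
    refine Finset.sum_congr rfl fun j _ => Finset.sum_congr rfl fun l _ => ?_
    rw [mul_add, AddChar.map_add_eq_mul]
    ring
  -- only the term with `j = -t` is different from zero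
  have hone : ‖∑ j ∈ Finset.range T, (ρ : ℂ) ^ j * (if t + (j : ZMod T) = 0 then (T : ℂ) else 0)‖
      ≤ T := by
    rw [Finset.sum_eq_single (-t).val]
    · rw [norm_mul, norm_pow, Complex.norm_real, Real.norm_of_nonneg hρ0.le]
      refine (mul_le_of_le_one_left (norm_nonneg _) (pow_le_one₀ hρ0.le hρ1.le)).trans ?_
      split_ifs <;> simp
    · intro j hj hne
      rw [if_neg, mul_zero]
      intro h
      refine hne ?_
      rw [← eq_neg_of_add_eq_zero_right h, ZMod.val_natCast_of_lt (Finset.mem_range.mp hj)]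
    · intro h
      exact absurd (Finset.mem_range.mpr (ZMod.val_lt _)) h
  rw [hsum, norm_mul, norm_mul, norm_div, norm_one, Complex.norm_natCast, norm_inv]
  have hn : ‖1 - (ρ : ℂ) ^ T‖ = 1 - ρ ^ T := by
    rw [← Complex.ofReal_pow, ← Complex.ofReal_one, ← Complex.ofReal_sub, Complex.norm_real,
      Real.norm_of_nonneg (by linarith)]
  have hlow := div_one_add_le_one_sub_exp_neg (show (0 : ℝ) ≤ T * x by positivity)
  have hexp : ρ ^ T = Real.exp (-(T * x)) := by
    rw [hρ, ← Real.exp_nat_mul]; ring_nf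
  rw [← hexp] at hlow
  calc 1 / (T : ℝ) * (‖1 - (ρ : ℂ) ^ T‖⁻¹ * _) ≤ 1 / (T : ℝ) * (‖1 - (ρ : ℂ) ^ T‖⁻¹ * T) := by
        gcongr
    _ = 1 / (1 - ρ ^ T) := by rw [hn]; field_simp
    _ ≤ 1 / (T * x / (1 + T * x)) := one_div_le_one_div_of_le (by positivity) hlow
    _ = _ := by field_simp; ring

/-- The inverse of `D₀` in infinite volume, as an average of integrals of propagators. -/
def waveInv (ε : (Fin 3 → ℝ) → ℝ) (x : BoldLat T) : ℂ :=
  (1 / (T : ℂ)) * ∑ l : ZMod T, ZMod.stdAddChar (l * x.1) *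
    ((1 / ((2 * Real.pi) ^ 3 : ℝ) : ℂ) * ∫ k in momentumCell, propWave ε l x.2 k)

lemma DispersionBounds.norm_waveInv_le (hε : DispersionBounds κ M ε) (hκ : 0 < κ) (x : BoldLat T) :
    ‖waveInv ε x‖ ≤ 1 / (2 * Real.pi) ^ 3 * (1 / gapConst κ M * momentumIntegral) := by
  have hT : (0 : ℝ) < T := by exact_mod_cast NeZero.pos T
  have hpi := Real.pi_pos
  rw [waveInv, norm_mul, norm_div, norm_one, Complex.norm_natCast]
  have h : ∀ l : ZMod T, ‖ZMod.stdAddChar (l * x.1) *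
      ((1 / ((2 * Real.pi) ^ 3 : ℝ) : ℂ) * ∫ k in momentumCell, propWave ε l x.2 k)‖
      ≤ 1 / (2 * Real.pi) ^ 3 * (1 / gapConst κ M * momentumIntegral) := by
    intro l
    rw [norm_mul, norm_stdAddChar, one_mul, norm_mul, norm_div, norm_one, Complex.norm_real,
      Real.norm_of_nonneg (by positivity)]
    exact mul_le_mul_of_nonneg_left (hε.norm_integral_propWave_le hκ l x.2) (by positivity)
  calc _ ≤ 1 / (T : ℝ) * ∑ _l : ZMod T,
        1 / (2 * Real.pi) ^ 3 * (1 / gapConst κ M * momentumIntegral) :=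
        mul_le_mul_of_nonneg_left (norm_sum_le_of_le _ fun l _ => h l) (by positivity)
    _ = _ := by
        rw [Finset.sum_const, Finset.card_univ, ZMod.card, nsmul_eq_mul]
        field_simp

end

/-! ### The propagator of the model -/

section

variable {T : ℕ} [NeZero T] {m cH DH : ℝ} {H : Fin 3 → Fin 3 → (Fin 3 → ℤ) → ℝ}

lemma IsBondOperator.boldDInvIntegrand_eq (h : IsBondOperator m cH DH H) (hm : 0 < m)
    (x : BoldLat T) (l : Fin T) (k : Fin 3 → ℝ) :
    boldDInvIntegrand H T x l k = ZMod.stdAddChar (((l : ℕ) : ZMod T) * x.1) *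
      propWave (dispersion H) ((l : ℕ) : ZMod T) x.2 k := by
  have h1 : ∀ j : ℕ, (ZMod.stdAddChar (j : ZMod T) : ℂ)
      = Complex.exp (Complex.I * ((2 * Real.pi * j / T : ℝ) : ℂ)) := by
    intro j
    have := ZMod.stdAddChar_coe (N := T) (j : ℤ)
    rw [Int.cast_natCast] at this
    rw [this]
    push_cast
    ring_nf
  have h2 : boldDSymbol H (2 * Real.pi * (l : ℕ) / T) k
      = propDenom (dispersion H) ((l : ℕ) : ZMod T) k := by
    rw [boldDSymbol, propDenom, h.kineticSymbol_eq hm, h1]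
    push_cast
    ring
  have h3 : (ZMod.stdAddChar (((l : ℕ) : ZMod T) * x.1) : ℂ)
      = Complex.exp (Complex.I * ((2 * Real.pi * (l : ℕ) / T * (x.1.val : ℝ) : ℝ) : ℂ)) := by
    have := h1 ((l : ℕ) * x.1.val)
    rw [Nat.cast_mul, ZMod.natCast_zmod_val] at this
    rw [this]
    push_cast
    ring_nf
  rw [boldDInvIntegrand, h2, h3, propWave]
  push_cast
  rw [mul_add, Complex.exp_add]
  ring

lemma IsBondOperator.integrableOn_boldDInvIntegrand (h : IsBondOperator m cH DH H) (hm : 0 < m)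
    (hcH : 0 < cH) (x : BoldLat T) (l : Fin T) :
    IntegrableOn (boldDInvIntegrand H T x l) momentumCell := by
  rw [funext (h.boldDInvIntegrand_eq hm x l)]
  exact ((h.dispersionBounds hm hcH).integrableOn_propWave (by positivity) _ _).const_mul _

lemma IsBondOperator.boldDInv_eq (h : IsBondOperator m cH DH H) (hm : 0 < m) (x : BoldLat T) :
    boldDInv H T x = waveInv (dispersion H) x := by
  have hbij : Function.Bijective fun l : Fin T => ((l : ℕ) : ZMod T) := by
    refine ⟨fun l l' hl => ?_, fun a => ⟨⟨a.val, ZMod.val_lt a⟩, by simp⟩⟩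
    have := congrArg ZMod.val hl
    simp only [ZMod.val_natCast_of_lt l.2, ZMod.val_natCast_of_lt l'.2] at this
    exact Fin.ext this
  rw [boldDInv, waveInv]
  congr 1
  refine Fintype.sum_bijective _ hbij _ _ fun l => ?_
  simp only [h.boldDInvIntegrand_eq hm]
  rw [integral_const_mul]
  ring

end

/-! ### The midpoint rule on the momentum torus -/

section

variable {T S : ℕ} [NeZero T] [NeZero S] {κ M : ℝ} {ε : (Fin 3 → ℝ) → ℝ}

/-- The character of the torus at a point of `(ℤ / T ℤ) × ℤ³`. -/
lemma char_proj (p : Lat T S) (y : BoldLat T) : p.char (y.proj S)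
    = ZMod.stdAddChar (p.1 * y.1) * Complex.exp (Complex.I * (phase (momentum p.2) y.2 : ℂ)) := by
  rw [Lat.char, BoldLat.proj, prod_stdAddChar_intCast]

/-- The cell around the origin contributes little, although the propagator is singular there. -/
lemma DispersionBounds.norm_zero_cell_le (hε : DispersionBounds κ M ε) (hκ : 0 < κ)
    (y : BoldLat T) :
    ‖(1 / (T : ℂ)) * ∑ l : ZMod T, ZMod.stdAddChar (l * y.1) *
      ((1 / ((2 * Real.pi) ^ 3 : ℝ) : ℂ) *
        ∫ u in Metric.closedBall 0 (Real.pi / S), propWave ε l y.2 u)‖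
      ≤ 1 / (S : ℝ) ^ 3 + momentumIntegral / (2 * Real.pi) ^ 3 / (κ * T) := by
  have hpi := Real.pi_pos
  have hT : (0 : ℝ) < T := by exact_mod_cast NeZero.pos T
  have hS : (1 : ℝ) ≤ S := by exact_mod_cast NeZero.one_le
  have hr : Real.pi / S ≤ Real.pi := div_le_self hpi.le hS
  have hsub : Metric.closedBall (0 : Fin 3 → ℝ) (Real.pi / S) ⊆ Metric.closedBall 0 Real.pi :=
    Metric.closedBall_subset_closedBall hr
  have hint : ∀ l : ZMod T, IntegrableOn (propWave ε l y.2)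
      (Metric.closedBall 0 (Real.pi / S)) := fun l =>
    ((hε.integrableOn_propWave hκ l y.2).congr_set_ae momentumCell_ae_eq.symm).mono_set hsub
  -- the sum over frequencies is performed first, which softens the singularity to `1 / (T ‖u‖²)`
  have hswap : (1 / (T : ℂ)) * ∑ l : ZMod T, ZMod.stdAddChar (l * y.1) *
      ((1 / ((2 * Real.pi) ^ 3 : ℝ) : ℂ) *
        ∫ u in Metric.closedBall 0 (Real.pi / S), propWave ε l y.2 u)
      = (1 / ((2 * Real.pi) ^ 3 : ℝ) : ℂ) * ∫ u in Metric.closedBall 0 (Real.pi / S),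
        (1 / (T : ℂ)) * ∑ l : ZMod T, ZMod.stdAddChar (l * y.1) * propWave ε l y.2 u := by
    rw [integral_const_mul, integral_finsetSum _ fun l _ => (hint l).const_mul _]
    simp only [integral_const_mul, Finset.mul_sum]
    refine Finset.sum_congr rfl fun l _ => ?_
    ring
  have hpt : ∀ u : Fin 3 → ℝ, ‖u‖ ≤ Real.pi → u ≠ 0 →
      ‖(1 / (T : ℂ)) * ∑ l : ZMod T, ZMod.stdAddChar (l * y.1) * propWave ε l y.2 u‖
        ≤ 1 + 1 / (κ * T) * (1 / ‖u‖ ^ 2) := by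
    intro u hu hu0
    have hu1 : 0 < ‖u‖ := norm_pos_iff.mpr hu0
    have hlow := hε.lower u (by linarith)
    have hε0 : 0 < ε u := lt_of_lt_of_le (by positivity) hlow
    have h1 : (1 / (T : ℂ)) * ∑ l : ZMod T, ZMod.stdAddChar (l * y.1) * propWave ε l y.2 u
        = ((1 / (T : ℂ)) * ∑ l : ZMod T, ZMod.stdAddChar (l * y.1) *
          (1 - (Real.exp (-ε u) : ℂ) * ZMod.stdAddChar l)⁻¹)
          * Complex.exp (Complex.I * (phase u y.2 : ℂ)) := by
      rw [mul_assoc, Finset.sum_mul]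
      simp only [propWave, propDenom, mul_assoc]
    rw [h1, norm_mul, mul_comm Complex.I, Complex.norm_exp_ofReal_mul_I, mul_one]
    refine (norm_sum_stdAddChar_mul_inv_le y.1 hε0).trans ?_
    rw [one_div_mul_one_div]
    have : 1 / (T * ε u) ≤ 1 / (κ * T * ‖u‖ ^ 2) :=
      one_div_le_one_div_of_le (by positivity) (by nlinarith)
    linarith
  have hball : volume.real (Metric.closedBall (0 : Fin 3 → ℝ) (Real.pi / S))
      = (2 * (Real.pi / S)) ^ 3 := by
    rw [Measure.real, Real.volume_pi_closedBall _ (by positivity),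
      ENNReal.toReal_ofReal (by positivity)]
    simp
  have hI := integrableOn_inv_norm_sq Real.pi hpi.le
  have hfin : volume (Metric.closedBall (0 : Fin 3 → ℝ) (Real.pi / S)) ≠ ⊤ :=
    measure_closedBall_lt_top.ne
  have hc : IntegrableOn (fun _ : Fin 3 → ℝ => (1 : ℝ)) (Metric.closedBall 0 (Real.pi / S)) :=
    integrableOn_const hfin
  have hIs := (hI.mono_set hsub).const_mul (1 / (κ * T))
  have hmono : ∫ u in Metric.closedBall (0 : Fin 3 → ℝ) (Real.pi / S), 1 / ‖u‖ ^ 2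
      ≤ momentumIntegral :=
    setIntegral_mono_set hI (ae_of_all _ fun u => by positivity) hsub.eventuallyLE
  rw [hswap, norm_mul, norm_div, norm_one, Complex.norm_real, Real.norm_of_nonneg (by positivity)]
  have hmain : ‖∫ u in Metric.closedBall 0 (Real.pi / S),
        (1 / (T : ℂ)) * ∑ l : ZMod T, ZMod.stdAddChar (l * y.1) * propWave ε l y.2 u‖
      ≤ (2 * (Real.pi / S)) ^ 3 + 1 / (κ * T) * momentumIntegral := by
    refine (norm_integral_le_of_norm_le (hc.add hIs) ?_).trans ?_
    · filter_upwards [ae_restrict_mem Metric.isClosed_closedBall.measurableSet,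
        ae_restrict_of_ae ae_ne_zero] with u hu hu0
      exact hpt u ((by simpa using hu : ‖u‖ ≤ Real.pi / S).trans hr) hu0
    · simp only [Pi.add_apply]
      rw [integral_add hc hIs, setIntegral_const, hball, integral_const_mul, smul_eq_mul, mul_one]
      gcongr
  calc _ ≤ 1 / (2 * Real.pi) ^ 3 * ((2 * (Real.pi / S)) ^ 3 + 1 / (κ * T) * momentumIntegral) := by
        gcongr
    _ = _ := by field_simp

/-- The bound on the difference between the momentum sum without the spatial zero modes and the
momentum integral. -/
def riemannConst (κ M : ℝ) : ℝ :=
  343 * secondDiffConst κ M * 11 + 1 + momentumIntegral / (2 * Real.pi) ^ 3 / κ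

/-- The momentum sum over the finite torus, without the spatially constant modes, approximates the
infinite volume propagator. The midpoint rule is applied in each cell of the momentum grid. -/
lemma DispersionBounds.norm_sum_char_div_sub_waveInv_le (hε : DispersionBounds κ M ε) (hκ : 0 < κ)
    (y : BoldLat T) :
    ‖(1 / ((T : ℂ) * (S : ℂ) ^ 3)) * ∑ q ∈ Finset.univ.erase (0 : Fin 3 → ZMod S), ∑ l : ZMod T,
      Lat.char ((l, q) : Lat T S) (y.proj S) / dSymbol ε ((l, q) : Lat T S) - waveInv ε y‖
      ≤ riemannConst κ M * (1 + oneLength y.2) ^ 2 * (1 / (S : ℝ) ^ 2 + 1 / T) := by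
  have hpi := Real.pi_pos
  have hT : (0 : ℝ) < T := by exact_mod_cast NeZero.pos T
  have hS : (1 : ℝ) ≤ S := by exact_mod_cast NeZero.one_le
  have hTc : (T : ℂ) ≠ 0 := by exact_mod_cast NeZero.ne T
  have hSc : (S : ℂ) ≠ 0 := by exact_mod_cast NeZero.ne S
  have hY := oneLength_nonneg y.2
  have hC : 0 ≤ secondDiffConst κ M := by
    have := hε.M_nonneg
    have := hε.gapConst_pos hκ
    unfold secondDiffConst
    positivity
  set C := secondDiffConst κ M * (1 + oneLength y.2) ^ 2 with hCdef
  have hC0 : 0 ≤ C := by positivity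
  -- the error of the midpoint rule in a cell
  set err : ZMod T → (Fin 3 → ZMod S) → ℂ := fun l q =>
    (1 / ((2 * Real.pi) ^ 3 : ℝ) : ℂ) *
      (∫ u in Metric.closedBall 0 (Real.pi / S), propWave ε l y.2 (momentum q + u))
      - (1 / (S : ℂ) ^ 3) * propWave ε l y.2 (momentum q) with herr
  have hcell := fun l : ZMod T => integral_momentumCell_eq_sum (S := S)
    (hε.propWave_periodic l y.2) (hε.integrableOn_propWave hκ l y.2)
  have hchar : ∀ l q, Lat.char ((l, q) : Lat T S) (y.proj S) / dSymbol ε ((l, q) : Lat T S)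
      = ZMod.stdAddChar (l * y.1) * propWave ε l y.2 (momentum q) := by
    intro l q
    rw [char_proj, dSymbol_eq, propWave]
    ring
  -- the cell at the origin has no counterpart in the sum and is split off from the integral
  have hsplit : (1 / ((T : ℂ) * (S : ℂ) ^ 3)) *
      ∑ q ∈ Finset.univ.erase (0 : Fin 3 → ZMod S), ∑ l : ZMod T,
        Lat.char ((l, q) : Lat T S) (y.proj S) / dSymbol ε ((l, q) : Lat T S) - waveInv ε y
      = -((1 / (T : ℂ)) * ∑ q ∈ Finset.univ.erase (0 : Fin 3 → ZMod S), ∑ l : ZMod T,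
          ZMod.stdAddChar (l * y.1) * err l q)
        - (1 / (T : ℂ)) * ∑ l : ZMod T, ZMod.stdAddChar (l * y.1) *
          ((1 / ((2 * Real.pi) ^ 3 : ℝ) : ℂ) *
          ∫ u in Metric.closedBall 0 (Real.pi / S), propWave ε l y.2 u) := by
    have h1 : ∀ l : ZMod T, ∫ k in momentumCell, propWave ε l y.2 k
        = (∫ u in Metric.closedBall 0 (Real.pi / S), propWave ε l y.2 u)
        + ∑ q ∈ Finset.univ.erase (0 : Fin 3 → ZMod S),
          ∫ u in Metric.closedBall 0 (Real.pi / S), propWave ε l y.2 (momentum q + u) := by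
      intro l
      rw [(hcell l).2, ← Finset.add_sum_erase _ _ (Finset.mem_univ (0 : Fin 3 → ZMod S)),
        momentum_zero]
      simp only [zero_add]
    simp only [hchar]
    rw [waveInv]
    rw [Finset.sum_comm, Finset.sum_comm (s := Finset.univ.erase (0 : Fin 3 → ZMod S))]
    simp only [h1, herr]
    rw [Finset.mul_sum, Finset.mul_sum, Finset.mul_sum, Finset.mul_sum, ← Finset.sum_neg_distrib,
      ← Finset.sum_sub_distrib, ← Finset.sum_sub_distrib]
    refine Finset.sum_congr rfl fun l _ => ?_
    simp only [mul_sub, mul_add, Finset.sum_sub_distrib, ← Finset.mul_sum]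
    field_simp
    ring
  have herrle : ∀ l, ∀ q ∈ Finset.univ.erase (0 : Fin 3 → ZMod S),
      ‖err l q‖ ≤ (1 / (S : ℝ) ^ 3) * (C * (Real.pi / S) ^ 2 / 2 *
        (1 / (‖momentum q‖ ^ 2 + freq l) ^ 2)) := by
    intro l q hq
    have hq0 := Finset.ne_of_mem_erase hq
    have hk := norm_momentum_pos hq0
    have hk2 := inv_le_norm_momentum hq0
    have hf := freq_nonneg l
    have hm := norm_integral_closedBall_sub_le (r := Real.pi / S)
      (E := C * (Real.pi / S) ^ 2 / (‖momentum q‖ ^ 2 + freq l) ^ 2) (by positivity)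
      ((hcell l).1 q) (propWave ε l y.2 (momentum q)) fun u hu => by
        have hu' : ‖u‖ ≤ Real.pi / S := by simpa using hu
        have h2 : Real.pi / S ≤ ‖momentum q‖ / 2 := by
          have : 2 * Real.pi / S = 2 * (Real.pi / S) := by ring
          linarith
        have := hε.norm_second_diff_propWave_le hκ l y.2 hk (norm_momentum_le q) (hu'.trans h2)
        rw [sub_eq_add_neg (momentum q) u] at this
        refine this.trans ?_
        rw [← hCdef]
        gcongr
    have hid : err l q = (1 / ((2 * Real.pi) ^ 3 : ℝ) : ℂ) *
        ((∫ u in Metric.closedBall 0 (Real.pi / S), propWave ε l y.2 (momentum q + u))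
          - ((2 * (Real.pi / S)) ^ 3 : ℝ) * propWave ε l y.2 (momentum q)) := by
      have hpc : (Real.pi : ℂ) ≠ 0 := Complex.ofReal_ne_zero.mpr hpi.ne'
      rw [herr]
      push_cast
      field_simp
    rw [hid, norm_mul, norm_div, norm_one, Complex.norm_real, Real.norm_of_nonneg (by positivity)]
    refine (mul_le_mul_of_nonneg_left hm (by positivity)).trans (le_of_eq ?_)
    field_simp
  -- zero frequency is treated separately: there `1 / ‖k‖⁴` is bounded by `S² / ‖k‖²`
  have hsum1 : ∀ q ∈ Finset.univ.erase (0 : Fin 3 → ZMod S),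
      (1 / (T : ℝ)) * ∑ l : ZMod T, 1 / (‖momentum q‖ ^ 2 + freq l) ^ 2
        ≤ ((S : ℝ) ^ 2 / (4 * Real.pi ^ 2 * T) + 2) * (1 / ‖momentum q‖ ^ 2) := by
    intro q hq
    have hq0 := Finset.ne_of_mem_erase hq
    have hk := norm_momentum_pos hq0
    have hk2 := inv_le_norm_momentum hq0
    have h1 := sum_inv_sq_freq_le (T := T) (x := ‖momentum q‖ ^ 2) (by positivity)
    rw [← Finset.add_sum_erase _ _ (Finset.mem_univ (0 : ZMod T)), mul_add,
      freq_eq_zero.mpr (rfl : (0 : ZMod T) = 0), add_zero]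
    have h2 : 1 / ‖momentum q‖ ^ 2 ≤ (S : ℝ) ^ 2 / (4 * Real.pi ^ 2) := by
      calc 1 / ‖momentum q‖ ^ 2 ≤ 1 / (2 * Real.pi / S) ^ 2 := by gcongr
        _ = _ := by field_simp; norm_num
    have h3 : 1 / (T : ℝ) * (1 / (‖momentum q‖ ^ 2) ^ 2)
        ≤ (S : ℝ) ^ 2 / (4 * Real.pi ^ 2 * T) * (1 / ‖momentum q‖ ^ 2) := by
      calc 1 / (T : ℝ) * (1 / (‖momentum q‖ ^ 2) ^ 2)
          = 1 / (T : ℝ) * (1 / ‖momentum q‖ ^ 2) * (1 / ‖momentum q‖ ^ 2) := by field_simp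
        _ ≤ 1 / (T : ℝ) * ((S : ℝ) ^ 2 / (4 * Real.pi ^ 2)) * (1 / ‖momentum q‖ ^ 2) := by gcongr
        _ = _ := by field_simp
    calc _ ≤ (S : ℝ) ^ 2 / (4 * Real.pi ^ 2 * T) * (1 / ‖momentum q‖ ^ 2)
          + 2 / ‖momentum q‖ ^ 2 := add_le_add h3 h1
      _ = _ := by ring
  have hfirst : ‖(1 / (T : ℂ)) * ∑ q ∈ Finset.univ.erase (0 : Fin 3 → ZMod S), ∑ l : ZMod T,
      ZMod.stdAddChar (l * y.1) * err l q‖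
      ≤ C * (Real.pi / S) ^ 2 / 2 * (((S : ℝ) ^ 2 / (4 * Real.pi ^ 2 * T) + 2) * 343) := by
    rw [norm_mul, norm_div, norm_one, Complex.norm_natCast]
    calc _ ≤ 1 / (T : ℝ) * ∑ q ∈ Finset.univ.erase (0 : Fin 3 → ZMod S), ∑ l : ZMod T,
          (1 / (S : ℝ) ^ 3) * (C * (Real.pi / S) ^ 2 / 2 *
            (1 / (‖momentum q‖ ^ 2 + freq l) ^ 2)) := by
          refine mul_le_mul_of_nonneg_left ?_ (by positivity)
          refine norm_sum_le_of_le _ fun q hq => norm_sum_le_of_le _ fun l _ => ?_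
          rw [norm_mul, norm_stdAddChar, one_mul]
          exact herrle l q hq
      _ = C * (Real.pi / S) ^ 2 / 2 * ((1 / (S : ℝ) ^ 3) *
          ∑ q ∈ Finset.univ.erase (0 : Fin 3 → ZMod S),
            (1 / (T : ℝ)) * ∑ l : ZMod T, 1 / (‖momentum q‖ ^ 2 + freq l) ^ 2) := by
          simp only [← Finset.mul_sum]
          ring
      _ ≤ C * (Real.pi / S) ^ 2 / 2 * ((1 / (S : ℝ) ^ 3) *
          ∑ q ∈ Finset.univ.erase (0 : Fin 3 → ZMod S),
            ((S : ℝ) ^ 2 / (4 * Real.pi ^ 2 * T) + 2) * (1 / ‖momentum q‖ ^ 2)) := by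
          refine mul_le_mul_of_nonneg_left ?_ (by positivity)
          exact mul_le_mul_of_nonneg_left (Finset.sum_le_sum hsum1) (by positivity)
      _ = C * (Real.pi / S) ^ 2 / 2 * (((S : ℝ) ^ 2 / (4 * Real.pi ^ 2 * T) + 2) *
          ((1 / (S : ℝ) ^ 3) *
            ∑ q ∈ Finset.univ.erase (0 : Fin 3 → ZMod S), 1 / ‖momentum q‖ ^ 2)) := by
          rw [← Finset.mul_sum]; ring
      _ ≤ _ := by
          gcongr
          exact sum_inv_norm_momentum_sq_le
  have hsecond := hε.norm_zero_cell_le (S := S) hκ y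
  rw [hsplit]
  refine (norm_sub_le _ _).trans ?_
  rw [norm_neg]
  refine (add_le_add hfirst hsecond).trans ?_
  set W := 1 / (S : ℝ) ^ 2 + 1 / T with hW
  have hW0 : 0 ≤ W := by positivity
  have hK := momentumIntegral_nonneg
  have hq1 : (1 : ℝ) ≤ (1 + oneLength y.2) ^ 2 := by nlinarith
  have e1 : C * (Real.pi / S) ^ 2 / 2 * (((S : ℝ) ^ 2 / (4 * Real.pi ^ 2 * T) + 2) * 343)
      ≤ 343 * C * 11 * W := by
    have hpi2 : Real.pi ^ 2 ≤ 10 := by nlinarith [Real.pi_lt_d2]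
    have : C * (Real.pi / S) ^ 2 / 2 * (((S : ℝ) ^ 2 / (4 * Real.pi ^ 2 * T) + 2) * 343)
        = 343 * C * (1 / 8 * (1 / T) + Real.pi ^ 2 * (1 / (S : ℝ) ^ 2)) := by
      field_simp; ring
    rw [this, mul_assoc (343 * C)]
    refine mul_le_mul_of_nonneg_left ?_ (by positivity)
    have h1 : 0 ≤ 1 / (S : ℝ) ^ 2 := by positivity
    have h2 : 0 ≤ 1 / (T : ℝ) := by positivity
    rw [hW]
    nlinarith
  have e2 : 1 / (S : ℝ) ^ 3 ≤ W := by
    have h1 : 1 / (S : ℝ) ^ 3 ≤ 1 / (S : ℝ) ^ 2 :=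
      one_div_le_one_div_of_le (by positivity) (pow_le_pow_right₀ hS (by norm_num))
    have h2 : 0 ≤ 1 / (T : ℝ) := by positivity
    linarith
  have e3 : momentumIntegral / (2 * Real.pi) ^ 3 / (κ * T)
      ≤ momentumIntegral / (2 * Real.pi) ^ 3 / κ * W := by
    have h1 : momentumIntegral / (2 * Real.pi) ^ 3 / (κ * T)
        = momentumIntegral / (2 * Real.pi) ^ 3 / κ * (1 / T) := by field_simp
    rw [h1]
    refine mul_le_mul_of_nonneg_left ?_ (by positivity)
    have h2 : 0 ≤ 1 / (S : ℝ) ^ 2 := by positivity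
    linarith
  have e4 : (1 + momentumIntegral / (2 * Real.pi) ^ 3 / κ) * W
      ≤ (1 + momentumIntegral / (2 * Real.pi) ^ 3 / κ) * W * (1 + oneLength y.2) ^ 2 :=
    le_mul_of_one_le_right (by positivity) hq1
  calc _ ≤ 343 * C * 11 * W + (W + momentumIntegral / (2 * Real.pi) ^ 3 / κ * W) := by
        linarith
    _ = 343 * C * 11 * W + (1 + momentumIntegral / (2 * Real.pi) ^ 3 / κ) * W := by ring
    _ ≤ 343 * C * 11 * W
        + (1 + momentumIntegral / (2 * Real.pi) ^ 3 / κ) * W * (1 + oneLength y.2) ^ 2 := by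
        linarith
    _ = _ := by rw [hCdef, riemannConst]; ring

end

/-! ### The Green's function on the diagonal, compared to infinite volume -/

/-- The constant in the comparison of the translation averaged Green's function with the infinite
volume propagator. -/
def greenConst (κ M a : ℝ) (r : ℕ) : ℝ :=
  zeroModeConst κ M a r * (1 + 4 / √(gapConst κ M))
    + 343 * (2 * a / gapConst κ M ^ 2 + 1 / gapConst κ M) + 2 * riemannConst κ M

section

variable {L r n T S T' S' : ℕ} [NeZero L] [NeZero T] [NeZero S] [NeZero T'] [NeZero S']
  {κ M a : ℝ} {ε : (Fin 3 → ℝ) → ℝ} {H : Fin 3 → Fin 3 → (Fin 3 → ℤ) → ℝ}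

/-- The translation average of the Green's function agrees with the infinite volume propagator up to
an error of order `L^{-2n}`, with the cell volume `L^{-4n}` taken into account. -/
lemma GreenSetup.norm_translate_average_sub_le (hg : GreenSetup κ M a ε H L r n T S T' S')
    (y : BoldLat T) :
    ‖(L : ℂ) ^ (4 * n) * ((1 / (Fintype.card (Lat T S) : ℂ)) *
        ∑ u, (greenInv H a L r n T S T' S')⁻¹ (u + y.proj S) u)
      - (L : ℂ) ^ (2 * n) * waveInv ε y‖ ≤ greenConst κ M a r * (1 + oneLength y.2) ^ 2 := by
  have hL := hg.L_pos
  have hLc : (L : ℂ) ≠ 0 := by exact_mod_cast NeZero.ne L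
  have hT : (0 : ℝ) < T := by exact_mod_cast NeZero.pos T
  have hS : (0 : ℝ) < S := by exact_mod_cast NeZero.pos S
  have hY := oneLength_nonneg y.2
  set N : ℂ := (T : ℂ) * (S : ℂ) ^ 3 with hN
  set e : ZMod T → (Fin 3 → ZMod S) → ℂ := fun l q => Lat.char ((l, q) : Lat T S) (y.proj S)
  set g : ZMod T → (Fin 3 → ZMod S) → ℂ := fun l q => greenDiag H a L r n T' S' ((l, q) : Lat T S)
  set A : ZMod T → (Fin 3 → ZMod S) → ℂ := fun l q => scaledSymbol ε L n ((l, q) : Lat T S) with hA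
  set X := Finset.univ.erase (0 : Fin 3 → ZMod S)
  -- spatially constant modes, effect of the averaging on the other modes, and Riemann sum
  have hsplit : (L : ℂ) ^ (4 * n) * ((1 / (Fintype.card (Lat T S) : ℂ)) *
        ∑ u, (greenInv H a L r n T S T' S')⁻¹ (u + y.proj S) u)
      - (L : ℂ) ^ (2 * n) * waveInv ε y
      = (L : ℂ) ^ (4 * n) * ((1 / N) * ∑ l : ZMod T, e l 0 * g l 0)
        + (L : ℂ) ^ (4 * n) * ((1 / N) * ∑ q ∈ X, ∑ l : ZMod T, e l q * (g l q - 1 / A l q))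
        + (L : ℂ) ^ (2 * n) * ((1 / N) * ∑ q ∈ X, ∑ l : ZMod T,
            e l q / dSymbol ε ((l, q) : Lat T S) - waveInv ε y) := by
    rw [average_translates_eq, Lat.card_eq, Fintype.sum_prod_type, Finset.sum_comm,
      ← Finset.add_sum_erase _ _ (Finset.mem_univ (0 : Fin 3 → ZMod S))]
    have h1 : ∑ q ∈ X, ∑ l : ZMod T, e l q * g l q
        = ∑ q ∈ X, ∑ l : ZMod T, e l q * (g l q - 1 / A l q)
          + (1 / (L : ℂ) ^ (2 * n)) * ∑ q ∈ X, ∑ l : ZMod T,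
            e l q / dSymbol ε ((l, q) : Lat T S) := by
      rw [Finset.mul_sum, ← Finset.sum_add_distrib]
      refine Finset.sum_congr rfl fun q _ => ?_
      rw [Finset.mul_sum, ← Finset.sum_add_distrib]
      refine Finset.sum_congr rfl fun l _ => ?_
      simp only [hA, scaledSymbol]
      rw [mul_sub, one_div, one_div, mul_inv]
      ring
    change (L : ℂ) ^ (4 * n) * (1 / N * (∑ l : ZMod T, e l 0 * g l 0
      + ∑ q ∈ X, ∑ l : ZMod T, e l q * g l q)) - _ = _
    rw [h1]
    have h2 : (L : ℂ) ^ (4 * n) = (L : ℂ) ^ (2 * n) * (L : ℂ) ^ (2 * n) := by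
      rw [← pow_add]; ring_nf
    rw [h2]
    field_simp
    ring
  have he : ∀ l q, ‖e l q‖ = 1 := fun l q => Lat.norm_char _ _
  have hNn : ‖1 / N‖ = 1 / ((T : ℝ) * (S : ℝ) ^ 3) := by
    rw [hN]; simp
  have b1 : ‖(L : ℂ) ^ (4 * n) * ((1 / N) * ∑ l : ZMod T, e l 0 * g l 0)‖
      ≤ zeroModeConst κ M a r * (1 + 4 / √(gapConst κ M)) := by
    refine le_trans ?_ hg.sum_greenDiag_zero_le
    rw [norm_mul, norm_pow, Complex.norm_natCast, norm_mul, hNn]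
    gcongr
    refine norm_sum_le_of_le _ fun l _ => ?_
    rw [norm_mul, he, one_mul]
  have b2 : ‖(L : ℂ) ^ (4 * n) * ((1 / N) * ∑ q ∈ X, ∑ l : ZMod T,
      e l q * (g l q - 1 / A l q))‖
      ≤ 343 * (2 * a / gapConst κ M ^ 2 + 1 / gapConst κ M) := by
    refine le_trans ?_ hg.sum_greenDiag_sub_inv_le
    rw [norm_mul, norm_pow, Complex.norm_natCast, norm_mul, hNn]
    gcongr
    refine norm_sum_le_of_le _ fun q _ => norm_sum_le_of_le _ fun l _ => ?_
    rw [norm_mul, he, one_mul]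
  have b3 : ‖(L : ℂ) ^ (2 * n) * ((1 / N) * ∑ q ∈ X, ∑ l : ZMod T,
      e l q / dSymbol ε ((l, q) : Lat T S) - waveInv ε y)‖
      ≤ 2 * riemannConst κ M * (1 + oneLength y.2) ^ 2 := by
    have h := hg.bounds.norm_sum_char_div_sub_waveInv_le (S := S) hg.κ_pos y
    have hR : 0 ≤ riemannConst κ M := by
      have := hg.bounds.M_nonneg
      have := hg.bounds.gapConst_pos hg.κ_pos
      have := hg.κ_pos
      have := momentumIntegral_nonneg
      have := Real.pi_pos
      unfold riemannConst secondDiffConst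
      positivity
    have h1 : (L : ℝ) ^ (2 * n) * (1 / (S : ℝ) ^ 2 + 1 / T) ≤ 2 := by
      have hS2 : (L : ℝ) ^ (2 * n) ≤ (S : ℝ) ^ 2 := by
        rw [mul_comm, pow_mul]
        exact pow_le_pow_left₀ (by positivity) hg.pow_le_S 2
      rw [mul_add, mul_one_div, mul_one_div]
      have e1 := (div_le_one (show 0 < (S : ℝ) ^ 2 by positivity)).mpr hS2
      have e2 := (div_le_one hT).mpr hg.pow_le_T
      linarith
    rw [norm_mul, norm_pow, Complex.norm_natCast]
    calc _ ≤ (L : ℝ) ^ (2 * n) * (riemannConst κ M * (1 + oneLength y.2) ^ 2 *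
          (1 / (S : ℝ) ^ 2 + 1 / T)) := mul_le_mul_of_nonneg_left h (by positivity)
      _ = riemannConst κ M * (1 + oneLength y.2) ^ 2 *
          ((L : ℝ) ^ (2 * n) * (1 / (S : ℝ) ^ 2 + 1 / T)) := by ring
      _ ≤ riemannConst κ M * (1 + oneLength y.2) ^ 2 * 2 :=
          mul_le_mul_of_nonneg_left h1 (by positivity)
      _ = _ := by ring
  rw [hsplit]
  refine norm_add₃_le.trans ?_
  have hq : (1 : ℝ) ≤ (1 + oneLength y.2) ^ 2 := by nlinarith
  have c1 := b1.trans (le_mul_of_one_le_right ((norm_nonneg _).trans b1) hq)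
  have c2 := b2.trans (le_mul_of_one_le_right ((norm_nonneg _).trans b2) hq)
  calc _ ≤ _ := add_le_add (add_le_add c1 c2) b3
    _ = _ := by rw [greenConst]; ring

end

/-! ### Tree lengths -/

open scoped Classical in
/-- In a connected graph, the distance of two vertices is at most the sum of all edge lengths, where
each edge is counted in both orientations. -/
lemma dist_le_sum_adj {V : Type*} [Fintype V] {G : SimpleGraph V} (hG : G.Connected)
    {δ : V → V → ℝ} (h0 : ∀ v, δ v v = 0) (hnn : ∀ u v, 0 ≤ δ u v)
    (htri : ∀ u v w, δ u w ≤ δ u v + δ v w) (u v : V) :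
    δ u v ≤ ∑ b, ∑ c, if G.Adj b c then δ b c else 0 := by
  obtain ⟨p, hp⟩ := hG.exists_isPath u v
  have hwalk : ∀ {u v : V} (p : G.Walk u v),
      δ u v ≤ ((p.darts.map fun d => d.toProd).map fun z => δ z.1 z.2).sum := by
    intro u v p
    induction p with
    | nil => simp [h0]
    | cons h p ih =>
      simp only [SimpleGraph.Walk.darts_cons, List.map_cons, List.sum_cons]
      exact (htri _ _ _).trans (by linarith)
  -- a path traverses each edge at most once
  have hnodup : (p.darts.map fun d => d.toProd).Nodup := by
    refine List.Nodup.map SimpleGraph.Dart.toProd_injective ?_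
    exact List.Nodup.of_map _ hp.isTrail.edges_nodup
  refine (hwalk p).trans ?_
  rw [← List.sum_toFinset _ hnodup, ← Fintype.sum_prod_type']
  calc _ = ∑ z ∈ (p.darts.map fun d => d.toProd).toFinset,
        if G.Adj z.1 z.2 then δ z.1 z.2 else 0 := by
        refine Finset.sum_congr rfl fun z hz => ?_
        simp only [List.mem_toFinset, List.mem_map] at hz
        obtain ⟨d, -, rfl⟩ := hz
        rw [if_pos d.adj]
    _ ≤ _ := Finset.sum_le_sum_of_subset_of_nonneg (Finset.subset_univ _) fun z _ _ => by
        split_ifs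
        exacts [hnn _ _, le_rfl]

lemma spatialLength_eq_norm (z : Fin 3 → ℤ) :
    spatialLength z = ‖WithLp.toLp 2 (fun i => (z i : ℝ))‖ := by
  rw [spatialLength, EuclideanSpace.norm_eq]
  simp

lemma spatialLength_add_le (x y : Fin 3 → ℤ) :
    spatialLength (x + y) ≤ spatialLength x + spatialLength y := by
  simp only [spatialLength_eq_norm]
  refine le_trans (le_of_eq ?_) (norm_add_le _ _)
  congr 1
  ext i
  simp

open scoped Classical in
/-- The spatial extension of a configuration is controlled by its tree length. -/
lemma oneLength_sub_le_treeLength {T r : ℕ} (x : Fin r → BoldLat T) (i j : Fin r) :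
    oneLength ((x i).2 - (x j).2) ≤ 4 * treeLength x := by
  have hr : Nonempty (Fin r) := ⟨i⟩
  refine (oneLength_le_spatialLength _).trans ?_
  suffices h : spatialLength ((x i).2 - (x j).2) / 2 ≤ treeLength x by linarith
  refine le_csInf ?_ ?_
  · obtain ⟨G, -, hG⟩ := (SimpleGraph.connected_top (V := Fin r)).exists_isTree_le
    exact ⟨_, r, x, G, hG, fun i => ⟨i, rfl⟩, rfl⟩
  · rintro l ⟨N, p, G, hG, hx, rfl⟩
    obtain ⟨b, hb⟩ := hx i
    obtain ⟨c, hc⟩ := hx j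
    have h := dist_le_sum_adj (G := G) hG.connected
      (δ := fun b c => spatialLength ((p b).2 - (p c).2))
      (fun v => by simp [spatialLength]) (fun u v => Real.sqrt_nonneg _)
      (fun u v w => by
        refine le_trans (le_of_eq ?_) (spatialLength_add_le _ _)
        rw [sub_add_sub_cancel]) b c
    have hle : ∀ b c, spatialLength ((p b).2 - (p c).2) ≤ boldDist (p b) (p c) := by
      intro b c
      refine Real.sqrt_le_sqrt ?_
      simp only [Pi.sub_apply, Int.cast_sub]
      linarith [sq_nonneg ((((p b).1 - (p c).1).valMinAbs : ℝ))]
    rw [← hb, ← hc]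
    have h2 : (∑ b, ∑ c, if G.Adj b c then spatialLength ((p b).2 - (p c).2) else 0)
        ≤ ∑ b, ∑ c, if G.Adj b c then boldDist (p b) (p c) else 0 := by
      refine Finset.sum_le_sum fun b _ => Finset.sum_le_sum fun c _ => ?_
      split_ifs
      exacts [hle b c, le_rfl]
    linarith

/-! ### The interaction -/

section

variable {T : ℕ} {V : (Fin 4 → BoldLat T) → ℂ} {m : ℝ}

/-- The configurations whose first point is the origin. -/
def consZeroEquiv (T : ℕ) :
    (Fin 3 → BoldLat T) ≃ {x : Fin 4 → BoldLat T // x 0 = 0} where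
  toFun x := ⟨Fin.cons 0 x, rfl⟩
  invFun x := Fin.tail x.1
  left_inv x := by simp
  right_inv x := by
    obtain ⟨x, hx⟩ := x
    refine Subtype.ext ?_
    change Fin.cons 0 (Fin.tail x) = x
    rw [← hx]
    exact Fin.cons_self_tail x

/-- The norm dominates the sum with the first point fixed at the origin. -/
lemma tsum_ofReal_le_kernelNorm (M : ℝ) :
    ∑' x : Fin 3 → BoldLat T, ENNReal.ofReal (‖V (Fin.cons 0 x)‖ *
      Real.exp (M * treeLength (Fin.cons 0 x : Fin 4 → BoldLat T))) ≤ kernelNorm M V := by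
  rw [kernelNorm]
  refine le_trans (le_of_eq ?_) (le_iSup₂ (f := fun (i : Fin 4) (y : BoldLat T) =>
    ∑' x : {x : Fin 4 → BoldLat T // x i = y},
      ENNReal.ofReal (‖V x.1‖ * Real.exp (M * treeLength x.1))) 0 0)
  exact (consZeroEquiv T).tsum_eq fun x =>
    ENNReal.ofReal (‖V x.1‖ * Real.exp (M * treeLength x.1))

lemma summable_weighted {M : ℝ} (hV : kernelNorm M V ≠ ⊤) :
    Summable fun x : Fin 3 → BoldLat T => ‖V (Fin.cons 0 x)‖ *
      Real.exp (M * treeLength (Fin.cons 0 x : Fin 4 → BoldLat T)) := by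
  have h := ENNReal.summable_toReal (ne_top_of_le_ne_top hV (tsum_ofReal_le_kernelNorm M))
  refine h.congr fun x => ?_
  rw [ENNReal.toReal_ofReal (by positivity)]

lemma tsum_weighted_le {M : ℝ} (hV : kernelNorm M V ≠ ⊤) :
    ∑' x : Fin 3 → BoldLat T, ‖V (Fin.cons 0 x)‖ *
      Real.exp (M * treeLength (Fin.cons 0 x : Fin 4 → BoldLat T)) ≤ (kernelNorm M V).toReal := by
  refine le_trans (le_of_eq ?_) (ENNReal.toReal_mono hV (tsum_ofReal_le_kernelNorm M))
  rw [ENNReal.tsum_toReal_eq fun _ => ENNReal.ofReal_ne_top]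
  refine tsum_congr fun x => ?_
  rw [ENNReal.toReal_ofReal (by positivity)]

/-- The quadratic growth in the separation of the points is absorbed into the exponential weight. -/
lemma one_add_oneLength_sq_le (hm : 0 < m) (x : Fin 3 → BoldLat T) :
    (1 + oneLength (x 2).2) ^ 2 ≤ (2 + 16 / m ^ 2) *
      Real.exp (2 * m * treeLength (Fin.cons 0 x : Fin 4 → BoldLat T)) := by
  set τ := treeLength (Fin.cons 0 x : Fin 4 → BoldLat T)
  have h := oneLength_sub_le_treeLength (Fin.cons 0 x : Fin 4 → BoldLat T) 3 0
  have h3 : (Fin.cons 0 x : Fin 4 → BoldLat T) 3 = x 2 := rfl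
  have h0 : (Fin.cons 0 x : Fin 4 → BoldLat T) 0 = 0 := rfl
  rw [h3, h0, Prod.snd_zero, sub_zero] at h
  have hY := oneLength_nonneg (x 2).2
  have hτ : 0 ≤ τ := by linarith
  have h1 := sq_le_exp (m := 2 * m) (by positivity) hτ
  have h2 : 1 ≤ Real.exp (2 * m * τ) := Real.one_le_exp (by positivity)
  have h5 : (1 + oneLength (x 2).2) ^ 2 ≤ (1 + 4 * τ) ^ 2 :=
    pow_le_pow_left₀ (by linarith) (by linarith) 2
  have h6 : (2 + 16 / m ^ 2) * Real.exp (2 * m * τ)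
      = 2 * Real.exp (2 * m * τ) + 32 * (2 / (2 * m) ^ 2 * Real.exp (2 * m * τ)) := by
    field_simp; ring
  rw [h6]
  nlinarith [sq_nonneg (1 - 4 * τ)]

lemma summable_norm_of_kernelNorm (hm : 0 < m) (hV : kernelNorm (2 * m) V ≠ ⊤) :
    Summable fun x : Fin 3 → BoldLat T => ‖V (Fin.cons 0 x)‖ := by
  refine (((summable_weighted hV).mul_left (2 + 16 / m ^ 2))).of_nonneg_of_le
    (fun x => norm_nonneg _) fun x => ?_
  have h1 := one_add_oneLength_sq_le hm x
  have h2 : (1 : ℝ) ≤ (1 + oneLength (x 2).2) ^ 2 := by nlinarith [oneLength_nonneg (x 2).2]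
  calc ‖V (Fin.cons 0 x)‖ ≤ ‖V (Fin.cons 0 x)‖ * _ :=
        le_mul_of_one_le_right (norm_nonneg _) (h2.trans h1)
    _ = _ := by ring

variable {S : ℕ} [NeZero T] [NeZero S]

lemma boldLift_proj (a : Lat T S) : a.boldLift.proj S = a := by
  ext <;> simp [Lat.boldLift, BoldLat.proj]

lemma proj_add (x y : BoldLat T) : (x + y).proj S = x.proj S + y.proj S := by
  ext <;> simp [BoldLat.proj]

open scoped Classical in
/-- By translation invariance, the periodized interaction is a sum over the separations from the
first point. -/
lemma periodize_eq (hV : TranslationInvariant V) (u : Fin 4 → Lat T S) :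
    periodize S V u = ∑' x : Fin 3 → BoldLat T,
      if (fun i => u 0 + (x i).proj S) = Fin.tail u then V (Fin.cons 0 x) else 0 := by
  set φ : (Fin 3 → BoldLat T) → (Fin 4 → BoldLat T) := fun x =>
    Fin.cons (u 0).boldLift fun i => (u 0).boldLift + x i with hφ
  have hinj : Function.Injective φ := by
    intro x x' h
    funext i
    have := congrFun h i.succ
    simpa [hφ] using this
  rw [periodize, ← hinj.tsum_eq]
  · refine tsum_congr fun x => ?_
    have hVx : V (φ x) = V (Fin.cons 0 x) := by
      rw [← hV (u 0).boldLift (Fin.cons 0 x)]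
      congr 1
      funext i
      refine Fin.cases ?_ (fun i => ?_) i
      · simp [hφ]
      · simp [hφ, add_comm]
    rw [hVx]
    refine if_congr ?_ rfl rfl
    rw [funext_iff, Fin.forall_fin_succ]
    simp only [hφ, Fin.cons_zero, Fin.cons_succ, true_and, boldLift_proj, proj_add, Fin.tail]
  · intro y hy
    rw [Function.mem_support, ne_eq, ite_eq_right_iff, Classical.not_imp] at hy
    refine ⟨fun i => y i.succ - (u 0).boldLift, ?_⟩
    funext i
    refine Fin.cases ?_ (fun i => ?_) i
    · simp [hφ, hy.1.1]
    · simp [hφ]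

/-- Integrating the periodized interaction against a kernel on the torus: the points are resolved
into the first one and the separations from it. -/
lemma sum_periodize_mul (hV : TranslationInvariant V)
    (hsum : Summable fun x : Fin 3 → BoldLat T => ‖V (Fin.cons 0 x)‖)
    (G : Lat T S → Lat T S → ℂ) :
    ∑ u : Fin 4 → Lat T S, periodize S V u * G (u 3) (u 0)
      = ∑' x : Fin 3 → BoldLat T, V (Fin.cons 0 x) * ∑ a, G (a + (x 2).proj S) a := by
  classical
  have hs : ∀ u : Fin 4 → Lat T S, Summable fun x : Fin 3 → BoldLat T =>
      (if (fun i => u 0 + (x i).proj S) = Fin.tail u then V (Fin.cons 0 x) else 0)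
        * G (u 3) (u 0) := by
    intro u
    refine Summable.mul_right _ (Summable.of_norm_bounded hsum fun x => ?_)
    split_ifs
    · exact le_rfl
    · simp
  simp only [periodize_eq hV, ← tsum_mul_right]
  rw [← Summable.tsum_finsetSum fun u _ => hs u]
  refine tsum_congr fun x => ?_
  rw [← (Fin.consEquiv fun _ : Fin 4 => Lat T S).sum_comp, Fintype.sum_prod_type, Finset.mul_sum]
  refine Finset.sum_congr rfl fun a _ => ?_
  rw [Finset.sum_eq_single fun i => a + (x i).proj S]
  · simp [Fin.consEquiv, Fin.cons_zero]
    left; rfl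
  · intro v _ hv
    rw [if_neg, zero_mul]
    intro h
    exact hv (by simpa [Fin.consEquiv] using h.symm)
  · simp

end

/-! ### The comparison of the chemical potentials -/

section

variable {L r n T S T' S' : ℕ} [NeZero L] [NeZero T] [NeZero S] [NeZero T'] [NeZero S']
  {κ M a m : ℝ} {ε : (Fin 3 → ℝ) → ℝ} {H : Fin 3 → Fin 3 → (Fin 3 → ℤ) → ℝ}
  {V : (Fin 4 → BoldLat T) → ℂ}

lemma summable_mul_waveInv (hε : DispersionBounds κ M ε) (hκ : 0 < κ) (hm : 0 < m)
    (hV : kernelNorm (2 * m) V ≠ ⊤) :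
    Summable fun x : Fin 3 → BoldLat T => V (Fin.cons 0 x) * waveInv ε (x 2) := by
  refine Summable.of_norm_bounded ((summable_norm_of_kernelNorm hm hV).mul_right
    (1 / (2 * Real.pi) ^ 3 * (1 / gapConst κ M * momentumIntegral))) fun x => ?_
  rw [norm_mul]
  exact mul_le_mul_of_nonneg_left (hε.norm_waveInv_le hκ _) (norm_nonneg _)

/-- With the volume factors collected, `μ_n^*` is an average over translates of the Green's
function. -/
lemma GreenSetup.muStarN_eq (hg : GreenSetup κ M a ε H L r n T S T' S')
    (hinv : TranslationInvariant V)
    (hsum : Summable fun x : Fin 3 → BoldLat T => ‖V (Fin.cons 0 x)‖) (μ₀ : ℝ) :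
    muStarN H a L r n S T' S' V μ₀ = (L : ℂ) ^ (2 * n) * (μ₀ : ℂ)
      - 2 * ∑' x : Fin 3 → BoldLat T, V (Fin.cons 0 x) *
        ((L : ℂ) ^ (4 * n) * ((1 / (Fintype.card (Lat T S) : ℂ)) *
          ∑ u, (greenInv H a L r n T S T' S')⁻¹ (u + (x 2).proj S) u)) := by
  have hLc : (L : ℂ) ≠ 0 := by exact_mod_cast NeZero.ne L
  have hc := Lat.card_ne_zero (T := T') (S := S')
  have hcard : (Fintype.card (Lat T S) : ℂ) = (L : ℂ) ^ (5 * n) * Fintype.card (Lat T' S') := by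
    rw [Lat.card_eq, Lat.card_eq, hg.time, hg.space]
    push_cast
    ring
  have h1 : ∑ u : Fin 4 → Lat T S,
      scaledInteraction L n S V u * greenKernel H a L r n T S T' S' (u 3) (u 0)
      = (L : ℂ) ^ (19 * n) * ∑' x : Fin 3 → BoldLat T, V (Fin.cons 0 x) *
        ∑ u, (greenInv H a L r n T S T' S')⁻¹ (u + (x 2).proj S) u := by
    rw [← sum_periodize_mul hinv hsum fun u v => (greenInv H a L r n T S T' S')⁻¹ u v,
      Finset.mul_sum]
    refine Finset.sum_congr rfl fun u _ => ?_
    rw [scaledInteraction, greenKernel, show 19 * n = 14 * n + 5 * n by ring, pow_add]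
    ring
  have h2 : ∀ x : Fin 3 → BoldLat T, V (Fin.cons 0 x) *
        ((L : ℂ) ^ (4 * n) * ((1 / (Fintype.card (Lat T S) : ℂ)) *
          ∑ u, (greenInv H a L r n T S T' S')⁻¹ (u + (x 2).proj S) u))
      = ((L : ℂ) ^ (4 * n) / (Fintype.card (Lat T S) : ℂ)) * (V (Fin.cons 0 x) *
        ∑ u, (greenInv H a L r n T S T' S')⁻¹ (u + (x 2).proj S) u) := fun x => by ring
  rw [muStarN, h1]
  simp only [h2]
  rw [tsum_mul_left, hcard, show (L : ℂ) ^ (19 * n) = ((L : ℂ) ^ n) ^ 19 by rw [← pow_mul]; ring,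
    show (L : ℂ) ^ (5 * n) = ((L : ℂ) ^ n) ^ 5 by rw [← pow_mul]; ring,
    show (L : ℂ) ^ (4 * n) = ((L : ℂ) ^ n) ^ 4 by rw [← pow_mul]; ring]
  field_simp

/-- The quadratic growth of the comparison between Green's function and propagator is absorbed by
the exponential weight in the norm of the interaction. -/
lemma GreenSetup.norm_muStar_sub_le (hg : GreenSetup κ M a ε H L r n T S T' S') (hm : 0 < m)
    (hinv : TranslationInvariant V) (hV : kernelNorm (2 * m) V ≠ ⊤)
    (hD : ∀ x : BoldLat T, boldDInv H T x = waveInv ε x) (μ₀ : ℝ) :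
    ‖(L : ℂ) ^ (2 * n) * ((μ₀ : ℂ) - muStar H V) - muStarN H a L r n S T' S' V μ₀‖
      ≤ greenConst κ M a r * (2 + 16 / m ^ 2) * coupling m V := by
  have hsum := summable_norm_of_kernelNorm hm hV
  set Ψ : BoldLat T → ℂ := fun y => (L : ℂ) ^ (4 * n) * ((1 / (Fintype.card (Lat T S) : ℂ)) *
        ∑ u, (greenInv H a L r n T S T' S')⁻¹ (u + y.proj S) u)
      - (L : ℂ) ^ (2 * n) * waveInv ε y with hΨ
  have hΨle : ∀ y, ‖Ψ y‖ ≤ greenConst κ M a r * (1 + oneLength y.2) ^ 2 :=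
    fun y => hg.norm_translate_average_sub_le y
  have hC : 0 ≤ greenConst κ M a r := by
    have := (norm_nonneg _).trans (hΨle 0)
    simpa [oneLength] using this
  have hterm : ∀ x : Fin 3 → BoldLat T, ‖V (Fin.cons 0 x) * Ψ (x 2)‖
      ≤ greenConst κ M a r * (2 + 16 / m ^ 2) * (‖V (Fin.cons 0 x)‖ *
        Real.exp (2 * m * treeLength (Fin.cons 0 x : Fin 4 → BoldLat T))) := by
    intro x
    rw [norm_mul]
    calc ‖V (Fin.cons 0 x)‖ * ‖Ψ (x 2)‖
        ≤ ‖V (Fin.cons 0 x)‖ * (greenConst κ M a r * ((2 + 16 / m ^ 2) *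
          Real.exp (2 * m * treeLength (Fin.cons 0 x : Fin 4 → BoldLat T)))) := by
          refine mul_le_mul_of_nonneg_left ((hΨle _).trans ?_) (norm_nonneg _)
          exact mul_le_mul_of_nonneg_left (one_add_oneLength_sq_le hm x) hC
      _ = _ := by ring
  have hw := (summable_weighted hV).mul_left (greenConst κ M a r * (2 + 16 / m ^ 2))
  have hΨsum : Summable fun x : Fin 3 → BoldLat T => V (Fin.cons 0 x) * Ψ (x 2) :=
    Summable.of_norm_bounded hw hterm
  have hDsum := summable_mul_waveInv (V := V) hg.bounds hg.κ_pos hm hV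
  have hid : (L : ℂ) ^ (2 * n) * ((μ₀ : ℂ) - muStar H V) - muStarN H a L r n S T' S' V μ₀
      = 2 * ∑' x : Fin 3 → BoldLat T, V (Fin.cons 0 x) * Ψ (x 2) := by
    have h1 : ∀ x : Fin 3 → BoldLat T, V (Fin.cons 0 x) *
        ((L : ℂ) ^ (4 * n) * ((1 / (Fintype.card (Lat T S) : ℂ)) *
          ∑ u, (greenInv H a L r n T S T' S')⁻¹ (u + (x 2).proj S) u))
        = V (Fin.cons 0 x) * Ψ (x 2)
          + (L : ℂ) ^ (2 * n) * (V (Fin.cons 0 x) * waveInv ε (x 2)) := by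
      intro x
      simp only [hΨ]
      ring
    rw [hg.muStarN_eq hinv hsum, muStar]
    simp only [h1, hD]
    rw [hΨsum.tsum_add (hDsum.mul_left _), tsum_mul_left]
    ring
  rw [hid, norm_mul, Complex.norm_ofNat, coupling]
  have hbound := tsum_of_norm_bounded hw.hasSum hterm
  rw [tsum_mul_left] at hbound
  have hC2 : 0 ≤ greenConst κ M a r * (2 + 16 / m ^ 2) := by positivity
  have := mul_le_mul_of_nonneg_left (tsum_weighted_le hV) hC2
  linarith

end

end

end ParabolicFlow

theorem mainTheorem7
    (m cH DH a : ℝ) (hm : 0 < m) (hcH : 0 < cH) (ha : 0 < a) (r : ℕ) (hr : 1 ≤ r) :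
    ∃ c : ℝ,
      ∀ H : Fin 3 → Fin 3 → (Fin 3 → ℤ) → ℝ, IsBondOperator m cH DH H →
      ∀ (Ltp Lsp : ℕ) [NeZero Ltp] [NeZero Lsp] (V : (Fin 4 → BoldLat Ltp) → ℂ),
        TranslationInvariant V → kernelNorm (2 * m) V ≠ ⊤ →
        -- the integrals in the definition of `μ_*` converge absolutely
        ((∀ (x : BoldLat Ltp) (l : Fin Ltp),
            MeasureTheory.IntegrableOn (boldDInvIntegrand H Ltp x l) momentumCell) ∧
          Summable fun x : Fin 3 → BoldLat Ltp => V (Fin.cons 0 x) * boldDInv H Ltp (x 2)) ∧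
        ∀ (L : ℕ) [NeZero L], Odd L → 1 < L →
        ∀ (μ₀ : ℝ) (n : ℕ), 1 ≤ n →
        -- the blocked lattice after `n` steps has size `(T', S')`
        ∀ (T' S' : ℕ) [NeZero T'] [NeZero S'], Ltp = L ^ (2 * n) * T' → Lsp = L ^ n * S' →
          -- the inverses in the definition of `S_n` exist
          IsUnit (frakQInv L r n T' S') ∧
          IsUnit (greenInv H a L r n Ltp Lsp T' S') ∧
          ‖(L : ℂ) ^ (2 * n) * ((μ₀ : ℂ) - muStar H V) - muStarN H a L r n Lsp T' S' V μ₀‖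
            ≤ c * coupling m V := by
  refine ⟨greenConst (cH / 25) (4 * momentConst m * DH) a r * (2 + 16 / m ^ 2),
    fun H hH T S _ _ V hinv hV => ⟨⟨fun x l => hH.integrableOn_boldDInvIntegrand hm hcH x l, ?_⟩,
      fun L _ hodd hL μ₀ n _ T' S' _ _ hT hS => ?_⟩⟩
  · simp only [hH.boldDInv_eq hm]
    exact summable_mul_waveInv (hH.dispersionBounds hm hcH) (by positivity) hm hV
  · have hg : GreenSetup (cH / 25) (4 * momentConst m * DH) a (dispersion H) H L r n T S T' S' :=
      { odd := hodd
        one_lt := hL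
        one_le_r := hr
        a_pos := ha
        κ_pos := by positivity
        time := hT
        space := hS
        bounds := hH.dispersionBounds hm hcH
        symbol := torusD_mulVec_char hH hm }
    exact ⟨isUnit_frakQInv n,
      isUnit_greenInv hodd ha hT hS hg.bounds hg.κ_pos hg.symbol,
      hg.norm_muStar_sub_le hm hinv hV (hH.boldDInv_eq hm) μ₀⟩
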